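/- Work in homotopy type theory: Martin-Löf type theory with a univalent universe $\mathcal{U}$ that contains $\mathbf{0}$, $\mathbf{1}$, $\mathbb{N}$, dependent function types, dependent pair types, disjoint sums and identity types and is closed under graph quotients (the higher inductive types $\mathrm{colim}(\Gamma)$ of a type of vertices $\Gamma_0:\mathcal{U}$ and edges $\Gamma_1:\Gamma_0\to\Gamma_0\to\mathcal{U}$, with constructors $\Gamma_0\to\mathrm{colim}(\Gamma)$ and $\prod_{i,j}\Gamma_1(i,j)\to(i=j)$, and induction into type families of any size), and with function extensionality for types of any size. Homotopy pushouts are formed from graph quotients. For $f:A\to X$, let $\mathrm{fib}_f(x):=\sum_{a:A}f(a)=x$. The join $P*Q$ of two types is the pushout of $P\leftarrow P\times Q\to Q$. For maps $f:A\to X$ and $g:B\to X$, let $A\times_X B:=\sum_{a:A}\sum_{b:B}f(a)=g(b)$, let $A*_X B$ be the pushout of the projections $A\leftarrow A\times_X B\to B$, and let the join of maps $f*g:A*_X B\to X$ be the map induced by $f$, $g$ and the canonical homotopy $f\circ\pi_1\sim g\circ\pi_2$. **Theorem.** Let $A,B,X:\mathcal{U}$, let $f:A\to X$ and $g:B\to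 X$ be maps, and let $x:X$. Then there is an equivalence $$\mathrm{fib}_{f*g}(x)\simeq \mathrm{fib}_f(x)*\mathrm{fib}_g(x).$$ That is, there is a closed term of type $$\prod_{A,B,X:\mathcal{U}}\ \prod_{f:A\to X}\ \prod_{g:B\to X}\ \prod_{x:X}\ \mathrm{fib}_{f*g}(x)\simeq \mathrm{fib}_f(x)*\mathrm{fib}_g(x).$$ -/

import Mathlib

/-!
Homotopy type theory as a formal system: Martin-Löf type theory with one univalent universe `U`
(in the style of Russell) that contains the usual types and is closed under graph quotients, and
with function extensionality for types of any size.  The presentation is that of the first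
presentation in the appendix of the book "Homotopy Type Theory": raw terms, a convertibility
relation on raw terms, and typing judgments.
-/

namespace HoTT

/-! ### Raw terms and substitution -/

/-- Raw terms (types are terms as well), with de Bruijn indices: `var 0` is the variable that was
bound last.  Binding arguments: `B` in `pi A B` and `sigma A B`, the body of `lam`, `B` in `funext A B f g`
and the motive `P` of each eliminator bind one variable; the motive `C` of `J C d p` binds two variables (the
endpoint, `var 1`, and the path, `var 0`).  The other arguments of the eliminators bind nothing:
where a method depends on variables, it is a term of a dependent function type. -/
inductive Tm : Type
  | var (n : ℕ)
  | univ
  | pi (A B : Tm)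
  | lam (t : Tm)
  | app (f a : Tm)
  | sigma (A B : Tm)
  | pair (a b : Tm)
  | sigmaElim (P m t : Tm)
  | id (A a b : Tm)
  | refl (a : Tm)
  | J (C d p : Tm)
  | empty
  | emptyElim (P t : Tm)
  | unit
  | star
  | unitElim (P c t : Tm)
  | nat
  | zero
  | succ (n : Tm)
  | natElim (P z s n : Tm)
  | sum (A B : Tm)
  | inl (a : Tm)
  | inr (b : Tm)
  | sumElim (P l r t : Tm)
  /-- the graph quotient of the graph with vertices `V` and edges `E : V → V → U` -/
  | gq (V E : Tm)
  | vert (i : Tm)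
  /-- the path constructor of `gq V E` -/
  | edge (V E i j e : Tm)
  | gqElim (P v d t : Tm)
  /-- the propositional computation rule of `gqElim` on the path constructor `edge` -/
  | gqComp (V E P v d i j e : Tm)
  /-- the axiom of function extensionality at `f g : ∏ (x : A), B(x)` -/
  | funext (A B f g : Tm)
  /-- the univalence axiom at `A` and `B` -/
  | ua (A B : Tm)

namespace Tm

/-- Extension of a renaming under one binder. -/
def upRen (ξ : ℕ → ℕ) : ℕ → ℕ
  | 0 => 0
  | n + 1 => ξ n + 1

/-- Renaming of the free variables. -/
def rename : (ℕ → ℕ) → Tm → Tm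
  | ξ, var n => var (ξ n)
  | _, univ => univ
  | ξ, pi A B => pi (A.rename ξ) (B.rename (upRen ξ))
  | ξ, lam t => lam (t.rename (upRen ξ))
  | ξ, app f a => app (f.rename ξ) (a.rename ξ)
  | ξ, sigma A B => sigma (A.rename ξ) (B.rename (upRen ξ))
  | ξ, pair a b => pair (a.rename ξ) (b.rename ξ)
  | ξ, sigmaElim P m t => sigmaElim (P.rename (upRen ξ)) (m.rename ξ) (t.rename ξ)
  | ξ, id A a b => id (A.rename ξ) (a.rename ξ) (b.rename ξ)
  | ξ, refl a => refl (a.rename ξ)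
  | ξ, J C d p => J (C.rename (upRen (upRen ξ))) (d.rename ξ) (p.rename ξ)
  | _, empty => empty
  | ξ, emptyElim P t => emptyElim (P.rename (upRen ξ)) (t.rename ξ)
  | _, unit => unit
  | _, star => star
  | ξ, unitElim P c t => unitElim (P.rename (upRen ξ)) (c.rename ξ) (t.rename ξ)
  | _, nat => nat
  | _, zero => zero
  | ξ, succ n => succ (n.rename ξ)
  | ξ, natElim P z s n =>
      natElim (P.rename (upRen ξ)) (z.rename ξ) (s.rename ξ) (n.rename ξ)
  | ξ, sum A B => sum (A.rename ξ) (B.rename ξ)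
  | ξ, inl a => inl (a.rename ξ)
  | ξ, inr b => inr (b.rename ξ)
  | ξ, sumElim P l r t =>
      sumElim (P.rename (upRen ξ)) (l.rename ξ) (r.rename ξ) (t.rename ξ)
  | ξ, gq V E => gq (V.rename ξ) (E.rename ξ)
  | ξ, vert i => vert (i.rename ξ)
  | ξ, edge V E i j e =>
      edge (V.rename ξ) (E.rename ξ) (i.rename ξ) (j.rename ξ) (e.rename ξ)
  | ξ, gqElim P v d t =>
      gqElim (P.rename (upRen ξ)) (v.rename ξ) (d.rename ξ) (t.rename ξ)
  | ξ, gqComp V E P v d i j e =>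
      gqComp (V.rename ξ) (E.rename ξ) (P.rename (upRen ξ)) (v.rename ξ) (d.rename ξ) (i.rename ξ)
        (j.rename ξ) (e.rename ξ)
  | ξ, funext A B f g =>
      funext (A.rename ξ) (B.rename (upRen ξ)) (f.rename ξ) (g.rename ξ)
  | ξ, ua A B => ua (A.rename ξ) (B.rename ξ)

/-- Weakening by `k` variables. -/
def wk (k : ℕ) (t : Tm) : Tm := t.rename (fun n => n + k)

/-- Weakening by `k` variables that leaves the variable bound last in place. -/
def wkUp (k : ℕ) (t : Tm) : Tm := t.rename (upRen (fun n => n + k))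

/-- Extension of a substitution under one binder. -/
def upSubst (σ : ℕ → Tm) : ℕ → Tm
  | 0 => var 0
  | n + 1 => (σ n).wk 1

/-- Simultaneous substitution for the free variables. -/
def subst : (ℕ → Tm) → Tm → Tm
  | σ, var n => σ n
  | _, univ => univ
  | σ, pi A B => pi (A.subst σ) (B.subst (upSubst σ))
  | σ, lam t => lam (t.subst (upSubst σ))
  | σ, app f a => app (f.subst σ) (a.subst σ)
  | σ, sigma A B => sigma (A.subst σ) (B.subst (upSubst σ))
  | σ, pair a b => pair (a.subst σ) (b.subst σ)
  | σ, sigmaElim P m t => sigmaElim (P.subst (upSubst σ)) (m.subst σ) (t.subst σ)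
  | σ, id A a b => id (A.subst σ) (a.subst σ) (b.subst σ)
  | σ, refl a => refl (a.subst σ)
  | σ, J C d p => J (C.subst (upSubst (upSubst σ))) (d.subst σ) (p.subst σ)
  | _, empty => empty
  | σ, emptyElim P t => emptyElim (P.subst (upSubst σ)) (t.subst σ)
  | _, unit => unit
  | _, star => star
  | σ, unitElim P c t => unitElim (P.subst (upSubst σ)) (c.subst σ) (t.subst σ)
  | _, nat => nat
  | _, zero => zero
  | σ, succ n => succ (n.subst σ)
  | σ, natElim P z s n =>
      natElim (P.subst (upSubst σ)) (z.subst σ) (s.subst σ) (n.subst σ)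
  | σ, sum A B => sum (A.subst σ) (B.subst σ)
  | σ, inl a => inl (a.subst σ)
  | σ, inr b => inr (b.subst σ)
  | σ, sumElim P l r t =>
      sumElim (P.subst (upSubst σ)) (l.subst σ) (r.subst σ) (t.subst σ)
  | σ, gq V E => gq (V.subst σ) (E.subst σ)
  | σ, vert i => vert (i.subst σ)
  | σ, edge V E i j e =>
      edge (V.subst σ) (E.subst σ) (i.subst σ) (j.subst σ) (e.subst σ)
  | σ, gqElim P v d t =>
      gqElim (P.subst (upSubst σ)) (v.subst σ) (d.subst σ) (t.subst σ)
  | σ, gqComp V E P v d i j e =>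
      gqComp (V.subst σ) (E.subst σ) (P.subst (upSubst σ)) (v.subst σ) (d.subst σ) (i.subst σ)
        (j.subst σ) (e.subst σ)
  | σ, funext A B f g =>
      funext (A.subst σ) (B.subst (upSubst σ)) (f.subst σ) (g.subst σ)
  | σ, ua A B => ua (A.subst σ) (B.subst σ)

/-- `t.inst a` is `t[a]`: the variable bound last is replaced by `a`. -/
def inst (t a : Tm) : Tm :=
  t.subst (fun n => match n with
    | 0 => a
    | n + 1 => var n)

/-- `t.inst₂ a b` is `t[a, b]`: `var 1` is replaced by `a` and `var 0` by `b`. -/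
def inst₂ (t a b : Tm) : Tm :=
  t.subst (fun n => match n with
    | 0 => b
    | 1 => a
    | n + 2 => var n)

/-- If `t` is a term over `Γ, z` and `a` a term over an extension of `Γ` by `k` variables, then
`t.instWk k a` is `t[a]` over that extension. -/
def instWk (k : ℕ) (t a : Tm) : Tm := (t.wkUp k).inst a

/-! ### Derived type and term formers

Each of them is a term over the same context as its arguments, except that an argument named `P`
is a type family `P(z)` over one further variable, and so is `B` in `happly`. -/

/-- Non-dependent function type `A → B`. -/
def arr (A B : Tm) : Tm := pi A (B.wk 1)

/-- Cartesian product `A × B`. -/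
def prod (A B : Tm) : Tm := sigma A (B.wk 1)

/-- Transport of `u : P(a)` along `p : a = b` to `P(b)`.  In `J`, the family `P` is regarded as
a family over the endpoint and the path. -/
def transport (P p u : Tm) : Tm := J (P.wk 1) u p

/-- For `f : ∏ z, P(z)` and `p : a = b`, the path `transport P p (f a) = f b`. -/
def apd (P f a p : Tm) : Tm :=
  J (id (P.wk 1) (transport (P.wkUp 2) (var 0) (app (f.wk 2) (a.wk 2))) (app (f.wk 2) (var 1)))
    (refl (app f a)) p

/-- Concatenation of `p : a = b` and `q : b = c` in the type `A`. -/
def concat (A a p q : Tm) : Tm := transport (id (A.wk 1) (a.wk 1) (var 0)) q p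

/-- The path `transport X p u = u` for a constant family `X`. -/
def transportConst (X p u : Tm) : Tm :=
  J (id (X.wk 2) (transport (X.wk 3) (var 0) (u.wk 2)) (u.wk 2)) (refl u) p

/-- `f : A → B` is an equivalence: it has a section `g` and a retraction `h`,
`(∑ g, ∏ y, f (g y) = y) × (∑ h, ∏ x, h (f x) = x)`. -/
def isEquiv (A B f : Tm) : Tm :=
  prod
    (sigma (arr B A)
      (pi (B.wk 1) (id (B.wk 2) (app (f.wk 2) (app (var 1) (var 0))) (var 0))))
    (sigma (arr B A)
      (pi (A.wk 1) (id (A.wk 2) (app (var 1) (app (f.wk 2) (var 0))) (var 0))))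

/-- The type `A ≃ B` of equivalences. -/
def equiv (A B : Tm) : Tm :=
  sigma (arr A B) (isEquiv (A.wk 1) (B.wk 1) (var 0))

/-- The identity equivalence (of any type). -/
def idEquiv : Tm :=
  pair (lam (var 0))
    (pair (pair (lam (var 0)) (lam (refl (var 0)))) (pair (lam (var 0)) (lam (refl (var 0)))))

/-- The canonical map `(A = B) → (A ≃ B)`, for `A B : U`. -/
def idToEquiv (A : Tm) : Tm :=
  lam (J (equiv (A.wk 3) (var 1)) idEquiv (var 0))

/-- The canonical map `(f = g) → ∏ x, f x = g x`, for `f g : ∏ x, B(x)`. -/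
def happly (A B f : Tm) : Tm :=
  lam (J (pi (A.wk 3) (id (B.wkUp 3) (app (f.wk 4) (var 0)) (app (var 2) (var 0))))
    (lam (refl (app (f.wk 2) (var 0)))) (var 0))

end Tm

open Tm

/-! ### Judgments -/

/-- Convertibility: the congruence on raw terms that is generated by the computation rules and by
the uniqueness rule for functions. -/
inductive Conv : Tm → Tm → Prop
  | rfl (t : Tm) : Conv t t
  | symm {s t : Tm} : Conv s t → Conv t s
  | trans {s t u : Tm} : Conv s t → Conv t u → Conv s u
  -- computation and uniqueness
  | beta (t a : Tm) : Conv (app (lam t) a) (t.inst a)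
  | eta (f : Tm) : Conv (lam (app (f.wk 1) (var 0))) f
  | sigmaElim_pair (P m a b : Tm) : Conv (sigmaElim P m (pair a b)) (app (app m a) b)
  | J_refl (C d a : Tm) : Conv (J C d (refl a)) d
  | unitElim_star (P c : Tm) : Conv (unitElim P c star) c
  | natElim_zero (P z s : Tm) : Conv (natElim P z s zero) z
  | natElim_succ (P z s n : Tm) :
      Conv (natElim P z s (succ n)) (app (app s n) (natElim P z s n))
  | sumElim_inl (P l r a : Tm) : Conv (sumElim P l r (inl a)) (app l a)
  | sumElim_inr (P l r b : Tm) : Conv (sumElim P l r (inr b)) (app r b)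
  | gqElim_vert (P v d i : Tm) : Conv (gqElim P v d (vert i)) (app v i)
  -- congruence
  | pi {A A' B B' : Tm} : Conv A A' → Conv B B' → Conv (pi A B) (pi A' B')
  | lam {t t' : Tm} : Conv t t' → Conv (lam t) (lam t')
  | app {f f' a a' : Tm} : Conv f f' → Conv a a' → Conv (app f a) (app f' a')
  | sigma {A A' B B' : Tm} : Conv A A' → Conv B B' → Conv (sigma A B) (sigma A' B')
  | pair {a a' b b' : Tm} : Conv a a' → Conv b b' → Conv (pair a b) (pair a' b')
  | sigmaElim {P P' m m' t t' : Tm} : Conv P P' → Conv m m' → Conv t t' →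
      Conv (sigmaElim P m t) (sigmaElim P' m' t')
  | id {A A' a a' b b' : Tm} : Conv A A' → Conv a a' → Conv b b' →
      Conv (id A a b) (id A' a' b')
  | refl {a a' : Tm} : Conv a a' → Conv (refl a) (refl a')
  | J {C C' d d' p p' : Tm} : Conv C C' → Conv d d' → Conv p p' →
      Conv (J C d p) (J C' d' p')
  | emptyElim {P P' t t' : Tm} : Conv P P' → Conv t t' →
      Conv (emptyElim P t) (emptyElim P' t')
  | unitElim {P P' c c' t t' : Tm} : Conv P P' → Conv c c' → Conv t t' →
      Conv (unitElim P c t) (unitElim P' c' t')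
  | succ {n n' : Tm} : Conv n n' → Conv (succ n) (succ n')
  | natElim {P P' z z' s s' n n' : Tm} : Conv P P' → Conv z z' → Conv s s' → Conv n n' →
      Conv (natElim P z s n) (natElim P' z' s' n')
  | sum {A A' B B' : Tm} : Conv A A' → Conv B B' → Conv (sum A B) (sum A' B')
  | inl {a a' : Tm} : Conv a a' → Conv (inl a) (inl a')
  | inr {b b' : Tm} : Conv b b' → Conv (inr b) (inr b')
  | sumElim {P P' l l' r r' t t' : Tm} : Conv P P' → Conv l l' → Conv r r' → Conv t t' →
      Conv (sumElim P l r t) (sumElim P' l' r' t')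
  | gq {V V' E E' : Tm} : Conv V V' → Conv E E' → Conv (gq V E) (gq V' E')
  | vert {i i' : Tm} : Conv i i' → Conv (vert i) (vert i')
  | edge {V V' E E' i i' j j' e e' : Tm} : Conv V V' → Conv E E' → Conv i i' → Conv j j' →
      Conv e e' → Conv (edge V E i j e) (edge V' E' i' j' e')
  | gqElim {P P' v v' d d' t t' : Tm} : Conv P P' → Conv v v' → Conv d d' → Conv t t' →
      Conv (gqElim P v d t) (gqElim P' v' d' t')
  | gqComp {V V' E E' P P' v v' d d' i i' j j' e e' : Tm} : Conv V V' → Conv E E' →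
      Conv P P' → Conv v v' → Conv d d' → Conv i i' → Conv j j' → Conv e e' →
      Conv (gqComp V E P v d i j e) (gqComp V' E' P' v' d' i' j' e')
  | funext {A A' B B' f f' g g' : Tm} : Conv A A' → Conv B B' → Conv f f' → Conv g g' →
      Conv (funext A B f g) (funext A' B' f' g')
  | ua {A A' B B' : Tm} : Conv A A' → Conv B B' → Conv (ua A B) (ua A' B')

/-- A context lists the types of the variables, the variable bound last (`var 0`) first; each type
is a term over the remaining part of the list. -/
abbrev Ctx := List Tm

/-- `isType A`: "`A` is a type" (of any size); `hasType t A`: "`t` is a term of type `A`". -/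
inductive Judgment : Type
  | isType (A : Tm)
  | hasType (t A : Tm)

infix:50 " ∶ " => Judgment.hasType

open Judgment

/-- The type of the second method of the eliminator `gqElim`, for the family `P` over the
quotient of the graph `(V, E)` and the first method `v`:
`∏ (i j : V) (e : E i j), transport P (edge i j e) (v i) = v j`. -/
def edgeMethod (V E P v : Tm) : Tm :=
  pi V (pi (V.wk 1) (pi (app (app (E.wk 2) (var 1)) (var 0))
    (id (P.instWk 3 (vert (var 1)))
      (transport (P.wkUp 3) (edge (V.wk 3) (E.wk 3) (var 2) (var 1) (var 0))
        (app (v.wk 3) (var 2)))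
      (app (v.wk 3) (var 1)))))

/-- Derivable judgments `Γ ⊢ 𝒥`.  Whenever a premise of a rule extends the context, the other
premises ensure that the context is extended by types, so that all contexts in a derivation over
the empty context are well-formed. -/
inductive Derives : Ctx → Judgment → Prop
  -- variables and conversion
  | var {Γ : Ctx} {n : ℕ} {A : Tm} : Γ[n]? = some A → Derives Γ (var n ∶ A.wk (n + 1))
  | conv {Γ : Ctx} {t A B : Tm} : Derives Γ (t ∶ A) → Derives Γ (isType B) → Conv A B →
      Derives Γ (t ∶ B)
  -- the universe
  | univ {Γ : Ctx} : Derives Γ (isType univ)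
  | el {Γ : Ctx} {A : Tm} : Derives Γ (A ∶ univ) → Derives Γ (isType A)
  -- dependent function types
  | pi {Γ : Ctx} {A B : Tm} : Derives Γ (isType A) → Derives (A :: Γ) (isType B) →
      Derives Γ (isType (pi A B))
  | pi_univ {Γ : Ctx} {A B : Tm} : Derives Γ (A ∶ univ) → Derives (A :: Γ) (B ∶ univ) →
      Derives Γ (pi A B ∶ univ)
  | lam {Γ : Ctx} {A B t : Tm} : Derives Γ (isType A) → Derives (A :: Γ) (t ∶ B) →
      Derives Γ (lam t ∶ pi A B)
  | app {Γ : Ctx} {A B f a : Tm} : Derives Γ (f ∶ pi A B) → Derives Γ (a ∶ A) →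
      Derives Γ (app f a ∶ B.inst a)
  -- dependent pair types
  | sigma {Γ : Ctx} {A B : Tm} : Derives Γ (isType A) → Derives (A :: Γ) (isType B) →
      Derives Γ (isType (sigma A B))
  | sigma_univ {Γ : Ctx} {A B : Tm} : Derives Γ (A ∶ univ) → Derives (A :: Γ) (B ∶ univ) →
      Derives Γ (sigma A B ∶ univ)
  | pair {Γ : Ctx} {A B a b : Tm} : Derives Γ (isType A) → Derives (A :: Γ) (isType B) →
      Derives Γ (a ∶ A) → Derives Γ (b ∶ B.inst a) → Derives Γ (pair a b ∶ sigma A B)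
  | sigmaElim {Γ : Ctx} {A B P m t : Tm} : Derives Γ (isType (sigma A B)) →
      Derives (sigma A B :: Γ) (isType P) →
      Derives Γ (m ∶ pi A (pi B (P.instWk 2 (pair (var 1) (var 0))))) →
      Derives Γ (t ∶ sigma A B) → Derives Γ (sigmaElim P m t ∶ P.inst t)
  -- identity types
  | id {Γ : Ctx} {A a b : Tm} : Derives Γ (isType A) → Derives Γ (a ∶ A) → Derives Γ (b ∶ A) →
      Derives Γ (isType (id A a b))
  | id_univ {Γ : Ctx} {A a b : Tm} : Derives Γ (A ∶ univ) → Derives Γ (a ∶ A) →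
      Derives Γ (b ∶ A) → Derives Γ (id A a b ∶ univ)
  | refl {Γ : Ctx} {A a : Tm} : Derives Γ (a ∶ A) → Derives Γ (refl a ∶ id A a a)
  | J {Γ : Ctx} {A a b C d p : Tm} : Derives Γ (isType A) → Derives Γ (a ∶ A) →
      Derives (id (A.wk 1) (a.wk 1) (var 0) :: A :: Γ) (isType C) →
      Derives Γ (d ∶ C.inst₂ a (refl a)) → Derives Γ (b ∶ A) → Derives Γ (p ∶ id A a b) →
      Derives Γ (J C d p ∶ C.inst₂ b p)
  -- the empty type
  | empty {Γ : Ctx} : Derives Γ (empty ∶ univ)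
  | emptyElim {Γ : Ctx} {P t : Tm} : Derives (empty :: Γ) (isType P) → Derives Γ (t ∶ empty) →
      Derives Γ (emptyElim P t ∶ P.inst t)
  -- the unit type
  | unit {Γ : Ctx} : Derives Γ (unit ∶ univ)
  | star {Γ : Ctx} : Derives Γ (star ∶ unit)
  | unitElim {Γ : Ctx} {P c t : Tm} : Derives (unit :: Γ) (isType P) →
      Derives Γ (c ∶ P.inst star) → Derives Γ (t ∶ unit) → Derives Γ (unitElim P c t ∶ P.inst t)
  -- the natural numbers
  | nat {Γ : Ctx} : Derives Γ (nat ∶ univ)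
  | zero {Γ : Ctx} : Derives Γ (zero ∶ nat)
  | succ {Γ : Ctx} {n : Tm} : Derives Γ (n ∶ nat) → Derives Γ (succ n ∶ nat)
  | natElim {Γ : Ctx} {P z s n : Tm} : Derives (nat :: Γ) (isType P) →
      Derives Γ (z ∶ P.inst zero) →
      Derives Γ (s ∶ pi nat (arr P (P.instWk 1 (succ (var 0))))) →
      Derives Γ (n ∶ nat) → Derives Γ (natElim P z s n ∶ P.inst n)
  -- disjoint sums
  | sum {Γ : Ctx} {A B : Tm} : Derives Γ (isType A) → Derives Γ (isType B) →
      Derives Γ (isType (sum A B))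
  | sum_univ {Γ : Ctx} {A B : Tm} : Derives Γ (A ∶ univ) → Derives Γ (B ∶ univ) →
      Derives Γ (sum A B ∶ univ)
  | inl {Γ : Ctx} {A B a : Tm} : Derives Γ (isType B) → Derives Γ (a ∶ A) →
      Derives Γ (inl a ∶ sum A B)
  | inr {Γ : Ctx} {A B b : Tm} : Derives Γ (isType A) → Derives Γ (b ∶ B) →
      Derives Γ (inr b ∶ sum A B)
  | sumElim {Γ : Ctx} {A B P l r t : Tm} : Derives Γ (isType (sum A B)) →
      Derives (sum A B :: Γ) (isType P) →
      Derives Γ (l ∶ pi A (P.instWk 1 (inl (var 0)))) →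
      Derives Γ (r ∶ pi B (P.instWk 1 (inr (var 0)))) →
      Derives Γ (t ∶ sum A B) → Derives Γ (sumElim P l r t ∶ P.inst t)
  -- graph quotients
  | gq {Γ : Ctx} {V E : Tm} : Derives Γ (V ∶ univ) → Derives Γ (E ∶ arr V (arr V univ)) →
      Derives Γ (gq V E ∶ univ)
  | vert {Γ : Ctx} {V E i : Tm} : Derives Γ (gq V E ∶ univ) → Derives Γ (i ∶ V) →
      Derives Γ (vert i ∶ gq V E)
  | edge {Γ : Ctx} {V E i j e : Tm} : Derives Γ (gq V E ∶ univ) → Derives Γ (i ∶ V) →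
      Derives Γ (j ∶ V) → Derives Γ (e ∶ app (app E i) j) →
      Derives Γ (edge V E i j e ∶ id (gq V E) (vert i) (vert j))
  | gqElim {Γ : Ctx} {V E P v d t : Tm} : Derives Γ (gq V E ∶ univ) →
      Derives (gq V E :: Γ) (isType P) →
      Derives Γ (v ∶ pi V (P.instWk 1 (vert (var 0)))) →
      Derives Γ (d ∶ edgeMethod V E P v) →
      Derives Γ (t ∶ gq V E) → Derives Γ (gqElim P v d t ∶ P.inst t)
  | gqComp {Γ : Ctx} {V E P v d i j e : Tm} : Derives Γ (gq V E ∶ univ) →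
      Derives (gq V E :: Γ) (isType P) →
      Derives Γ (v ∶ pi V (P.instWk 1 (vert (var 0)))) →
      Derives Γ (d ∶ edgeMethod V E P v) →
      Derives Γ (i ∶ V) → Derives Γ (j ∶ V) → Derives Γ (e ∶ app (app E i) j) →
      Derives Γ (gqComp V E P v d i j e ∶
        id (id (P.inst (vert j)) (transport P (edge V E i j e) (app v i)) (app v j))
          (apd P (lam (gqElim (P.wkUp 1) (v.wk 1) (d.wk 1) (var 0))) (vert i) (edge V E i j e))
          (app (app (app d i) j) e))
  -- function extensionality, for types of any size
  | funext {Γ : Ctx} {A B f g : Tm} : Derives Γ (isType A) → Derives (A :: Γ) (isType B) →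
      Derives Γ (f ∶ pi A B) → Derives Γ (g ∶ pi A B) →
      Derives Γ (funext A B f g ∶
        isEquiv (id (pi A B) f g) (pi A (id B (app (f.wk 1) (var 0)) (app (g.wk 1) (var 0))))
          (happly A B f))
  -- univalence of the universe
  | ua {Γ : Ctx} {A B : Tm} : Derives Γ (A ∶ univ) → Derives Γ (B ∶ univ) →
      Derives Γ (ua A B ∶ isEquiv (id univ A B) (equiv A B) (idToEquiv A))

/-! ### Homotopy fibers, pushouts and joins -/

namespace Tm

/-- The homotopy fiber `∑ (a : A), f a = x` of `f : A → X` at `x : X`. -/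
def hfib (A X f x : Tm) : Tm := sigma A (id (X.wk 1) (app (f.wk 1) (var 0)) (x.wk 1))

/-- The relation `E` on `A + B` that defines the pushout of `f : C → A` and `g : C → B`:
`E i j := ∑ (c : C), (inl (f c) = i) × (inr (g c) = j)`. -/
def pushoutEdge (A B C f g : Tm) : Tm :=
  lam (lam (sigma (C.wk 2)
    (prod (id (sum (A.wk 3) (B.wk 3)) (inl (app (f.wk 3) (var 0))) (var 2))
      (id (sum (A.wk 3) (B.wk 3)) (inr (app (g.wk 3) (var 0))) (var 1)))))

/-- The homotopy pushout of `f : C → A` and `g : C → B`: the homotopy coequalizer of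
`inl ∘ f` and `inr ∘ g`, as a graph quotient.  Its point constructors are `vert (inl a)` and
`vert (inr b)`; its path constructor at `c` is the edge from `inl (f c)` to `inr (g c)` given by
`pair c (pair (refl (inl (f c))) (refl (inr (g c))))`. -/
def pushout (A B C f g : Tm) : Tm := gq (sum A B) (pushoutEdge A B C f g)

/-- The map out of the quotient of a graph `(V, E)` into a type `X` that is given by
`k : V → X` and `s : ∏ (i j : V), E i j → k i = k j`. -/
def gqRec (V E X k s : Tm) : Tm :=
  lam (gqElim (X.wk 2) (k.wk 1)
    (lam (lam (lam (concat (X.wk 4)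
      (transport (X.wk 5) (edge (V.wk 4) (E.wk 4) (var 2) (var 1) (var 0))
        (app (k.wk 4) (var 2)))
      (transportConst (X.wk 4) (edge (V.wk 4) (E.wk 4) (var 2) (var 1) (var 0))
        (app (k.wk 4) (var 2)))
      (app (app (app (s.wk 4) (var 2)) (var 1)) (var 0))))))
    (var 0))

/-- The map on the vertices of the graph that underlies `pushoutRec`. -/
def pushoutRecVert (X u v : Tm) : Tm := lam (sumElim (X.wk 2) (u.wk 1) (v.wk 1) (var 0))

/-- The map on the edges of the graph that underlies `pushoutRec`: the edge from `i` to `j` given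
by `(c, (p, q))` goes to `H c : u (f c) = v (g c)`, transported along
`p : inl (f c) = i` and `q : inr (g c) = j`. -/
def pushoutRecEdge (f X u v H : Tm) : Tm :=
  lam (lam (lam
    (sigmaElim
      (id (X.wk 4) (app ((pushoutRecVert X u v).wk 4) (var 3))
        (app ((pushoutRecVert X u v).wk 4) (var 2)))
      (lam (lam
        (sigmaElim
          (id (X.wk 6) (app ((pushoutRecVert X u v).wk 6) (var 5))
            (app ((pushoutRecVert X u v).wk 6) (var 4)))
          (lam (lam
            (J
              (id (X.wk 9) (app ((pushoutRecVert X u v).wk 9) (var 1))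
                (app ((pushoutRecVert X u v).wk 9) (var 7)))
              (J
                (id (X.wk 9)
                  (app ((pushoutRecVert X u v).wk 9) (inl (app (f.wk 9) (var 5))))
                  (app ((pushoutRecVert X u v).wk 9) (var 1)))
                (app (H.wk 7) (var 3))
                (var 0))
              (var 1))))
          (var 0))))
      (var 0))))

/-- The map from the pushout of `f : C → A` and `g : C → B` to `X` that is given by
`u : A → X`, `v : B → X` and `H : ∏ (c : C), u (f c) = v (g c)`. -/
def pushoutRec (A B C f g X u v H : Tm) : Tm :=
  gqRec (sum A B) (pushoutEdge A B C f g) X (pushoutRecVert X u v) (pushoutRecEdge f X u v H)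

/-- The pullback `A ×_X B := ∑ (a : A) (b : B), f a = g b` of `f : A → X` and `g : B → X`. -/
def pullback (A B X f g : Tm) : Tm :=
  sigma A (sigma (B.wk 1) (id (X.wk 2) (app (f.wk 2) (var 1)) (app (g.wk 2) (var 0))))

/-- The projection from `A ×_X B` to `A`. -/
def pullbackFst (A : Tm) : Tm := lam (sigmaElim (A.wk 2) (lam (lam (var 1))) (var 0))

/-- The projection from `A ×_X B` to `B`. -/
def pullbackSnd (B : Tm) : Tm :=
  lam (sigmaElim (B.wk 2)
    (lam (lam (sigmaElim (B.wk 4) (lam (lam (var 1))) (var 0)))) (var 0))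

/-- The homotopy that makes the pullback square commute. -/
def pullbackPath (A B X f g : Tm) : Tm :=
  lam (sigmaElim
    (id (X.wk 2) (app (f.wk 2) (app ((pullbackFst A).wk 2) (var 0)))
      (app (g.wk 2) (app ((pullbackSnd B).wk 2) (var 0))))
    (lam (lam (sigmaElim
      (id (X.wk 4) (app (f.wk 4) (app ((pullbackFst A).wk 4) (pair (var 2) (var 0))))
        (app (g.wk 4) (app ((pullbackSnd B).wk 4) (pair (var 2) (var 0)))))
      (lam (lam (var 0)))
      (var 0))))
    (var 0))

/-- The domain `A *_X B` of the join of `f : A → X` and `g : B → X`: the pushout of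
`A ← A ×_X B → B`. -/
def joinDom (A B X f g : Tm) : Tm :=
  pushout A B (pullback A B X f g) (pullbackFst A) (pullbackSnd B)

/-- The join `f * g : A *_X B → X` of `f : A → X` and `g : B → X`. -/
def joinMap (A B X f g : Tm) : Tm :=
  pushoutRec A B (pullback A B X f g) (pullbackFst A) (pullbackSnd B) X f g
    (pullbackPath A B X f g)

/-- The join `A * B` of two types: the pushout of `A ← A × B → B`. -/
def join (A B : Tm) : Tm :=
  pushout A B (prod A B)
    (lam (sigmaElim (A.wk 2) (lam (lam (var 1))) (var 0)))
    (lam (sigmaElim (B.wk 2) (lam (lam (var 0))) (var 0)))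

end Tm

end HoTT

/-! ### Substitution calculus, and closure of conversion and derivability under substitution -/

namespace HoTT

namespace Tm

/-! ### Composition of renamings and substitutions -/

/-! The mathematical argument has two steps. Suppose first that `f` and `g` are the projections of
families `F` and `G` over `X`. The pullback of the two projections is `Σ x, F x × G x`, and forming
a pushout commutes with `Σ`. So the domain of the join of the projections is equivalent, over `X`,
to `Σ x, F x * G x`. The fiber of the projection of this total space at `x` is `F x * G x`. The
equivalence is given by `toTot` and `ofTot`; that they are mutually inverse and compatible with the
maps to `X` is `toTotOfTotEntry`, `ofTotToTotEntry` and `projToTotEntry`. Each of these homotopies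
is constant on points, and on the path constructor it amounts to a naturality square (`trPathEntry`)
that is filled by the computation rules for recursion on pushouts (`recGlueEntry`).

For general maps, `A` is equivalent to `Σ x, fib f x` in such a way that `f` becomes the projection
(`equivTotalEntry`), and similarly for `B` and `g`. Univalence, in the form of equivalence induction
(`equivIndEntry`), carries the statement for projections over to `f` and `g`, while the right-hand
side `fib f x * fib g x` is held fixed (`fibJoinEntry`).

The theorem asks for a derivation in a formal system, so these arguments are written as terms of
that system and their typing is certified by a type checker. The checker is proved sound: whatever
it accepts is derivable (`Checker.run_sound`). Soundness rests on closure of `Derives` under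
substitution, on inversion (`Derives.components`) and on the fact that the type of a derivable term
is a type (`Derives.presupposition`). Completeness and termination of conversion play no role: every
procedure has a bound on its recursion depth and may fail.

The proof terms refer to each other by numbered free variables that stand for definitions. If each
definition passes the checker relative to the earlier ones, then substituting values for these
variables yields closed derivable terms (`exists_realized`). The kernel evaluates the checker on the
list `definitions`; the last item of the list has the required type. -/

theorem upSubst_var_comp (ξ : ℕ → ℕ) :
    upSubst (fun n => var (ξ n)) = fun n => var (upRen ξ n) := by
  funext n
  cases n <;> rfl

theorem rename_eq_subst (t : Tm) : ∀ ξ, t.rename ξ = t.subst (fun n => var (ξ n)) := by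
  induction t <;> intro ξ <;> simp_all [rename, subst, upSubst_var_comp]

theorem upSubst_var : upSubst var = var := by
  funext n
  cases n <;> rfl

@[simp]
theorem subst_var (t : Tm) : t.subst var = t := by
  induction t <;> simp_all [subst, upSubst_var]

theorem upSubst_comp_upRen (σ : ℕ → Tm) (ξ : ℕ → ℕ) :
    (fun n => upSubst σ (upRen ξ n)) = upSubst (fun n => σ (ξ n)) := by
  funext n
  cases n <;> rfl

/-- The composition laws depend on each other in a fixed order: lifting a substitution under a
binder weakens its values, so composing substitutions presupposes both ways of composing a
substitution with a renaming. -/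
theorem rename_subst (t : Tm) :
    ∀ ξ σ, (t.rename ξ).subst σ = t.subst (fun n => σ (ξ n)) := by
  induction t <;> intro ξ σ <;> simp_all [rename, subst, upSubst_comp_upRen]

theorem rename_rename (t : Tm) (ξ ζ : ℕ → ℕ) :
    (t.rename ξ).rename ζ = t.rename (fun n => ζ (ξ n)) := by
  rw [rename_eq_subst _ ζ, rename_subst, rename_eq_subst]

theorem upSubst_rename (σ : ℕ → Tm) (ξ : ℕ → ℕ) :
    (fun n => (upSubst σ n).rename (upRen ξ)) = upSubst (fun n => (σ n).rename ξ) := by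
  funext n
  cases n <;> simp [upSubst, rename, upRen, wk, rename_rename]

theorem subst_rename (t : Tm) :
    ∀ σ ξ, (t.subst σ).rename ξ = t.subst (fun n => (σ n).rename ξ) := by
  induction t <;> intro σ ξ <;> simp_all [rename, subst, upSubst_rename]

theorem upSubst_subst (σ τ : ℕ → Tm) :
    (fun n => (upSubst σ n).subst (upSubst τ)) = upSubst (fun n => (σ n).subst τ) := by
  funext n
  cases n <;> simp [upSubst, subst, wk, rename_subst, subst_rename]

theorem subst_subst (t : Tm) :
    ∀ σ τ, (t.subst σ).subst τ = t.subst (fun n => (σ n).subst τ) := by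
  induction t <;> intro σ τ <;> simp_all [subst, upSubst_subst]

/-! ### Substitution in the derived formers -/

theorem subst_congr (t : Tm) {σ τ : ℕ → Tm} (h : ∀ n, σ n = τ n) : t.subst σ = t.subst τ := by
  rw [show σ = τ from _root_.funext h]

theorem wk_eq (k : ℕ) (t : Tm) : t.wk k = t.subst (fun n => var (n + k)) :=
  rename_eq_subst t _

theorem wk_subst (k : ℕ) (t : Tm) (σ : ℕ → Tm) : (t.wk k).subst σ = t.subst (fun n => σ (n + k)) :=
  rename_subst t _ σ

theorem subst_wk (k : ℕ) (t : Tm) (σ : ℕ → Tm) :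
    (t.subst σ).wk k = t.subst (fun n => (σ n).wk k) :=
  subst_rename t σ _

theorem wk_wk (k l : ℕ) (t : Tm) : (t.wk k).wk l = t.wk (k + l) := by
  simp [wk, rename_rename, Nat.add_assoc]

@[simp]
theorem var_wk (n k : ℕ) : (var n).wk k = var (n + k) := rfl

theorem wk_zero (t : Tm) : t.wk 0 = t := by
  simp [wk_eq]

theorem wk_subst_up (t : Tm) (σ : ℕ → Tm) : (t.wk 1).subst (upSubst σ) = (t.subst σ).wk 1 := by
  rw [wk_subst, subst_wk]
  rfl

theorem wk_subst_up₂ (t : Tm) (σ : ℕ → Tm) :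
    (t.wk 2).subst (upSubst (upSubst σ)) = (t.subst σ).wk 2 := by
  rw [wk_subst, subst_wk]
  exact subst_congr t fun n => by simp [upSubst, wk_wk]

theorem wk_subst_up₃ (t : Tm) (σ : ℕ → Tm) :
    (t.wk 3).subst (upSubst (upSubst (upSubst σ))) = (t.subst σ).wk 3 := by
  rw [wk_subst, subst_wk]
  exact subst_congr t fun n => by simp [upSubst, wk_wk]

theorem wk_subst_up₄ (t : Tm) (σ : ℕ → Tm) :
    (t.wk 4).subst (upSubst (upSubst (upSubst (upSubst σ)))) = (t.subst σ).wk 4 := by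
  rw [wk_subst, subst_wk]
  exact subst_congr t fun n => by simp [upSubst, wk_wk]

theorem wkUp_subst (k : ℕ) (t : Tm) (σ : ℕ → Tm) :
    (t.wkUp k).subst (upSubst σ) = t.subst (upSubst (fun n => σ (n + k))) := by
  rw [wkUp, rename_subst, upSubst_comp_upRen]

theorem subst_wkUp (k : ℕ) (t : Tm) (σ : ℕ → Tm) :
    (t.subst (upSubst σ)).wkUp k = t.subst (upSubst (fun n => (σ n).wk k)) := by
  rw [wkUp, subst_rename, upSubst_rename]
  rfl

theorem wkUp_subst_up₁ (t : Tm) (σ : ℕ → Tm) :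
    (t.wkUp 1).subst (upSubst (upSubst σ)) = (t.subst (upSubst σ)).wkUp 1 := by
  rw [wkUp_subst, subst_wkUp]
  rfl

theorem wkUp_subst_up₂ (t : Tm) (σ : ℕ → Tm) :
    (t.wkUp 2).subst (upSubst (upSubst (upSubst σ))) = (t.subst (upSubst σ)).wkUp 2 := by
  rw [wkUp_subst, subst_wkUp]
  simp [upSubst, wk_wk]

theorem wkUp_subst_up₃ (t : Tm) (σ : ℕ → Tm) :
    (t.wkUp 3).subst (upSubst (upSubst (upSubst (upSubst σ)))) =
      (t.subst (upSubst σ)).wkUp 3 := by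
  rw [wkUp_subst, subst_wkUp]
  simp [upSubst, wk_wk]

/-- The types in the application and elimination rules contain `inst`, so closure of derivability
under substitution rests on this commutation. -/
theorem inst_subst (t a : Tm) (σ : ℕ → Tm) :
    (t.inst a).subst σ = (t.subst (upSubst σ)).inst (a.subst σ) := by
  rw [inst, inst, subst_subst, subst_subst]
  refine subst_congr t fun n => ?_
  cases n <;> simp [upSubst, subst, wk_subst]

theorem inst₂_subst (t a b : Tm) (σ : ℕ → Tm) :
    (t.inst₂ a b).subst σ = (t.subst (upSubst (upSubst σ))).inst₂ (a.subst σ) (b.subst σ) := by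
  rw [inst₂, inst₂, subst_subst, subst_subst]
  refine subst_congr t fun n => ?_
  rcases n with _ | _ | n <;> simp [upSubst, subst, wk_subst, wk_wk]

@[simp]
theorem wk_inst (t a : Tm) : (t.wk 1).inst a = t := by
  rw [inst, wk_subst]
  exact subst_var t

theorem instWk_subst₁ (t a : Tm) (σ : ℕ → Tm) :
    (t.instWk 1 a).subst (upSubst σ) =
      (t.subst (upSubst σ)).instWk 1 (a.subst (upSubst σ)) := by
  rw [instWk, inst_subst, wkUp_subst_up₁]
  rfl

theorem instWk_subst₂ (t a : Tm) (σ : ℕ → Tm) :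
    (t.instWk 2 a).subst (upSubst (upSubst σ)) =
      (t.subst (upSubst σ)).instWk 2 (a.subst (upSubst (upSubst σ))) := by
  rw [instWk, inst_subst, wkUp_subst_up₂]
  rfl

theorem instWk_subst₃ (t a : Tm) (σ : ℕ → Tm) :
    (t.instWk 3 a).subst (upSubst (upSubst (upSubst σ))) =
      (t.subst (upSubst σ)).instWk 3 (a.subst (upSubst (upSubst (upSubst σ)))) := by
  rw [instWk, inst_subst, wkUp_subst_up₃]
  rfl

theorem arr_subst (A B : Tm) (σ : ℕ → Tm) :
    (arr A B).subst σ = arr (A.subst σ) (B.subst σ) := by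
  simp [arr, subst, wk_subst_up]

theorem prod_subst (A B : Tm) (σ : ℕ → Tm) :
    (prod A B).subst σ = prod (A.subst σ) (B.subst σ) := by
  simp [prod, subst, wk_subst_up]

theorem transport_subst (P p u : Tm) (σ : ℕ → Tm) :
    (transport P p u).subst σ =
      transport (P.subst (upSubst σ)) (p.subst σ) (u.subst σ) := by
  simp [transport, subst, wk_subst_up]

theorem apd_subst (P f a p : Tm) (σ : ℕ → Tm) :
    (apd P f a p).subst σ =
      apd (P.subst (upSubst σ)) (f.subst σ) (a.subst σ) (p.subst σ) := by
  simp [apd, subst, wk_subst_up, wk_subst_up₂, wkUp_subst_up₂, transport_subst, upSubst]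

theorem isEquiv_subst (A B f : Tm) (σ : ℕ → Tm) :
    (isEquiv A B f).subst σ = isEquiv (A.subst σ) (B.subst σ) (f.subst σ) := by
  simp [isEquiv, subst, wk_subst_up, wk_subst_up₂, prod_subst, arr_subst, upSubst]

theorem equiv_subst (A B : Tm) (σ : ℕ → Tm) :
    (equiv A B).subst σ = equiv (A.subst σ) (B.subst σ) := by
  simp [equiv, subst, wk_subst_up, isEquiv_subst, arr_subst, upSubst]

theorem idEquiv_subst (σ : ℕ → Tm) : idEquiv.subst σ = idEquiv := by
  simp [idEquiv, subst, upSubst]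

theorem idToEquiv_subst (A : Tm) (σ : ℕ → Tm) :
    (idToEquiv A).subst σ = idToEquiv (A.subst σ) := by
  simp [idToEquiv, subst, wk_subst_up₃, equiv_subst, idEquiv_subst, upSubst]

theorem happly_subst (A B f : Tm) (σ : ℕ → Tm) :
    (happly A B f).subst σ = happly (A.subst σ) (B.subst (upSubst σ)) (f.subst σ) := by
  simp [happly, subst, wk_subst_up₂, wk_subst_up₃, wk_subst_up₄, wkUp_subst_up₃, upSubst]

theorem edgeMethod_subst (V E P v : Tm) (σ : ℕ → Tm) :
    (edgeMethod V E P v).subst σ =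
      edgeMethod (V.subst σ) (E.subst σ) (P.subst (upSubst σ)) (v.subst σ) := by
  simp [edgeMethod, subst, wk_subst_up, wk_subst_up₂, wk_subst_up₃, wkUp_subst_up₃,
    instWk_subst₃, transport_subst, upSubst]

end Tm

open Tm Judgment

/-! ### Convertibility and derivability are closed under substitution -/

/-- Conversion is untyped, so no context is involved. Only `beta` and `eta` need a commutation law;
the other rules are stable under substitution by unfolding. -/
theorem Conv.subst {s t : Tm} (h : Conv s t) : ∀ σ, Conv (s.subst σ) (t.subst σ) := by
  induction h with
  | symm _ ih => exact fun σ => (ih σ).symm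
  | trans _ _ ih₁ ih₂ => exact fun σ => (ih₁ σ).trans (ih₂ σ)
  | rfl => exact fun σ => .rfl _
  | beta t a => intro σ; rw [inst_subst]; exact .beta _ _
  | eta f => intro σ; simp only [Tm.subst, wk_subst_up]; exact .eta _
  | sigmaElim_pair => exact fun σ => .sigmaElim_pair _ _ _ _
  | J_refl => exact fun σ => .J_refl _ _ _
  | unitElim_star => exact fun σ => .unitElim_star _ _
  | natElim_zero => exact fun σ => .natElim_zero _ _ _
  | natElim_succ => exact fun σ => .natElim_succ _ _ _ _
  | sumElim_inl => exact fun σ => .sumElim_inl _ _ _ _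
  | sumElim_inr => exact fun σ => .sumElim_inr _ _ _ _
  | gqElim_vert => exact fun σ => .gqElim_vert _ _ _ _
  | pi _ _ h₁ h₂ => exact fun σ => .pi (h₁ σ) (h₂ _)
  | lam _ h => exact fun σ => .lam (h _)
  | app _ _ h₁ h₂ => exact fun σ => .app (h₁ σ) (h₂ σ)
  | sigma _ _ h₁ h₂ => exact fun σ => .sigma (h₁ σ) (h₂ _)
  | pair _ _ h₁ h₂ => exact fun σ => .pair (h₁ σ) (h₂ σ)
  | sigmaElim _ _ _ h₁ h₂ h₃ => exact fun σ => .sigmaElim (h₁ _) (h₂ σ) (h₃ σ)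
  | id _ _ _ h₁ h₂ h₃ => exact fun σ => .id (h₁ σ) (h₂ σ) (h₃ σ)
  | refl _ h => exact fun σ => .refl (h σ)
  | J _ _ _ h₁ h₂ h₃ => exact fun σ => .J (h₁ _) (h₂ σ) (h₃ σ)
  | emptyElim _ _ h₁ h₂ => exact fun σ => .emptyElim (h₁ _) (h₂ σ)
  | unitElim _ _ _ h₁ h₂ h₃ => exact fun σ => .unitElim (h₁ _) (h₂ σ) (h₃ σ)
  | succ _ h => exact fun σ => .succ (h σ)
  | natElim _ _ _ _ h₁ h₂ h₃ h₄ => exact fun σ => .natElim (h₁ _) (h₂ σ) (h₃ σ) (h₄ σ)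
  | sum _ _ h₁ h₂ => exact fun σ => .sum (h₁ σ) (h₂ σ)
  | inl _ h => exact fun σ => .inl (h σ)
  | inr _ h => exact fun σ => .inr (h σ)
  | sumElim _ _ _ _ h₁ h₂ h₃ h₄ => exact fun σ => .sumElim (h₁ _) (h₂ σ) (h₃ σ) (h₄ σ)
  | gq _ _ h₁ h₂ => exact fun σ => .gq (h₁ σ) (h₂ σ)
  | vert _ h => exact fun σ => .vert (h σ)
  | edge _ _ _ _ _ h₁ h₂ h₃ h₄ h₅ => exact fun σ => .edge (h₁ σ) (h₂ σ) (h₃ σ) (h₄ σ) (h₅ σ)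
  | gqElim _ _ _ _ h₁ h₂ h₃ h₄ => exact fun σ => .gqElim (h₁ _) (h₂ σ) (h₃ σ) (h₄ σ)
  | gqComp _ _ _ _ _ _ _ _ h₁ h₂ h₃ h₄ h₅ h₆ h₇ h₈ =>
    exact fun σ => .gqComp (h₁ σ) (h₂ σ) (h₃ _) (h₄ σ) (h₅ σ) (h₆ σ) (h₇ σ) (h₈ σ)
  | funext _ _ _ _ h₁ h₂ h₃ h₄ => exact fun σ => .funext (h₁ σ) (h₂ _) (h₃ σ) (h₄ σ)
  | ua _ _ h₁ h₂ => exact fun σ => .ua (h₁ σ) (h₂ σ)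

/-- Substitution in a judgment. -/
def Judgment.subst (σ : ℕ → Tm) : Judgment → Judgment
  | isType A => isType (A.subst σ)
  | hasType t A => hasType (t.subst σ) (A.subst σ)

/-- A notion of "term of a given type in a given context" along which substitutions can be lifted
under binders. -/
structure Liftable (G : Ctx → Tm → Tm → Prop) : Prop where
  var_zero : ∀ Γ A, G (A :: Γ) (var 0) (A.wk 1)
  wk : ∀ Γ B t A, G Γ t A → G (B :: Γ) (t.wk 1) (A.wk 1)
  derives : ∀ Γ t A, G Γ t A → Derives Γ (t ∶ A)

/-- `σ` maps the variables of `Γ` to terms over `Δ` of the corresponding types, in the sense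
of `G`. -/
def IsSubst (G : Ctx → Tm → Tm → Prop) (Γ Δ : Ctx) (σ : ℕ → Tm) : Prop :=
  ∀ n A, Γ[n]? = some A → G Δ (σ n) ((A.wk (n + 1)).subst σ)

theorem IsSubst.up {G : Ctx → Tm → Tm → Prop} (hG : Liftable G) {Γ Δ : Ctx} {σ : ℕ → Tm}
    (h : IsSubst G Γ Δ σ) (A : Tm) : IsSubst G (A :: Γ) (A.subst σ :: Δ) (upSubst σ) := by
  intro n B hB
  cases n with
  | zero =>
    obtain rfl : A = B := by simpa using hB
    rw [wk_subst_up]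
    exact hG.var_zero _ _
  | succ n =>
    rw [← wk_wk, wk_subst_up]
    exact hG.wk _ _ _ _ (h n B (by simpa using hB))

/-- One induction serves for both weakening and substitution. Passing under a binder requires
weakening the values of the substitution. For values that are variables this is evident, which gives
weakening; weakening in turn makes arbitrary derivable terms liftable, which gives substitution. -/
theorem Derives.subst_of_liftable {G : Ctx → Tm → Tm → Prop} (hG : Liftable G) {Γ : Ctx}
    {𝒥 : Judgment} (h : Derives Γ 𝒥) :
    ∀ {Δ : Ctx} {σ : ℕ → Tm}, IsSubst G Γ Δ σ → Derives Δ (𝒥.subst σ) := by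
  induction h with
  | var h => exact fun hσ => hG.derives _ _ _ (hσ _ _ h)
  | conv _ _ h ih₁ ih₂ => exact fun hσ => .conv (ih₁ hσ) (ih₂ hσ) (h.subst _)
  | univ => exact fun _ => .univ
  | el _ ih => exact fun hσ => .el (ih hσ)
  | pi _ _ ih₁ ih₂ => exact fun hσ => .pi (ih₁ hσ) (ih₂ (hσ.up hG _))
  | pi_univ _ _ ih₁ ih₂ => exact fun hσ => .pi_univ (ih₁ hσ) (ih₂ (hσ.up hG _))
  | lam _ _ ih₁ ih₂ => exact fun hσ => .lam (ih₁ hσ) (ih₂ (hσ.up hG _))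
  | app _ _ ih₁ ih₂ =>
    intro _ _ hσ
    simp only [Judgment.subst, inst_subst]
    exact .app (ih₁ hσ) (ih₂ hσ)
  | sigma _ _ ih₁ ih₂ => exact fun hσ => .sigma (ih₁ hσ) (ih₂ (hσ.up hG _))
  | sigma_univ _ _ ih₁ ih₂ => exact fun hσ => .sigma_univ (ih₁ hσ) (ih₂ (hσ.up hG _))
  | pair _ _ _ _ ih₁ ih₂ ih₃ ih₄ =>
    intro _ _ hσ
    refine .pair (ih₁ hσ) (ih₂ (hσ.up hG _)) (ih₃ hσ) ?_
    rw [← inst_subst]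
    exact ih₄ hσ
  | sigmaElim _ _ _ _ ih₁ ih₂ ih₃ ih₄ =>
    intro _ _ hσ
    simp only [Judgment.subst, inst_subst]
    refine .sigmaElim (ih₁ hσ) (ih₂ (hσ.up hG _)) ?_ (ih₄ hσ)
    have := ih₃ hσ
    simp only [Judgment.subst, Tm.subst, instWk_subst₂] at this
    exact this
  | id _ _ _ ih₁ ih₂ ih₃ => exact fun hσ => .id (ih₁ hσ) (ih₂ hσ) (ih₃ hσ)
  | id_univ _ _ _ ih₁ ih₂ ih₃ => exact fun hσ => .id_univ (ih₁ hσ) (ih₂ hσ) (ih₃ hσ)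
  | refl _ ih => exact fun hσ => .refl (ih hσ)
  | J _ _ _ _ _ _ ih₁ ih₂ ih₃ ih₄ ih₅ ih₆ =>
    intro _ _ hσ
    simp only [Judgment.subst, inst₂_subst]
    refine .J (ih₁ hσ) (ih₂ hσ) ?_ ?_ (ih₅ hσ) (ih₆ hσ)
    · have := ih₃ ((hσ.up hG _).up hG _)
      simp only [Tm.subst, wk_subst_up] at this
      exact this
    · have := ih₄ hσ
      simp only [Judgment.subst, inst₂_subst] at this
      exact this
  | empty => exact fun _ => .empty
  | emptyElim _ _ ih₁ ih₂ =>
    intro _ _ hσ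
    simp only [Judgment.subst, inst_subst]
    exact .emptyElim (ih₁ (hσ.up hG _)) (ih₂ hσ)
  | unit => exact fun _ => .unit
  | star => exact fun _ => .star
  | unitElim _ _ _ ih₁ ih₂ ih₃ =>
    intro _ _ hσ
    simp only [Judgment.subst, inst_subst]
    refine .unitElim (ih₁ (hσ.up hG _)) ?_ (ih₃ hσ)
    have := ih₂ hσ
    simp only [Judgment.subst, inst_subst] at this
    exact this
  | nat => exact fun _ => .nat
  | zero => exact fun _ => .zero
  | succ _ ih => exact fun hσ => .succ (ih hσ)
  | natElim _ _ _ _ ih₁ ih₂ ih₃ ih₄ =>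
    intro _ _ hσ
    simp only [Judgment.subst, inst_subst]
    refine .natElim (ih₁ (hσ.up hG _)) ?_ ?_ (ih₄ hσ)
    · have := ih₂ hσ
      simp only [Judgment.subst, inst_subst] at this
      exact this
    · have := ih₃ hσ
      simp only [Judgment.subst, Tm.subst, arr_subst, instWk_subst₁] at this
      exact this
  | sum _ _ ih₁ ih₂ => exact fun hσ => .sum (ih₁ hσ) (ih₂ hσ)
  | sum_univ _ _ ih₁ ih₂ => exact fun hσ => .sum_univ (ih₁ hσ) (ih₂ hσ)
  | inl _ _ ih₁ ih₂ => exact fun hσ => .inl (ih₁ hσ) (ih₂ hσ)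
  | inr _ _ ih₁ ih₂ => exact fun hσ => .inr (ih₁ hσ) (ih₂ hσ)
  | sumElim _ _ _ _ _ ih₁ ih₂ ih₃ ih₄ ih₅ =>
    intro _ _ hσ
    simp only [Judgment.subst, inst_subst]
    refine .sumElim (ih₁ hσ) (ih₂ (hσ.up hG _)) ?_ ?_ (ih₅ hσ)
    · have := ih₃ hσ
      simp only [Judgment.subst, Tm.subst, instWk_subst₁] at this
      exact this
    · have := ih₄ hσ
      simp only [Judgment.subst, Tm.subst, instWk_subst₁] at this
      exact this
  | gq _ _ ih₁ ih₂ =>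
    intro _ _ hσ
    refine .gq (ih₁ hσ) ?_
    have := ih₂ hσ
    simp only [Judgment.subst, arr_subst] at this
    exact this
  | vert _ _ ih₁ ih₂ => exact fun hσ => .vert (ih₁ hσ) (ih₂ hσ)
  | edge _ _ _ _ ih₁ ih₂ ih₃ ih₄ => exact fun hσ => .edge (ih₁ hσ) (ih₂ hσ) (ih₃ hσ) (ih₄ hσ)
  | gqElim _ _ _ _ _ ih₁ ih₂ ih₃ ih₄ ih₅ =>
    intro _ _ hσ
    simp only [Judgment.subst, inst_subst]
    refine .gqElim (ih₁ hσ) (ih₂ (hσ.up hG _)) ?_ ?_ (ih₅ hσ)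
    · have := ih₃ hσ
      simp only [Judgment.subst, Tm.subst, instWk_subst₁] at this
      exact this
    · have := ih₄ hσ
      simp only [Judgment.subst, edgeMethod_subst] at this
      exact this
  | gqComp _ _ _ _ _ _ _ ih₁ ih₂ ih₃ ih₄ ih₅ ih₆ ih₇ =>
    intro _ _ hσ
    simp only [Judgment.subst, Tm.subst, inst_subst, transport_subst, apd_subst, wk_subst_up,
      wkUp_subst_up₁]
    refine .gqComp (ih₁ hσ) (ih₂ (hσ.up hG _)) ?_ ?_ (ih₅ hσ) (ih₆ hσ) (ih₇ hσ)
    · have := ih₃ hσ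
      simp only [Judgment.subst, Tm.subst, instWk_subst₁] at this
      exact this
    · have := ih₄ hσ
      simp only [Judgment.subst, edgeMethod_subst] at this
      exact this
  | funext _ _ _ _ ih₁ ih₂ ih₃ ih₄ =>
    intro _ _ hσ
    simp only [Judgment.subst, isEquiv_subst, happly_subst, Tm.subst, wk_subst_up]
    exact .funext (ih₁ hσ) (ih₂ (hσ.up hG _)) (ih₃ hσ) (ih₄ hσ)
  | ua _ _ ih₁ ih₂ =>
    intro _ _ hσ
    simp only [Judgment.subst, isEquiv_subst, idToEquiv_subst, equiv_subst, Tm.subst]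
    exact .ua (ih₁ hσ) (ih₂ hσ)

theorem liftable_var :
    Liftable fun Γ t A => ∃ n B, Γ[n]? = some B ∧ t = var n ∧ A = B.wk (n + 1) where
  var_zero Γ A := ⟨0, A, rfl, rfl, rfl⟩
  wk := by
    rintro Γ C t A ⟨n, B, h, rfl, rfl⟩
    exact ⟨n + 1, B, by simpa using h, rfl, wk_wk _ _ _⟩
  derives := by
    rintro Γ t A ⟨n, B, h, rfl, rfl⟩
    exact .var h

/-- Weakening. -/
theorem Derives.wk {Γ : Ctx} {𝒥 : Judgment} (h : Derives Γ 𝒥) (B : Tm) :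
    Derives (B :: Γ) (𝒥.subst fun n => Tm.var (n + 1)) :=
  h.subst_of_liftable liftable_var fun n A hA =>
    ⟨n + 1, A, by simpa using hA, rfl, by rw [← wk_eq, wk_wk]⟩

theorem Derives.wk_isType {Γ : Ctx} {A : Tm} (h : Derives Γ (isType A)) (B : Tm) :
    Derives (B :: Γ) (isType (A.wk 1)) := by
  rw [wk_eq]
  exact h.wk B

theorem Derives.wk_hasType {Γ : Ctx} {t A : Tm} (h : Derives Γ (t ∶ A)) (B : Tm) :
    Derives (B :: Γ) (t.wk 1 ∶ A.wk 1) := by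
  rw [wk_eq, wk_eq]
  exact h.wk B

theorem liftable_derives : Liftable fun Γ t A => Derives Γ (t ∶ A) where
  var_zero _ _ := .var rfl
  wk _ B _ _ h := h.wk_hasType B
  derives _ _ _ h := h

/-- Substitution. -/
theorem Derives.subst {Γ Δ : Ctx} {𝒥 : Judgment} {σ : ℕ → Tm} (h : Derives Γ 𝒥)
    (hσ : IsSubst (fun Γ t A => Derives Γ (t ∶ A)) Γ Δ σ) : Derives Δ (𝒥.subst σ) :=
  h.subst_of_liftable liftable_derives hσ

end HoTT

/-! ### Inversion, typing of the derived formers, and presuppositions -/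

namespace HoTT

open Tm Judgment

namespace Tm

theorem wkUp_eq (k : ℕ) (t : Tm) : t.wkUp k = t.subst (upSubst fun n => var (n + k)) := by
  rw [wkUp, rename_eq_subst, upSubst_var_comp]

-- Over `Γ, z` extended by `k` variables, `z` is `var k`; instantiating a family over `Γ, z` at `z`
-- itself is therefore just weakening.
@[simp]
theorem wkUp_inst_var (k : ℕ) (t : Tm) : (t.wkUp (k + 1)).inst (var k) = t.wk k := by
  rw [inst, wkUp, rename_subst, wk_eq]
  refine subst_congr t fun n => ?_
  cases n with
  | zero => simp [upRen]
  | succ n => simp [upRen]; omega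

theorem wkUp_wkUp (k l : ℕ) (t : Tm) : (t.wkUp k).wkUp l = t.wkUp (k + l) := by
  rw [wkUp, wkUp, rename_rename, wkUp]
  congr 1
  funext n
  cases n <;> simp [upRen, Nat.add_assoc]

@[simp]
theorem wk_inst₂ (t a b : Tm) : (t.wk 2).inst₂ a b = t := by
  rw [inst₂, wk_subst]
  exact subst_var t

@[simp]
theorem wk_one_inst₂ (t a b : Tm) : (t.wk 1).inst₂ a b = t.inst a := by
  rw [inst₂, wk_subst, inst]
  refine subst_congr t fun n => ?_
  cases n <;> rfl

theorem wk_wkUp (k : ℕ) (t : Tm) : (t.wk 1).wkUp k = (t.wk k).wk 1 := by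
  rw [wk, wk, wk, wkUp, rename_rename, rename_rename]
  rfl

/-- `instSubst a` is the substitution that defines `inst`. -/
def instSubst (a : Tm) : ℕ → Tm
  | 0 => a
  | n + 1 => var n

/-- `inst₂Subst a b` is the substitution that defines `inst₂`. -/
def inst₂Subst (a b : Tm) : ℕ → Tm
  | 0 => b
  | 1 => a
  | n + 2 => var n

theorem inst_eq (t a : Tm) : t.inst a = t.subst (instSubst a) := by
  refine subst_congr t fun n => ?_
  cases n <;> rfl

theorem inst₂_eq (t a b : Tm) : t.inst₂ a b = t.subst (inst₂Subst a b) := by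
  refine subst_congr t fun n => ?_
  rcases n with _ | _ | n <;> rfl

theorem wkUp_subst_inst₂ (P a b : Tm) : (P.wkUp 2).subst (upSubst (inst₂Subst a b)) = P := by
  rw [wkUp_subst]
  exact (congrArg (P.subst ·) upSubst_var).trans (subst_var P)

theorem wkUp_subst_inst (P a : Tm) : (P.wkUp 1).subst (upSubst (instSubst a)) = P := by
  rw [wkUp_subst]
  exact (congrArg (P.subst ·) upSubst_var).trans (subst_var P)

theorem instWk_inst (P t a : Tm) : (P.instWk 1 t).inst a = P.inst (t.inst a) := by
  rw [instWk, inst_eq _ a, inst_subst, wkUp_subst_inst, inst_eq t]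

/-- `instWkSubst k a` is the substitution that defines `instWk k`. -/
def instWkSubst (k : ℕ) (a : Tm) : ℕ → Tm
  | 0 => a
  | n + 1 => var (n + k)

theorem instWk_eq (k : ℕ) (t a : Tm) : t.instWk k a = t.subst (instWkSubst k a) := by
  rw [instWk, inst_eq, wkUp_eq, subst_subst]
  refine subst_congr t fun n => ?_
  cases n <;> rfl

theorem arr_wk (k : ℕ) (A B : Tm) : (arr A B).wk k = arr (A.wk k) (B.wk k) := by
  rw [wk_eq, arr_subst, ← wk_eq, ← wk_eq]

theorem wk_subst_inst₂ (t a b : Tm) : (t.wk 2).subst (inst₂Subst a b) = t := by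
  rw [← inst₂_eq, wk_inst₂]

theorem wk_subst_inst₂' (k : ℕ) (t a b : Tm) :
    (t.wk (k + 2)).subst (inst₂Subst a b) = t.wk k := by
  rw [Nat.add_comm, Nat.add_comm, ← wk_wk, wk_subst_inst₂]

theorem wk_subst_instSubst (t a : Tm) : (t.wk 1).subst (instSubst a) = t := by
  rw [← inst_eq, wk_inst]

theorem wk_subst_instSubst₂ (t a : Tm) : (t.wk 2).subst (upSubst (instSubst a)) = t.wk 1 := by
  rw [← wk_wk 1 1, wk_subst_up, wk_subst_instSubst]

theorem wk_subst_instSubst₃ (t a : Tm) :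
    (t.wk 3).subst (upSubst (upSubst (instSubst a))) = t.wk 2 := by
  rw [← wk_wk 1 2, wk_subst_up₂, wk_subst_instSubst]

theorem wkUp_subst_instSubst₂ (t a : Tm) :
    (t.wkUp 2).subst (upSubst (upSubst (instSubst a))) = t.wkUp 1 := by
  rw [← wkUp_wkUp 1 1, wkUp_subst_up₁, wkUp_subst_inst]

theorem wkUp_subst_instSubst₃ (t a : Tm) :
    (t.wkUp 3).subst (upSubst (upSubst (upSubst (instSubst a)))) = t.wkUp 2 := by
  rw [← wkUp_wkUp 1 2, wkUp_subst_up₂, wkUp_subst_inst]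

theorem wkUp_subst_inst₂' (P a b : Tm) :
    (P.wkUp 3).subst (upSubst (inst₂Subst a b)) = P.wkUp 1 := by
  rw [wkUp_subst, wkUp_eq]
  rfl

end Tm

/-! ### Instantiation, inversion -/

namespace Derives

theorem conv' {Γ : Ctx} {t A B : Tm} (h : Derives Γ (t ∶ A)) (e : A = B) : Derives Γ (t ∶ B) :=
  e ▸ h

theorem isSubst_inst {Γ : Ctx} {a A : Tm} (ha : Derives Γ (a ∶ A)) :
    IsSubst (fun Γ t A => Derives Γ (t ∶ A)) (A :: Γ) Γ (instSubst a) := by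
  intro n B hB
  cases n with
  | zero =>
    obtain rfl : A = B := by simpa using hB
    rw [← inst_eq, wk_inst]
    exact ha
  | succ n =>
    rw [wk_subst]
    refine conv' (.var (by simpa using hB)) ?_
    rw [wk_eq]
    rfl

theorem isSubst_inst₂ {Γ : Ctx} {a b A B : Tm} (ha : Derives Γ (a ∶ A))
    (hb : Derives Γ (b ∶ B.inst a)) :
    IsSubst (fun Γ t A => Derives Γ (t ∶ A)) (B :: A :: Γ) Γ (inst₂Subst a b) := by
  intro n C hC
  rcases n with _ | _ | n
  · obtain rfl : B = C := by simpa using hC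
    rw [← inst₂_eq, wk_one_inst₂]
    exact hb
  · obtain rfl : A = C := by simpa using hC
    rw [← inst₂_eq, wk_inst₂]
    exact ha
  · rw [wk_subst]
    refine conv' (.var (by simpa using hC)) ?_
    rw [wk_eq]
    rfl

theorem inst_isType {Γ : Ctx} {a A B : Tm} (h : Derives (A :: Γ) (isType B))
    (ha : Derives Γ (a ∶ A)) : Derives Γ (isType (B.inst a)) := by
  rw [inst_eq]
  exact h.subst ha.isSubst_inst

theorem inst₂_isType {Γ : Ctx} {a b A B C : Tm} (h : Derives (B :: A :: Γ) (isType C))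
    (ha : Derives Γ (a ∶ A)) (hb : Derives Γ (b ∶ B.inst a)) :
    Derives Γ (isType (C.inst₂ a b)) := by
  rw [inst₂_eq]
  exact h.subst (isSubst_inst₂ ha hb)

theorem wkUp_isType {Γ : Ctx} {A P : Tm} (h : Derives (A :: Γ) (isType P)) (B : Tm) :
    Derives (A.wk 1 :: B :: Γ) (isType (P.wkUp 1)) := by
  rw [wkUp_eq, wk_eq]
  refine h.subst_of_liftable (σ := upSubst fun n => Tm.var (n + 1)) liftable_var
    (IsSubst.up liftable_var ?_ A)
  exact fun n A hA => ⟨n + 1, A, by simpa using hA, rfl, by rw [← wk_eq, wk_wk]⟩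

theorem wkUp₂_isType {Γ : Ctx} {A P : Tm} (h : Derives (A :: Γ) (isType P)) (B C : Tm) :
    Derives (A.wk 2 :: C :: B :: Γ) (isType (P.wkUp 2)) := by
  simpa only [wk_wk, wkUp_wkUp] using (h.wkUp_isType B).wkUp_isType C

theorem wkUp₃_isType {Γ : Ctx} {A P : Tm} (h : Derives (A :: Γ) (isType P)) (B C D : Tm) :
    Derives (A.wk 3 :: D :: C :: B :: Γ) (isType (P.wkUp 3)) := by
  simpa only [wk_wk, wkUp_wkUp] using (h.wkUp₂_isType B C).wkUp_isType D

theorem wk₂_isType {Γ : Ctx} {A : Tm} (h : Derives Γ (isType A)) (B C : Tm) :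
    Derives (C :: B :: Γ) (isType (A.wk 2)) := by
  simpa only [wk_wk] using (h.wk_isType B).wk_isType C

theorem wk₂_hasType {Γ : Ctx} {t A : Tm} (h : Derives Γ (t ∶ A)) (B C : Tm) :
    Derives (C :: B :: Γ) (t.wk 2 ∶ A.wk 2) := by
  simpa only [wk_wk] using (h.wk_hasType B).wk_hasType C

theorem wk₃_hasType {Γ : Ctx} {t A : Tm} (h : Derives Γ (t ∶ A)) (B C D : Tm) :
    Derives (D :: C :: B :: Γ) (t.wk 3 ∶ A.wk 3) := by
  simpa only [wk_wk] using (h.wk₂_hasType B C).wk_hasType D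

/-- The judgments about the components of a type former that follow from those about the type. -/
def Components (Γ : Ctx) : Tm → Prop
  | .pi A B => Derives Γ (isType A) ∧ Derives (A :: Γ) (isType B)
  | .sigma A B => Derives Γ (isType A) ∧ Derives (A :: Γ) (isType B)
  | .id A a b => Derives Γ (isType A) ∧ Derives Γ (a ∶ A) ∧ Derives Γ (b ∶ A)
  | .sum A B => Derives Γ (isType A) ∧ Derives Γ (isType B)
  | .gq V E => Derives Γ (V ∶ Tm.univ) ∧ Derives Γ (E ∶ arr V (arr V Tm.univ))
  | _ => True

/-- In either form of judgment it is the subject that is analyzed, never its type. Neither `conv`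
nor `el` changes the subject, so inversion is a direct induction and injectivity of the type formers
is not needed. -/
theorem components_aux {Γ : Ctx} {𝒥 : Judgment} (h : Derives Γ 𝒥) :
    match 𝒥 with
    | isType A => Components Γ A
    | hasType A _ => Components Γ A := by
  induction h with
  | pi h₁ h₂ => exact ⟨h₁, h₂⟩
  | pi_univ h₁ h₂ => exact ⟨.el h₁, .el h₂⟩
  | sigma h₁ h₂ => exact ⟨h₁, h₂⟩
  | sigma_univ h₁ h₂ => exact ⟨.el h₁, .el h₂⟩
  | id h₁ h₂ h₃ => exact ⟨h₁, h₂, h₃⟩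
  | id_univ h₁ h₂ h₃ => exact ⟨.el h₁, h₂, h₃⟩
  | sum h₁ h₂ => exact ⟨h₁, h₂⟩
  | sum_univ h₁ h₂ => exact ⟨.el h₁, .el h₂⟩
  | gq h₁ h₂ => exact ⟨h₁, h₂⟩
  | conv _ _ _ ih => exact ih
  | el _ ih => exact ih
  | _ => trivial

theorem components {Γ : Ctx} {A : Tm} (h : Derives Γ (isType A)) : Components Γ A :=
  components_aux h

theorem gq_univ {Γ : Ctx} {V E : Tm} (h : Derives Γ (isType (.gq V E))) :
    Derives Γ (.gq V E ∶ Tm.univ) :=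
  .gq h.components.1 h.components.2

/-! ### Typing of the derived formers -/

theorem arr {Γ : Ctx} {A B : Tm} (hA : Derives Γ (isType A)) (hB : Derives Γ (isType B)) :
    Derives Γ (isType (arr A B)) :=
  .pi hA (hB.wk_isType A)

theorem prod {Γ : Ctx} {A B : Tm} (hA : Derives Γ (isType A)) (hB : Derives Γ (isType B)) :
    Derives Γ (isType (prod A B)) :=
  .sigma hA (hB.wk_isType A)

theorem app_arr {Γ : Ctx} {A B f a : Tm} (hf : Derives Γ (f ∶ Tm.arr A B))
    (ha : Derives Γ (a ∶ A)) : Derives Γ (.app f a ∶ B) :=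
  conv' (.app hf ha) (wk_inst _ _)

theorem lam_arr {Γ : Ctx} {A B t : Tm} (hA : Derives Γ (isType A))
    (h : Derives (A :: Γ) (t ∶ B.wk 1)) : Derives Γ (.lam t ∶ Tm.arr A B) :=
  .lam hA h

theorem transport {Γ : Ctx} {A P a b p u : Tm} (hP : Derives (A :: Γ) (isType P))
    (hid : Derives Γ (isType (.id A a b))) (hp : Derives Γ (p ∶ .id A a b))
    (hu : Derives Γ (u ∶ P.inst a)) : Derives Γ (transport P p u ∶ P.inst b) := by
  obtain ⟨hA, ha, hb⟩ := hid.components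
  refine conv' (.J hA ha (hP.wk_isType _) (conv' hu ?_) hb hp) ?_ <;> rw [wk_one_inst₂]

theorem pathContext {Γ : Ctx} {A a : Tm} (hA : Derives Γ (isType A)) (ha : Derives Γ (a ∶ A)) :
    Derives (A :: Γ) (isType (.id (A.wk 1) (a.wk 1) (.var 0))) :=
  .id (hA.wk_isType _) (ha.wk_hasType _) (.var rfl)

theorem apd {Γ : Ctx} {A P f a b p : Tm} (hP : Derives (A :: Γ) (isType P))
    (hid : Derives Γ (isType (.id A a b))) (hp : Derives Γ (p ∶ .id A a b))
    (hf : Derives Γ (f ∶ .pi A P)) :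
    Derives Γ (apd P f a p ∶ .id (P.inst b) (Tm.transport P p (.app f a)) (.app f b)) := by
  obtain ⟨hA, ha, hb⟩ := hid.components
  have key : ∀ c q, (Tm.id (P.wk 1) (Tm.transport (P.wkUp 2) (.var 0) (.app (f.wk 2) (a.wk 2)))
      (.app (f.wk 2) (.var 1))).inst₂ c q =
        .id (P.inst c) (Tm.transport P q (.app f a)) (.app f c) := by
    intro c q
    have h : ∀ t : Tm, (t.wk 2).subst (inst₂Subst c q) = t := fun t => by
      rw [← inst₂_eq, wk_inst₂]
    rw [inst₂_eq]
    simp only [Tm.subst, transport_subst, wkUp_subst_inst₂, h]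
    rw [← inst₂_eq, wk_one_inst₂]
    rfl
  have hf' := hf.wk₂_hasType A (.id (A.wk 1) (a.wk 1) (.var 0))
  have hpi : (Tm.pi A P).wk 2 = .pi (A.wk 2) (P.wkUp 2) := rfl
  rw [hpi] at hf'
  have hfa : ∀ c, Derives Γ (c ∶ A) → Derives Γ (.app f c ∶ P.inst c) := fun c hc => hf.app hc
  refine conv' (.J hA ha (.id (hP.wk_isType _) ?_ ?_) ?_ hb hp) (key b p)
  · have h := transport (u := .app (f.wk 2) (a.wk 2)) (hP.wkUp₂_isType A
      (.id (A.wk 1) (a.wk 1) (.var 0))) (a := a.wk 2) (b := .var 1) (p := .var 0) ?_ ?_ ?_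
    · exact conv' h (wkUp_inst_var 1 P)
    · exact .id (hA.wk₂_isType _ _) (ha.wk₂_hasType _ _) (.var (A := A) rfl)
    · exact conv' (.var rfl) (by simp [Tm.wk, rename, rename_rename])
    · exact hf'.app (ha.wk₂_hasType _ _)
  · exact conv' (hf'.app (.var (A := A) rfl)) (wkUp_inst_var 1 P)
  · rw [key]
    -- Transport along `refl` equals its argument only up to `J_refl`, so `refl` has to be retyped
    -- by conversion.
    refine .conv (.refl (hfa a ha)) ?_ (.id (.rfl _) (.symm (.J_refl _ _ _)) (.rfl _))
    exact .id (hP.inst_isType ha)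
      (transport hP (.id hA ha ha) (.refl ha) (hfa a ha)) (hfa a ha)

theorem isType_vertMethod {Γ : Ctx} {V E P : Tm} (hq : Derives Γ (.gq V E ∶ Tm.univ))
    (hP : Derives (.gq V E :: Γ) (isType P)) :
    Derives Γ (isType (.pi V (P.instWk 1 (.vert (.var 0))))) := by
  have hV := hq.el.components.1.el
  refine .pi hV ((hP.wkUp_isType V).inst_isType ?_)
  exact .vert (hq.wk_hasType V) (.var (A := V) rfl)

theorem isType_edge {Γ : Ctx} {V E i j : Tm} (hq : Derives Γ (.gq V E ∶ Tm.univ))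
    (hi : Derives Γ (i ∶ V)) (hj : Derives Γ (j ∶ V)) :
    Derives Γ (.app (.app E i) j ∶ Tm.univ) :=
  (hq.el.components.2.app_arr hi).app_arr hj

theorem isType_edgeMethod {Γ : Ctx} {V E P v : Tm} (hq : Derives Γ (.gq V E ∶ Tm.univ))
    (hP : Derives (.gq V E :: Γ) (isType P))
    (hv : Derives Γ (v ∶ .pi V (P.instWk 1 (.vert (.var 0))))) :
    Derives Γ (isType (edgeMethod V E P v)) := by
  have hV := hq.el.components.1.el
  set D : Tm := .app (.app (E.wk 2) (.var 1)) (.var 0)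
  have hq2 : Derives (V.wk 1 :: V :: Γ) (.gq (V.wk 2) (E.wk 2) ∶ Tm.univ) :=
    hq.wk₂_hasType V (V.wk 1)
  have hq3 : Derives (D :: V.wk 1 :: V :: Γ) (.gq (V.wk 3) (E.wk 3) ∶ Tm.univ) :=
    hq.wk₃_hasType V (V.wk 1) D
  have hv3 : ∀ k, Derives (D :: V.wk 1 :: V :: Γ) (.var k ∶ V.wk 3) →
      Derives (D :: V.wk 1 :: V :: Γ) (.app (v.wk 3) (.var k) ∶ P.instWk 3 (.vert (.var k))) := by
    intro k hk
    have h := hv.wk₃_hasType V (V.wk 1) D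
    refine conv' (Derives.app (A := V.wk 3) (B := (P.instWk 1 (.vert (.var 0))).wkUp 3) h hk) ?_
    rw [inst_eq, wkUp_eq, instWk_eq, instWk_eq, subst_subst, subst_subst]
    refine subst_congr P fun n => ?_
    cases n <;> rfl
  have h0 : Derives (D :: V.wk 1 :: V :: Γ) (.var 0 ∶ .app (.app (E.wk 3) (.var 2)) (.var 1)) :=
    conv' (.var rfl) (by simp [D, Tm.wk, rename, rename_rename])
  have h1 : Derives (D :: V.wk 1 :: V :: Γ) (.var 1 ∶ V.wk 3) :=
    conv' (.var rfl) (wk_wk _ _ _)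
  have h2 : Derives (D :: V.wk 1 :: V :: Γ) (.var 2 ∶ V.wk 3) := .var (A := V) rfl
  refine .pi hV (.pi (hV.wk_isType V) (.pi (.el (isType_edge hq2 ?_ ?_)) ?_))
  · exact .var (A := V) rfl
  · exact conv' (.var rfl) (wk_wk _ _ _)
  · have hP3 := hP.wkUp₃_isType V (V.wk 1) D
    have hid : Derives (D :: V.wk 1 :: V :: Γ)
        (isType (.id (.gq (V.wk 3) (E.wk 3)) (.vert (.var 2)) (.vert (.var 1)))) :=
      .id hq3.el (.vert hq3 h2) (.vert hq3 h1)
    exact .id (hP3.inst_isType (.vert hq3 h1))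
      (transport hP3 hid (.edge hq3 h2 h1 h0) (hv3 2 h2)) (hv3 1 h1)

theorem edgeMethod_app {Γ : Ctx} {V E P v d i j e : Tm}
    (hd : Derives Γ (d ∶ edgeMethod V E P v)) (hi : Derives Γ (i ∶ V)) (hj : Derives Γ (j ∶ V))
    (he : Derives Γ (e ∶ .app (.app E i) j)) :
    Derives Γ (.app (.app (.app d i) j) e ∶
      .id (P.inst (.vert j)) (Tm.transport P (.edge V E i j e) (.app v i)) (.app v j)) := by
  have h₁ := hd.app hi
  rw [inst_eq] at h₁
  simp only [Tm.subst, wk_subst_instSubst] at h₁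
  have h₂ := h₁.app hj
  rw [inst_eq] at h₂
  simp only [Tm.subst] at h₂
  have h₃ : Derives Γ (.app (.app (.app d i) j) e ∶ _) := h₂.app (conv' he ?_)
  · refine conv' h₃ ?_
    simp only [inst_eq _ e, Tm.subst, transport_subst, instWk, inst_subst, wk_subst_instSubst,
      wk_subst_instSubst₂, wk_subst_instSubst₃, wkUp_subst_inst, wkUp_subst_instSubst₂,
      wkUp_subst_instSubst₃]
    simp only [upSubst, instSubst, Tm.subst, var_wk, wk_wk, Nat.reduceAdd, wk_subst_instSubst,
      wk_subst_instSubst₂]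
  · simp only [wk_subst_instSubst, wk_subst_instSubst₂]
    simp only [upSubst, instSubst, Tm.subst, wk_subst_instSubst]

/-- This function occurs in the type of `gqComp`; its typing is needed to see that this type is well
formed. -/
theorem gqElim_fun {Γ : Ctx} {V E P v d : Tm} (hq : Derives Γ (.gq V E ∶ Tm.univ))
    (hP : Derives (.gq V E :: Γ) (isType P))
    (hv : Derives Γ (v ∶ .pi V (P.instWk 1 (.vert (.var 0)))))
    (hd : Derives Γ (d ∶ edgeMethod V E P v)) :
    Derives Γ (.lam (.gqElim (P.wkUp 1) (v.wk 1) (d.wk 1) (.var 0)) ∶ .pi (.gq V E) P) := by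
  refine .lam hq.el (conv' (.gqElim (V := V.wk 1) (E := E.wk 1) (hq.wk_hasType _)
    (hP.wkUp_isType (.gq V E)) ?_ ?_ (.var (A := .gq V E) rfl)) ?_)
  · refine conv' (hv.wk_hasType _) ?_
    rw [wk_eq, Tm.subst, instWk_subst₁, ← wkUp_eq, ← wk_eq]
    rfl
  · refine conv' (hd.wk_hasType _) ?_
    rw [wk_eq, edgeMethod_subst, ← wkUp_eq, ← wk_eq, ← wk_eq, ← wk_eq]
  · rw [wkUp_inst_var, wk_zero]

theorem isEquiv_half {Γ : Ctx} {A B : Tm} :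
    Derives (B.wk 1 :: Tm.arr B A :: Γ) (.app (.var 1) (.var 0) ∶ A.wk 2) := by
  refine app_arr (A := B.wk 2) (conv' (.var (A := Tm.arr B A) rfl) (arr_wk _ _ _)) ?_
  exact conv' (.var rfl) (wk_wk _ _ _)

theorem isType_section {Γ : Ctx} {A B f : Tm} (hB : Derives Γ (isType B))
    (hf : Derives Γ (f ∶ Tm.arr A B)) :
    Derives (Tm.arr B A :: Γ) (isType (.pi (B.wk 1)
      (.id (B.wk 2) (.app (f.wk 2) (.app (.var 1) (.var 0))) (.var 0)))) := by
  refine .pi (hB.wk_isType _) (.id (hB.wk₂_isType _ _) ?_ (conv' (.var rfl) (wk_wk _ _ _)))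
  exact app_arr (conv' (hf.wk₂_hasType _ _) (arr_wk _ _ _)) (isEquiv_half)

theorem isType_retraction {Γ : Ctx} {A B f : Tm} (hA : Derives Γ (isType A))
    (hf : Derives Γ (f ∶ Tm.arr A B)) :
    Derives (Tm.arr B A :: Γ) (isType (.pi (A.wk 1)
      (.id (A.wk 2) (.app (.var 1) (.app (f.wk 2) (.var 0))) (.var 0)))) := by
  have h0 : Derives (A.wk 1 :: Tm.arr B A :: Γ) (.var 0 ∶ A.wk 2) :=
    conv' (.var rfl) (wk_wk _ _ _)
  refine .pi (hA.wk_isType _) (.id (hA.wk₂_isType _ _) ?_ h0)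
  refine app_arr (A := B.wk 2) (conv' (.var (A := Tm.arr B A) rfl) (arr_wk _ _ _)) ?_
  exact app_arr (conv' (hf.wk₂_hasType _ _) (arr_wk _ _ _)) h0

theorem isEquiv {Γ : Ctx} {A B f : Tm} (hA : Derives Γ (isType A)) (hB : Derives Γ (isType B))
    (hf : Derives Γ (f ∶ Tm.arr A B)) : Derives Γ (isType (isEquiv A B f)) :=
  prod (.sigma (hB.arr hA) (isType_section hB hf))
    (.sigma (hB.arr hA) (isType_retraction hA hf))

theorem isType_isEquiv_var {Γ : Ctx} {A B : Tm} (hA : Derives Γ (isType A))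
    (hB : Derives Γ (isType B)) :
    Derives (Tm.arr A B :: Γ) (isType (Tm.isEquiv (A.wk 1) (B.wk 1) (.var 0))) :=
  isEquiv (hA.wk_isType _) (hB.wk_isType _) (conv' (.var rfl) (arr_wk _ _ _))

theorem equiv {Γ : Ctx} {A B : Tm} (hA : Derives Γ (isType A)) (hB : Derives Γ (isType B)) :
    Derives Γ (isType (equiv A B)) :=
  .sigma (hA.arr hB) (isType_isEquiv_var hA hB)

theorem idEquiv {Γ : Ctx} {A : Tm} (hA : Derives Γ (isType A)) :
    Derives Γ (idEquiv ∶ Tm.equiv A A) := by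
  have hi : Derives Γ (.lam (.var 0) ∶ Tm.arr A A) := .lam_arr hA (.var rfl)
  have h₀ : Derives (A :: Γ) (.var 0 ∶ A.wk 1) := .var rfl
  have hr : Derives Γ (.lam (.refl (.var 0)) ∶ .pi A (.id (A.wk 1) (.var 0) (.var 0))) :=
    .lam hA (.refl h₀)
  have b : ∀ t, Conv (.app (.lam (.var 0)) t) t := fun t => .beta _ _
  have hs := isType_section hA hi
  have hs' := hs.inst_isType hi
  have ht := isType_retraction hA hi
  have ht' := ht.inst_isType hi
  refine .pair (hA.arr hA) (isType_isEquiv_var hA hA) hi (conv' (.pair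
    (.sigma (hA.arr hA) hs) (wk_isType (.sigma (hA.arr hA) ht) _)
    (.pair (hA.arr hA) hs hi (.conv hr hs' ?_))
    (conv' (.pair (hA.arr hA) ht hi (.conv hr ht' ?_)) (wk_inst _ _).symm)) ?_)
  · rw [inst_eq, Tm.subst, wk_subst_instSubst, Tm.subst, wk_subst_instSubst₂]
    exact .pi (.rfl _) (.id (.rfl _) (.symm (.trans (b _) (b _))) (.rfl _))
  · rw [inst_eq, Tm.subst, wk_subst_instSubst, Tm.subst, wk_subst_instSubst₂]
    exact .pi (.rfl _) (.id (.rfl _) (.symm (.trans (b _) (b _))) (.rfl _))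
  · rw [inst_eq, isEquiv_subst, wk_subst_instSubst]
    rfl

theorem idToEquiv {Γ : Ctx} {A B : Tm} (hA : Derives Γ (A ∶ Tm.univ))
    (hB : Derives Γ (B ∶ Tm.univ)) :
    Derives Γ (idToEquiv A ∶ Tm.arr (.id Tm.univ A B) (Tm.equiv A B)) := by
  have w : ∀ c q : Tm, (Tm.equiv (A.wk 3) (.var 1)).inst₂ c q = Tm.equiv (A.wk 1) c := by
    intro c q
    rw [inst₂_eq, equiv_subst, wk_subst_inst₂' 1]
    rfl
  have hA' := hA.wk_hasType (.id Tm.univ A B)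
  have hA₃ := (hA'.wk₂_hasType Tm.univ (.id Tm.univ ((A.wk 1).wk 1) (.var 0))).el
  rw [show (A.wk 1).wk 2 = A.wk 3 from wk_wk 1 2 A] at hA₃
  refine .lam_arr (.id .univ hA hB) (conv' (.J (A := Tm.univ) .univ hA' (equiv hA₃ ?_)
    (conv' hA'.el.idEquiv (w _ _).symm) (hB.wk_hasType _)
    (.var (A := .id Tm.univ A B) rfl)) ?_)
  · exact .el (.var (A := Tm.univ) rfl)
  · rw [w, wk_eq 1 (Tm.equiv A B), equiv_subst, ← wk_eq, ← wk_eq]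

theorem app_var {Γ : Ctx} {A B f : Tm} (hf : Derives Γ (f ∶ .pi A B)) :
    Derives (A :: Γ) (.app (f.wk 1) (.var 0) ∶ B) := by
  refine conv' (.app (A := A.wk 1) (B := B.wkUp 1) (hf.wk_hasType A) (.var rfl)) ?_
  rw [wkUp_inst_var, wk_zero]

theorem happly {Γ : Ctx} {A B f g : Tm} (hA : Derives Γ (isType A))
    (hB : Derives (A :: Γ) (isType B)) (hf : Derives Γ (f ∶ .pi A B))
    (hg : Derives Γ (g ∶ .pi A B)) :
    Derives Γ (happly A B f ∶ Tm.arr (.id (.pi A B) f g)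
      (.pi A (.id B (.app (f.wk 1) (.var 0)) (.app (g.wk 1) (.var 0))))) := by
  have hpi : ∀ k, (Tm.pi A B).wk k = .pi (A.wk k) (B.wkUp k) := fun k => rfl
  have w : ∀ c q : Tm, (Tm.pi (A.wk 3) (.id (B.wkUp 3) (.app (f.wk 4) (.var 0))
      (.app (.var 2) (.var 0)))).inst₂ c q =
        .pi (A.wk 1) (.id (B.wkUp 1) (.app (f.wk 2) (.var 0)) (.app (c.wk 1) (.var 0))) := by
    intro c q
    rw [inst₂_eq]
    have hf₄ : (f.wk 4).subst (upSubst (inst₂Subst c q)) = f.wk 2 := by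
      rw [← wk_wk 3 1, wk_subst_up, wk_subst_inst₂' 1, wk_wk]
    simp only [Tm.subst, wk_subst_inst₂' 1, wkUp_subst_inst₂', hf₄]
    rfl
  have hA' := hA.wk_isType (.id (.pi A B) f g)
  have hB' := hB.wkUp_isType (.id (.pi A B) f g)
  have hf' := hf.wk_hasType (.id (.pi A B) f g)
  have hg' := hg.wk_hasType (.id (.pi A B) f g)
  rw [hpi] at hf' hg'
  have hi' : Derives (.id (.pi A B) f g :: Γ) (isType (.pi (A.wk 1) (B.wkUp 1))) := .pi hA' hB'
  have hA₃ := hA'.wk₂_isType (.pi (A.wk 1) (B.wkUp 1))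
    (.id ((Tm.pi (A.wk 1) (B.wkUp 1)).wk 1) ((f.wk 1).wk 1) (.var 0))
  have hB₃ := hB'.wkUp₂_isType (.pi (A.wk 1) (B.wkUp 1))
    (.id ((Tm.pi (A.wk 1) (B.wkUp 1)).wk 1) ((f.wk 1).wk 1) (.var 0))
  have hf₃ := hf'.wk₂_hasType (.pi (A.wk 1) (B.wkUp 1))
    (.id ((Tm.pi (A.wk 1) (B.wkUp 1)).wk 1) ((f.wk 1).wk 1) (.var 0))
  rw [show (f.wk 1).wk 2 = f.wk 3 from wk_wk 1 2 f,
    show (Tm.pi (A.wk 1) (B.wkUp 1)).wk 2 = .pi ((A.wk 1).wk 2) ((B.wkUp 1).wkUp 2) from rfl,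
    show (A.wk 1).wk 2 = A.wk 3 from wk_wk 1 2 A, wkUp_wkUp] at hf₃
  rw [show (A.wk 1).wk 2 = A.wk 3 from wk_wk 1 2 A] at hA₃
  rw [show (A.wk 1).wk 2 = A.wk 3 from wk_wk 1 2 A, wkUp_wkUp] at hB₃
  have hfv := app_var hf'
  rw [show (f.wk 1).wk 1 = f.wk 2 from wk_wk 1 1 f] at hfv
  refine .lam_arr (.id (.pi hA hB) hf hg) (conv' (.J (A := .pi (A.wk 1) (B.wkUp 1)) (a := f.wk 1)
    (b := g.wk 1) hi' hf' (.pi hA₃ (.id hB₃ ?_ ?_)) (conv' (.lam hA' (.refl hfv))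
      ?_) hg' (.var (A := .id (.pi A B) f g) rfl)) ?_)
  · have h := app_var hf₃
    rw [show (f.wk 3).wk 1 = f.wk 4 from wk_wk 3 1 f] at h
    exact h
  · refine app_var (f := .var 1) ?_
    refine conv' (.var rfl) ?_
    change Tm.pi ((A.wk 1).wk 2) ((B.wkUp 1).wkUp 2) = _
    rw [wk_wk, wkUp_wkUp]
  · rw [w, show (f.wk 1).wk 1 = f.wk 2 from wk_wk 1 1 f]
  · rw [w]
    change _ = Tm.pi (A.wk 1) (.id (B.wkUp 1) (.app ((f.wk 1).wkUp 1) (.var 0))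
      (.app ((g.wk 1).wkUp 1) (.var 0)))
    rw [wk_wkUp, wk_wkUp, wk_wk, wk_wk]

end Derives

/-! ### Presuppositions -/

/-- Each type of the context is a type over the remaining part of the context. -/
inductive WellFormed : Ctx → Prop
  | nil : WellFormed []
  | cons {Γ : Ctx} {A : Tm} : WellFormed Γ → Derives Γ (isType A) → WellFormed (A :: Γ)

theorem WellFormed.lookup {Γ : Ctx} (h : WellFormed Γ) :
    ∀ {n : ℕ} {A : Tm}, Γ[n]? = some A → Derives Γ (isType (A.wk (n + 1))) := by
  induction h with
  | nil => intro n A h; simp at h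
  | @cons Γ B _ hB ih =>
    intro n A h
    cases n with
    | zero =>
      obtain rfl : B = A := by simpa using h
      exact hB.wk_isType B
    | succ n =>
      rw [← wk_wk]
      exact (ih (by simpa using h)).wk_isType B

/-- The checker may convert an inferred type only once it is known to be a type. Most rules carry
the required premises. Well-formedness of the context enters for variables, and the axioms `gqComp`,
`funext` and `ua` need the typing of the derived formers. -/
theorem Derives.presupposition_aux {Γ : Ctx} {𝒥 : Judgment} (h : Derives Γ 𝒥) :
    WellFormed Γ → match 𝒥 with
      | isType _ => True
      | hasType _ A => Derives Γ (isType A) := by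
  induction h with
  | var h => exact fun w => w.lookup h
  | conv _ h => exact fun _ => h
  | pi_univ => exact fun _ => .univ
  | lam h _ _ ih => exact fun w => .pi h (ih (w.cons h))
  | app _ h ih _ => exact fun w => (ih w).components.2.inst_isType h
  | sigma_univ => exact fun _ => .univ
  | pair h₁ h₂ => exact fun _ => .sigma h₁ h₂
  | sigmaElim _ h _ ht => exact fun _ => h.inst_isType ht
  | id_univ => exact fun _ => .univ
  | refl h ih => exact fun w => .id (ih w) h h
  | J hA ha hC _ hb hp =>
    refine fun _ => hC.inst₂_isType hb (hp.conv' ?_)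
    rw [inst_eq, Tm.subst, wk_subst_instSubst, wk_subst_instSubst]
    rfl
  | empty => exact fun _ => .univ
  | emptyElim h ht => exact fun _ => h.inst_isType ht
  | unit => exact fun _ => .univ
  | star => exact fun _ => .el .unit
  | unitElim h _ ht => exact fun _ => h.inst_isType ht
  | nat => exact fun _ => .univ
  | zero => exact fun _ => .el .nat
  | succ => exact fun _ => .el .nat
  | natElim h _ _ ht => exact fun _ => h.inst_isType ht
  | sum_univ => exact fun _ => .univ
  | inl h _ _ ih => exact fun w => .sum (ih w) h
  | inr h _ _ ih => exact fun w => .sum h (ih w)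
  | sumElim _ h _ _ ht => exact fun _ => h.inst_isType ht
  | gq => exact fun _ => .univ
  | vert h => exact fun _ => h.el
  | edge h hi hj => exact fun _ => .id h.el (.vert h hi) (.vert h hj)
  | gqElim _ h _ _ ht => exact fun _ => h.inst_isType ht
  | @gqComp Γ V E P v d i j e hq hP hv hd hi hj he =>
    intro _
    have hi' := hq.vert hi
    have hj' := hq.vert hj
    have hid : Derives Γ (isType (.id (.gq V E) (.vert i) (.vert j))) := .id hq.el hi' hj'
    have hv' : ∀ k, Derives Γ (k ∶ V) → Derives Γ (.app v k ∶ P.inst (.vert k)) := fun k hk =>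
      (hv.app hk).conv' (instWk_inst _ _ _)
    have ht : Derives Γ (isType
        (.id (P.inst (.vert j)) (Tm.transport P (Tm.edge V E i j e) (Tm.app v i)) (Tm.app v j))) :=
      .id (hP.inst_isType hj') (hP.transport hid (.edge hq hi hj he) (hv' i hi)) (hv' j hj)
    -- At a vertex the eliminator reduces to `v k` by `beta` and `gqElim_vert`; this conversion
    -- matches the type of `apd` with that of `d i j e`.
    have key : ∀ k, Conv
        (.app (.lam (.gqElim (P.wkUp 1) (v.wk 1) (d.wk 1) (.var 0))) (.vert k)) (.app v k) := by
      intro k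
      refine (Conv.beta _ _).trans ?_
      rw [inst_eq, Tm.subst, wk_subst_instSubst]
      exact .gqElim_vert _ _ _ _
    refine .id ht (.conv (hP.apd hid (.edge hq hi hj he) (.gqElim_fun hq hP hv hd)) ht ?_)
      (hd.edgeMethod_app hi hj he)
    exact .id (.rfl _) (.J (.rfl _) (key i) (.rfl _)) (key j)
  | funext hA hB hf hg =>
    exact fun _ => .isEquiv (.id (.pi hA hB) hf hg) (.pi hA (.id hB hf.app_var hg.app_var))
      (.happly hA hB hf hg)
  | ua hA hB => exact fun _ => .isEquiv (.id .univ hA hB) (.equiv hA.el hB.el) (.idToEquiv hA hB)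
  | _ => exact fun _ => trivial

theorem Derives.presupposition {Γ : Ctx} {t A : Tm} (h : Derives Γ (t ∶ A))
    (hΓ : WellFormed Γ) : Derives Γ (isType A) :=
  h.presupposition_aux hΓ

end HoTT

/-! ### A sound, fuel-bounded conversion test with unfolding of definitions -/

namespace HoTT

open Tm Judgment

/-! ### Normalization -/

namespace Tm

/-- Syntactic equality. -/
def beq : Tm → Tm → Bool
  | var m, var n => m == n
  | univ, univ => true
  | pi a b, pi a' b' => beq a a' && beq b b'
  | lam a, lam a' => beq a a'
  | app a b, app a' b' => beq a a' && beq b b'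
  | sigma a b, sigma a' b' => beq a a' && beq b b'
  | pair a b, pair a' b' => beq a a' && beq b b'
  | sigmaElim a b c, sigmaElim a' b' c' => beq a a' && beq b b' && beq c c'
  | id a b c, id a' b' c' => beq a a' && beq b b' && beq c c'
  | refl a, refl a' => beq a a'
  | J a b c, J a' b' c' => beq a a' && beq b b' && beq c c'
  | empty, empty => true
  | emptyElim a b, emptyElim a' b' => beq a a' && beq b b'
  | unit, unit => true
  | star, star => true
  | unitElim a b c, unitElim a' b' c' => beq a a' && beq b b' && beq c c'
  | nat, nat => true
  | zero, zero => true
  | succ a, succ a' => beq a a'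
  | natElim a b c d, natElim a' b' c' d' => beq a a' && beq b b' && beq c c' && beq d d'
  | sum a b, sum a' b' => beq a a' && beq b b'
  | inl a, inl a' => beq a a'
  | inr a, inr a' => beq a a'
  | sumElim a b c d, sumElim a' b' c' d' => beq a a' && beq b b' && beq c c' && beq d d'
  | gq a b, gq a' b' => beq a a' && beq b b'
  | vert a, vert a' => beq a a'
  | edge a b c d e, edge a' b' c' d' e' => beq a a' && beq b b' && beq c c' && beq d d' && beq e e'
  | gqElim a b c d, gqElim a' b' c' d' => beq a a' && beq b b' && beq c c' && beq d d'
  | gqComp a b c d e f g h, gqComp a' b' c' d' e' f' g' h' =>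
    beq a a' && beq b b' && beq c c' && beq d d' && beq e e' && beq f f' && beq g g' && beq h h'
  | funext a b c d, funext a' b' c' d' => beq a a' && beq b b' && beq c c' && beq d d'
  | ua a b, ua a' b' => beq a a' && beq b b'
  | _, _ => false

/-- Only this direction matters: all tests are sufficient conditions. -/
theorem eq_of_beq (s : Tm) : ∀ t, beq s t = true → s = t := by
  induction s <;> intro t h <;> cases t <;>
    first
    | rfl
    | exact absurd h Bool.false_ne_true
    | (simp only [beq, Bool.and_eq_true, beq_iff_eq] at h; simp_all only)
    | (simp only [beq, Bool.and_eq_true] at h; grind)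

/-! ### Efficient substitution -/

/-- The extension of a substitution under `n` binders. -/
def ups (σ : ℕ → Tm) : ℕ → ℕ → Tm
  | 0 => σ
  | n + 1 => upSubst (ups σ n)

theorem ups_lt (σ : ℕ → Tm) {n k : ℕ} (h : k < n) : ups σ n k = var k := by
  induction n generalizing k with
  | zero => omega
  | succ n ih =>
    cases k with
    | zero => rfl
    | succ k =>
      rw [ups, upSubst, ih (by omega)]
      rfl

theorem ups_add (σ : ℕ → Tm) (n k : ℕ) : ups σ n (k + n) = (σ k).wk n := by
  induction n with
  | zero => rw [wk_zero]; rfl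
  | succ n ih =>
    change (ups σ n (k + n)).wk 1 = _
    rw [ih, wk_wk]

theorem wk_subst_ups (t : Tm) (σ : ℕ → Tm) (n k : ℕ) :
    (t.wk k).subst (ups σ (n + k)) = (t.subst (ups σ n)).wk k := by
  induction k with
  | zero => rw [wk_zero, wk_zero]; rfl
  | succ k ih =>
    rw [← wk_wk, ← wk_wk, ← ih]
    exact wk_subst_up _ _

/-- Weakening by `k` variables under `d` binders. -/
def shift (k : ℕ) : Tm → ℕ → Tm
  | .var i, d => bif Nat.blt i d then .var i else .var (i + k)
  | .pi a b, d => .pi (shift k a d) (shift k b (d + 1))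
  | .lam a, d => .lam (shift k a (d + 1))
  | .app a b, d => .app (shift k a d) (shift k b d)
  | .sigma a b, d => .sigma (shift k a d) (shift k b (d + 1))
  | .pair a b, d => .pair (shift k a d) (shift k b d)
  | .sigmaElim a b c, d => .sigmaElim (shift k a (d + 1)) (shift k b d) (shift k c d)
  | .id a b c, d => .id (shift k a d) (shift k b d) (shift k c d)
  | .refl a, d => .refl (shift k a d)
  | .J a b c, d => .J (shift k a (d + 2)) (shift k b d) (shift k c d)
  | .emptyElim a b, d => .emptyElim (shift k a (d + 1)) (shift k b d)
  | .unitElim a b c, d => .unitElim (shift k a (d + 1)) (shift k b d) (shift k c d)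
  | .succ a, d => .succ (shift k a d)
  | .natElim a b c e, d => .natElim (shift k a (d + 1)) (shift k b d) (shift k c d) (shift k e d)
  | .sum a b, d => .sum (shift k a d) (shift k b d)
  | .inl a, d => .inl (shift k a d)
  | .inr a, d => .inr (shift k a d)
  | .sumElim a b c e, d => .sumElim (shift k a (d + 1)) (shift k b d) (shift k c d) (shift k e d)
  | .gq a b, d => .gq (shift k a d) (shift k b d)
  | .vert a, d => .vert (shift k a d)
  | .edge a b c e f, d => .edge (shift k a d) (shift k b d) (shift k c d) (shift k e d)
      (shift k f d)
  | .gqElim a b c e, d => .gqElim (shift k a (d + 1)) (shift k b d) (shift k c d) (shift k e d)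
  | .gqComp a b c e f g h i, d => .gqComp (shift k a d) (shift k b d) (shift k c (d + 1))
      (shift k e d) (shift k f d) (shift k g d) (shift k h d) (shift k i d)
  | .funext a b c e, d => .funext (shift k a d) (shift k b (d + 1)) (shift k c d) (shift k e d)
  | .ua a b, d => .ua (shift k a d) (shift k b d)
  | .univ, _ => .univ
  | .empty, _ => .empty
  | .unit, _ => .unit
  | .star, _ => .star
  | .nat, _ => .nat
  | .zero, _ => .zero

/-- `shift` carries a binder depth where `rename` builds a new function at every binder, which suits
evaluation; this identity transfers the substitution calculus to it. The same holds for `substList`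
below. -/
theorem shift_eq_subst (k : ℕ) (t : Tm) :
    ∀ d, shift k t d = t.subst (ups (fun i => .var (i + k)) d) := by
  induction t with
  | var i =>
    intro d
    unfold shift
    by_cases h : i < d
    · rw [show Nat.blt i d = true from Nat.blt_eq.mpr h, Tm.subst, ups_lt _ h]
      rfl
    · obtain ⟨j, rfl⟩ := Nat.exists_eq_add_of_le' (Nat.le_of_not_lt h)
      rw [Bool.eq_false_iff.mpr (mt Nat.blt_eq.mp h), Tm.subst, ups_add, var_wk, cond_false,
        Nat.add_right_comm]
  | _ => intro d; simp_all [shift, Tm.subst, ups]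

theorem shift_zero (k : ℕ) (t : Tm) : shift k t 0 = t.wk k := by
  rw [shift_eq_subst, wk_eq]
  rfl

/-- The substitution of the terms of a list for the first variables. -/
def listSubst : List Tm → ℕ → Tm
  | [], n => .var n
  | a :: _, 0 => a
  | _ :: l, n + 1 => listSubst l n

/-- Substitution of the terms of a list for the first variables under `d` binders. -/
def substList (l : List Tm) : Tm → ℕ → Tm
  | .var i, d =>
    bif Nat.blt i d then .var i
    else bif Nat.beq d 0 then listSubst l i else shift d (listSubst l (i - d)) 0
  | .pi a b, d => .pi (substList l a d) (substList l b (d + 1))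
  | .lam a, d => .lam (substList l a (d + 1))
  | .app a b, d => .app (substList l a d) (substList l b d)
  | .sigma a b, d => .sigma (substList l a d) (substList l b (d + 1))
  | .pair a b, d => .pair (substList l a d) (substList l b d)
  | .sigmaElim a b c, d => .sigmaElim (substList l a (d + 1)) (substList l b d) (substList l c d)
  | .id a b c, d => .id (substList l a d) (substList l b d) (substList l c d)
  | .refl a, d => .refl (substList l a d)
  | .J a b c, d => .J (substList l a (d + 2)) (substList l b d) (substList l c d)
  | .emptyElim a b, d => .emptyElim (substList l a (d + 1)) (substList l b d)
  | .unitElim a b c, d => .unitElim (substList l a (d + 1)) (substList l b d) (substList l c d)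
  | .succ a, d => .succ (substList l a d)
  | .natElim a b c e, d => .natElim (substList l a (d + 1)) (substList l b d) (substList l c d)
      (substList l e d)
  | .sum a b, d => .sum (substList l a d) (substList l b d)
  | .inl a, d => .inl (substList l a d)
  | .inr a, d => .inr (substList l a d)
  | .sumElim a b c e, d => .sumElim (substList l a (d + 1)) (substList l b d) (substList l c d)
      (substList l e d)
  | .gq a b, d => .gq (substList l a d) (substList l b d)
  | .vert a, d => .vert (substList l a d)
  | .edge a b c e f, d => .edge (substList l a d) (substList l b d) (substList l c d)
      (substList l e d) (substList l f d)
  | .gqElim a b c e, d => .gqElim (substList l a (d + 1)) (substList l b d) (substList l c d)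
      (substList l e d)
  | .gqComp a b c e f g h i, d => .gqComp (substList l a d) (substList l b d)
      (substList l c (d + 1)) (substList l e d) (substList l f d) (substList l g d)
      (substList l h d) (substList l i d)
  | .funext a b c e, d => .funext (substList l a d) (substList l b (d + 1)) (substList l c d)
      (substList l e d)
  | .ua a b, d => .ua (substList l a d) (substList l b d)
  | .univ, _ => .univ
  | .empty, _ => .empty
  | .unit, _ => .unit
  | .star, _ => .star
  | .nat, _ => .nat
  | .zero, _ => .zero

theorem substList_eq_subst (l : List Tm) (t : Tm) :
    ∀ d, substList l t d = t.subst (ups (listSubst l) d) := by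
  induction t with
  | var i =>
    intro d
    unfold substList
    by_cases h : i < d
    · rw [show Nat.blt i d = true from Nat.blt_eq.mpr h, Tm.subst, ups_lt _ h]
      rfl
    · obtain ⟨j, rfl⟩ := Nat.exists_eq_add_of_le' (Nat.le_of_not_lt h)
      rw [Bool.eq_false_iff.mpr (mt Nat.blt_eq.mp h), Tm.subst, ups_add, cond_false, shift_zero,
        Nat.add_sub_cancel]
      cases d with
      | zero => rw [wk_zero]; rfl
      | succ d => rfl
  | _ => intro d; simp_all [substList, Tm.subst, ups]

/-- Consecutive beta steps merge into one simultaneous substitution: the pending list simply grows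
by the new argument. -/
theorem listSubst_cons (l : List Tm) (t a : Tm) :
    (t.subst (upSubst (listSubst l))).inst a = t.subst (listSubst (a :: l)) := by
  rw [inst_eq, subst_subst]
  refine subst_congr t fun n => ?_
  cases n with
  | zero => rfl
  | succ n => exact wk_subst_instSubst _ _

/-- Application to several arguments. -/
def appList (f : Tm) : List Tm → Tm
  | [] => f
  | a :: l => appList (.app f a) l

/-- The value of the function `t`, with `l` substituted, at the arguments. -/
def applyList (l : List Tm) : Tm → List Tm → Tm
  | .lam b, a :: args => applyList (a :: l) b args
  | t, args => appList (substList l t 0) args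

/-- A term as an application to several arguments. -/
def unapply : Tm → List Tm → Tm × List Tm
  | .app f a, args => unapply f (a :: args)
  | t, args => (t, args)

/-- One level of weak head normalization; `r` normalizes the scrutinees and the contracta. -/
def whnfStep (r : Tm → Tm) : Tm → Tm
  | app f a =>
    match unapply f [a] with
    | (g, args) =>
      match r g with
      | lam t => r (applyList [] (lam t) args)
      | g' => appList g' args
  | sigmaElim P m t =>
    match r t with
    | pair a b => r (app (app m a) b)
    | t' => sigmaElim P m t'
  | J C d p =>
    match r p with
    | refl _ => r d
    | p' => J C d p'
  | unitElim P c t =>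
    match r t with
    | star => r c
    | t' => unitElim P c t'
  | sumElim P f g t =>
    match r t with
    | inl a => r (app f a)
    | inr b => r (app g b)
    | t' => sumElim P f g t'
  | gqElim P v d t =>
    match r t with
    | vert i => r (app v i)
    | t' => gqElim P v d t'
  | t => t

/-- Weak head normalization, up to depth `n`. -/
def whnf : ℕ → Tm → Tm
  | 0 => fun t => t
  | n + 1 => whnfStep (whnf n)

end Tm

theorem appList_unapply (t : Tm) :
    ∀ args, appList (unapply t args).1 (unapply t args).2 = appList t args := by
  induction t with
  | app f a ih _ => exact fun args => ih (a :: args)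
  | _ => exact fun _ => rfl

theorem Conv.appList {f g : Tm} (h : Conv f g) (args : List Tm) :
    Conv (Tm.appList f args) (Tm.appList g args) := by
  induction args generalizing f g with
  | nil => exact h
  | cons a args ih => exact ih (.app h (.rfl a))

theorem conv_applyList (args : List Tm) :
    ∀ l t, Conv (Tm.appList (t.subst (listSubst l)) args) (applyList l t args) := by
  induction args with
  | nil =>
    intro l t
    have : applyList l t [] = substList l t 0 := by cases t <;> rfl
    rw [this, substList_eq_subst]
    exact .rfl _
  | cons a args ih =>
    intro l t
    cases t with
    | lam b =>
      refine .trans (Conv.appList (.beta _ _) args) ?_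
      rw [listSubst_cons]
      exact ih (a :: l) b
    | _ =>
      unfold applyList
      rw [substList_eq_subst]
      exact .rfl _

theorem listSubst_nil : listSubst [] = .var := rfl

/-- Any `r` that stays within the conversion class will do, so exhausting the recursion depth may
leave a term unreduced but cannot break soundness. -/
theorem conv_whnfStep {r : Tm → Tm} (hr : ∀ t, Conv t (r t)) (t : Tm) : Conv t (whnfStep r t) := by
  unfold whnfStep
  split
  · next f a =>
    have h := appList_unapply f [a]
    revert h
    cases unapply f [a] with
    | mk g args =>
      intro h
      change Conv (Tm.appList f [a]) _
      rw [← h]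
      change Conv (Tm.appList g args) _
      dsimp only
      split
      · next t hg =>
        have h' := conv_applyList args [] (.lam t)
        rw [listSubst_nil, subst_var] at h'
        exact .trans (Conv.appList (hg ▸ hr g) args) (.trans h' (hr _))
      · exact Conv.appList (hr g) args
  · split
    · next h =>
      exact .trans (.sigmaElim (.rfl _) (.rfl _) (h ▸ hr _)) (.trans (.sigmaElim_pair ..) (hr _))
    · exact .sigmaElim (.rfl _) (.rfl _) (hr _)
  · split
    · next h => exact .trans (.J (.rfl _) (.rfl _) (h ▸ hr _)) (.trans (.J_refl ..) (hr _))
    · exact .J (.rfl _) (.rfl _) (hr _)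
  · split
    · next h =>
      exact .trans (.unitElim (.rfl _) (.rfl _) (h ▸ hr _)) (.trans (.unitElim_star ..) (hr _))
    · exact .unitElim (.rfl _) (.rfl _) (hr _)
  · split
    · next h =>
      exact .trans (.sumElim (.rfl _) (.rfl _) (.rfl _) (h ▸ hr _))
        (.trans (.sumElim_inl ..) (hr _))
    · next h =>
      exact .trans (.sumElim (.rfl _) (.rfl _) (.rfl _) (h ▸ hr _))
        (.trans (.sumElim_inr ..) (hr _))
    · exact .sumElim (.rfl _) (.rfl _) (.rfl _) (hr _)
  · split
    · next h =>
      exact .trans (.gqElim (.rfl _) (.rfl _) (.rfl _) (h ▸ hr _))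
        (.trans (.gqElim_vert ..) (hr _))
    · exact .gqElim (.rfl _) (.rfl _) (.rfl _) (hr _)
  · exact .rfl _

theorem conv_whnf (n : ℕ) : ∀ t, Conv t (whnf n t) := by
  induction n with
  | zero => exact .rfl
  | succ n ih => exact conv_whnfStep ih

/-! ### Definitions

Over a context of `n` variables, `var (n + i)` stands for the `i`-th of a list of definitions. -/

/-- The definition of a closed term. -/
structure Entry where
  value : Tm
  type : Tm
  /-- whether the checker may replace the defined term by its value -/
  transparent : Bool

/-- A list of definitions. -/
abbrev Sig : Type := ℕ → Option Entry

/-- The terms `σ` are as defined by `S`. -/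
def Sig.Realized (S : Sig) (σ : ℕ → Tm) : Prop :=
  ∀ i e, S i = some e → Derives [] (σ i ∶ e.type.subst σ) ∧ σ i = e.value.subst σ

/-- Convertibility over `n` variables, when the definitions are realized by `σ`. -/
def ConvIn (σ : ℕ → Tm) (n : ℕ) (s t : Tm) : Prop := Conv (s.subst (ups σ n)) (t.subst (ups σ n))

theorem Conv.convIn {s t : Tm} (h : Conv s t) (σ : ℕ → Tm) (n : ℕ) : ConvIn σ n s t := h.subst _

/-- Unfolding of the definition that blocks the evaluation of a term. -/
def delta (S : Sig) (n : ℕ) : Tm → Option Tm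
  | var k =>
    bif Nat.ble n k then
      match S (k - n) with
      | some e => bif e.transparent then some (shift n e.value 0) else none
      | none => none
    else none
  | app f a => match delta S n f with
    | some f' => some (app f' a)
    | none => none
  | sigmaElim P m t => match delta S n t with
    | some t' => some (sigmaElim P m t')
    | none => none
  | J C d p => match delta S n p with
    | some p' => some (J C d p')
    | none => none
  | unitElim P c t => match delta S n t with
    | some t' => some (unitElim P c t')
    | none => none
  | sumElim P l r t => match delta S n t with
    | some t' => some (sumElim P l r t')
    | none => none
  | gqElim P v d t => match delta S n t with
    | some t' => some (gqElim P v d t')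
    | none => none
  | _ => none

/-- A realization sends a defined variable to the same term as its value, so unfolding the variable
is an equality after substitution; congruence carries it through the surrounding application or
eliminator. -/
theorem convIn_delta {S : Sig} {σ : ℕ → Tm} (hS : S.Realized σ) (n : ℕ) (t : Tm) :
    ∀ {t'}, delta S n t = some t' → ConvIn σ n t t' := by
  induction t with
  | var k =>
    intro t' h
    unfold delta at h
    cases hk : Nat.ble n k with
    | false => rw [hk] at h; cases h
    | true =>
      rw [hk, cond_true] at h
      split at h
      · next e he =>
        cases htr : e.transparent with
        | false => rw [htr] at h; cases h
        | true =>
          rw [htr] at h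
          obtain rfl := Option.some.inj h
          rw [shift_zero]
          have h1 := ups_add σ n (k - n)
          rw [Nat.sub_add_cancel (Nat.le_of_ble_eq_true hk), (hS _ _ he).2] at h1
          have h2 := wk_subst_ups e.value σ 0 n
          rw [Nat.zero_add] at h2
          unfold ConvIn
          rw [h2, Tm.subst, h1]
          exact .rfl _
      · cases h
  | app f a ih =>
    intro t' h
    unfold delta at h
    split at h
    · next hf =>
      obtain rfl := Option.some.inj h
      exact .app (ih hf) (.rfl _)
    · cases h
  | sigmaElim _ _ _ _ _ ih =>
    intro t' h
    unfold delta at h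
    split at h
    · next hf =>
      obtain rfl := Option.some.inj h
      exact .sigmaElim (.rfl _) (.rfl _) (ih hf)
    · cases h
  | J _ _ _ _ _ ih =>
    intro t' h
    unfold delta at h
    split at h
    · next hf =>
      obtain rfl := Option.some.inj h
      exact .J (.rfl _) (.rfl _) (ih hf)
    · cases h
  | unitElim _ _ _ _ _ ih =>
    intro t' h
    unfold delta at h
    split at h
    · next hf =>
      obtain rfl := Option.some.inj h
      exact .unitElim (.rfl _) (.rfl _) (ih hf)
    · cases h
  | sumElim _ _ _ _ _ _ _ ih =>
    intro t' h
    unfold delta at h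
    split at h
    · next hf =>
      obtain rfl := Option.some.inj h
      exact .sumElim (.rfl _) (.rfl _) (.rfl _) (ih hf)
    · cases h
  | gqElim _ _ _ _ _ _ _ ih =>
    intro t' h
    unfold delta at h
    split at h
    · next hf =>
      obtain rfl := Option.some.inj h
      exact .gqElim (.rfl _) (.rfl _) (.rfl _) (ih hf)
    · cases h
  | _ => intro t' h; cases h

/-! ### Convertibility tests -/

/-- Comparison of the immediate subterms; `r` compares the subterms. -/
def congrTest (r : ℕ → Tm → Tm → Bool) (n : ℕ) : Tm → Tm → Bool
  | .pi A B, .pi A' B' => r n A A' && r (n + 1) B B'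
  | .sigma A B, .sigma A' B' => r n A A' && r (n + 1) B B'
  | .app A B, .app A' B' => r n A A' && r n B B'
  | .pair A B, .pair A' B' => r n A A' && r n B B'
  | .sigmaElim A B C, .sigmaElim A' B' C' => r (n + 1) A A' && r n B B' && r n C C'
  | .id A B C, .id A' B' C' => r n A A' && r n B B' && r n C C'
  | .refl A, .refl A' => r n A A'
  | .J A B C, .J A' B' C' => r (n + 2) A A' && r n B B' && r n C C'
  | .unitElim A B C, .unitElim A' B' C' => r (n + 1) A A' && r n B B' && r n C C'
  | .sum A B, .sum A' B' => r n A A' && r n B B'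
  | .inl A, .inl A' => r n A A'
  | .inr A, .inr A' => r n A A'
  | .sumElim A B C D, .sumElim A' B' C' D' => r (n + 1) A A' && r n B B' && r n C C' && r n D D'
  | .gq A B, .gq A' B' => r n A A' && r n B B'
  | .vert A, .vert A' => r n A A'
  | .edge A B C D E, .edge A' B' C' D' E' =>
    r n A A' && r n B B' && r n C C' && r n D D' && r n E E'
  | .gqElim A B C D, .gqElim A' B' C' D' => r (n + 1) A A' && r n B B' && r n C C' && r n D D'
  | s, t => beq s t

theorem convIn_of_congrTest {σ : ℕ → Tm} {r : ℕ → Tm → Tm → Bool}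
    (hr : ∀ {n s t}, r n s t = true → ConvIn σ n s t) {n : ℕ} {s t : Tm}
    (h : congrTest r n s t = true) : ConvIn σ n s t := by
  unfold congrTest at h
  split at h
  · simp only [Bool.and_eq_true] at h
    exact .pi (hr h.1) (hr h.2)
  · simp only [Bool.and_eq_true] at h
    exact .sigma (hr h.1) (hr h.2)
  · simp only [Bool.and_eq_true] at h
    exact .app (hr h.1) (hr h.2)
  · simp only [Bool.and_eq_true] at h
    exact .pair (hr h.1) (hr h.2)
  · simp only [Bool.and_eq_true] at h
    exact .sigmaElim (hr h.1.1) (hr h.1.2) (hr h.2)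
  · simp only [Bool.and_eq_true] at h
    exact .id (hr h.1.1) (hr h.1.2) (hr h.2)
  · exact .refl (hr h)
  · simp only [Bool.and_eq_true] at h
    exact .J (hr h.1.1) (hr h.1.2) (hr h.2)
  · simp only [Bool.and_eq_true] at h
    exact .unitElim (hr h.1.1) (hr h.1.2) (hr h.2)
  · simp only [Bool.and_eq_true] at h
    exact .sum (hr h.1) (hr h.2)
  · exact .inl (hr h)
  · exact .inr (hr h)
  · simp only [Bool.and_eq_true] at h
    exact .sumElim (hr h.1.1.1) (hr h.1.1.2) (hr h.1.2) (hr h.2)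
  · simp only [Bool.and_eq_true] at h
    exact .gq (hr h.1) (hr h.2)
  · exact .vert (hr h)
  · simp only [Bool.and_eq_true] at h
    exact .edge (hr h.1.1.1.1) (hr h.1.1.1.2) (hr h.1.1.2) (hr h.1.2) (hr h.2)
  · simp only [Bool.and_eq_true] at h
    exact .gqElim (hr h.1.1.1) (hr h.1.1.2) (hr h.1.2) (hr h.2)
  · rw [eq_of_beq _ _ h]
    exact .rfl _

/-- `congrTest` and the uniqueness rule for functions. -/
def etaTest (r : ℕ → Tm → Tm → Bool) (n : ℕ) (s t : Tm) : Bool :=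
  match s with
  | lam a =>
    match t with
    | lam b => r (n + 1) a b
    | t => r (n + 1) a (app (shift 1 t 0) (var 0))
  | s =>
    match t with
    | lam b => r (n + 1) (app (shift 1 s 0) (var 0)) b
    | t => congrTest r n s t

/-- A function is compared with an abstraction by applying it to a fresh variable; `eta` then
removes the application. -/
theorem ConvIn.lam_eta {σ : ℕ → Tm} {n : ℕ} {a t : Tm}
    (h : ConvIn σ (n + 1) a (app (shift 1 t 0) (var 0))) : ConvIn σ n (lam a) t := by
  refine .trans (.lam h) ?_
  rw [Tm.subst, shift_zero]
  change Conv (.lam (.app ((t.wk 1).subst (upSubst (ups σ n))) _)) _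
  rw [wk_subst_up]
  exact .eta _

theorem convIn_of_etaTest {σ : ℕ → Tm} {r : ℕ → Tm → Tm → Bool}
    (hr : ∀ {n s t}, r n s t = true → ConvIn σ n s t) {n : ℕ} {s t : Tm}
    (h : etaTest r n s t = true) : ConvIn σ n s t := by
  unfold etaTest at h
  split at h
  · split at h
    · exact .lam (hr h)
    · exact .lam_eta (hr h)
  · split at h
    · exact .symm (ConvIn.lam_eta (Conv.symm (hr h)))
    · exact convIn_of_congrTest hr h

/-- Comparison of the arguments of two applications of the same term. -/
def spineTest (r : Tm → Tm → Bool) : Tm → Tm → Bool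
  | app f a, t =>
    match t with
    | app f' a' => spineTest r f f' && r a a'
    | _ => false
  | s, t => beq s t

theorem convIn_of_spineTest {σ : ℕ → Tm} {n : ℕ} {r : Tm → Tm → Bool}
    (hr : ∀ {s t}, r s t = true → ConvIn σ n s t) (s : Tm) :
    ∀ {t}, spineTest r s t = true → ConvIn σ n s t := by
  induction s with
  | app f a ih =>
    intro t h
    unfold spineTest at h
    split at h
    · simp only [Bool.and_eq_true] at h
      exact .app (ih h.1) (hr h.2)
    · cases h
  | _ =>
    intro t h
    rw [eq_of_beq _ _ h]
    exact .rfl _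

/-- The variable that blocks the evaluation of a term. -/
def headVar : Tm → ℕ
  | var k => k
  | app f _ => headVar f
  | sigmaElim _ _ t => headVar t
  | J _ _ p => headVar p
  | unitElim _ _ t => headVar t
  | sumElim _ _ _ t => headVar t
  | gqElim _ _ _ t => headVar t
  | _ => 0

/-- Comparison of two terms in weak head normal form. -/
def convStep (S : Sig) (r : ℕ → Tm → Tm → Bool) (n : ℕ) (s t : Tm) : Bool :=
  match delta S n s with
  | none =>
    match delta S n t with
    | none => etaTest r n s t
    | some t' => r n s t'
  | some s' =>
    match delta S n t with
    | none => r n s' t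
    | some t' =>
      -- When both sides can be unfolded, applications of the same head are first compared argument
      -- by argument. Otherwise the side whose head has the larger number is unfolded: definitions
      -- refer only to earlier ones, so the heads may then come to agree.
      bif spineTest (r n) s t then true
      else bif Nat.blt (headVar s) (headVar t) then r n s t'
      else bif Nat.blt (headVar t) (headVar s) then r n s' t
      else r n s' t'

/-- A sufficient test for convertibility. -/
def convTest (S : Sig) : ℕ → ℕ → Tm → Tm → Bool
  | 0 => fun _ _ _ => false
  | m + 1 => fun n s t =>
    bif beq s t then true else convStep S (convTest S m) n (whnf 1000 s) (whnf 1000 t)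

/-- Normalization and unfolding stay within the conversion class, so a positive answer for the
reduced terms holds for the original ones. When the depth `m` runs out the answer is negative. -/
theorem convIn_of_convTest {S : Sig} {σ : ℕ → Tm} (hS : S.Realized σ) (m : ℕ) :
    ∀ {n s t}, convTest S m n s t = true → ConvIn σ n s t := by
  induction m with
  | zero => intro _ _ _ h; cases h
  | succ m ih =>
    intro n s t h
    unfold convTest at h
    cases hb : beq s t with
    | true =>
      rw [eq_of_beq _ _ hb]
      exact .rfl _
    | false =>
      rw [hb, cond_false] at h
      refine .trans ((conv_whnf 1000 s).convIn σ n)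
        (.trans ?_ ((conv_whnf 1000 t).convIn σ n).symm)
      generalize whnf 1000 s = s at h
      generalize whnf 1000 t = t at h
      change ConvIn σ n s t
      unfold convStep at h
      split at h
      · split at h
        · exact convIn_of_etaTest ih h
        · next ht => exact .trans (ih h) (convIn_delta hS n t ht).symm
      · next hs =>
        have hs := convIn_delta hS n s hs
        split at h
        · exact .trans hs (ih h)
        · next ht =>
          have ht := (convIn_delta hS n t ht).symm
          cases h1 : spineTest (convTest S m n) s t with
          | true => exact convIn_of_spineTest ih s h1
          | false =>
            cases h2 : Nat.blt (headVar s) (headVar t) with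
            | true =>
              rw [h1, h2] at h
              exact .trans (ih h) ht
            | false =>
              cases h3 : Nat.blt (headVar t) (headVar s) with
              | true =>
                rw [h1, h2, h3] at h
                exact .trans hs (ih h)
              | false =>
                rw [h1, h2, h3] at h
                exact .trans hs (.trans (ih h) ht)

end HoTT

/-! ### A sound bidirectional type checker, and sequences of definitions -/

namespace HoTT

open Tm Judgment

/-! ### Derivability in terms of definitions -/

/-- The context `Γ`, when the definitions are realized by `σ`. -/
def realize (σ : ℕ → Tm) : Ctx → Ctx
  | [] => []
  | A :: Γ => A.subst (ups σ Γ.length) :: realize σ Γ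

/-- Derivability over `Γ`, when the definitions are realized by `σ`. -/
def DerivesIn (σ : ℕ → Tm) (Γ : Ctx) (𝒥 : Judgment) : Prop :=
  Derives (realize σ Γ) (𝒥.subst (ups σ Γ.length))

namespace DerivesIn

variable {σ : ℕ → Tm} {Γ : Ctx}

theorem realize_lookup (σ : ℕ → Tm) (Γ : Ctx) {k : ℕ} {A : Tm} (h : Γ[k]? = some A) :
    k < Γ.length ∧ ∃ B, (realize σ Γ)[k]? = some B ∧
      (A.wk (k + 1)).subst (ups σ Γ.length) = B.wk (k + 1) := by
  induction Γ generalizing k with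
  | nil => simp at h
  | cons C Γ ih =>
    cases k with
    | zero =>
      obtain rfl : C = A := by simpa using h
      exact ⟨Nat.succ_pos _, _, rfl, wk_subst_up _ _⟩
    | succ k =>
      obtain ⟨h₁, B, h₂, h₃⟩ := ih (by simpa using h)
      refine ⟨Nat.succ_lt_succ h₁, B, h₂, ?_⟩
      rw [← wk_wk (k + 1) 1 A, ← wk_wk (k + 1) 1 B, ← h₃]
      exact wk_subst_up _ _

theorem var {k : ℕ} {A : Tm} (h : Γ[k]? = some A) : DerivesIn σ Γ (.var k ∶ A.wk (k + 1)) := by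
  obtain ⟨h₁, B, h₂, h₃⟩ := realize_lookup σ Γ h
  rw [DerivesIn, Judgment.subst, h₃, Tm.subst, ups_lt σ h₁]
  exact .var h₂

theorem wk_closed {t A : Tm} (h : Derives [] (t ∶ A)) (Γ : Ctx) :
    Derives Γ (t.wk Γ.length ∶ A.wk Γ.length) := by
  induction Γ with
  | nil => simpa only [List.length_nil, wk_zero] using h
  | cons B Γ ih =>
    have := ih.wk_hasType B
    rwa [wk_wk, wk_wk] at this

theorem length_realize (σ : ℕ → Tm) (Γ : Ctx) : (realize σ Γ).length = Γ.length := by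
  induction Γ with
  | nil => rfl
  | cons A Γ ih => rw [realize, List.length_cons, List.length_cons, ih]

/-- The realization of a definition is derivable over the empty context, hence by weakening over
every context. This is the typing rule for variables beyond the context. -/
theorem const {S : Sig} (hS : S.Realized σ) {k : ℕ} {e : Entry} (hk : Γ.length ≤ k)
    (h : S (k - Γ.length) = some e) : DerivesIn σ Γ (.var k ∶ e.type.wk Γ.length) := by
  have h₁ := wk_closed (hS _ _ h).1 (realize σ Γ)
  have h₂ := ups_add σ Γ.length (k - Γ.length)
  have h₃ := wk_subst_ups e.type σ 0 Γ.length
  rw [Nat.zero_add] at h₃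
  rw [length_realize] at h₁
  rw [Nat.sub_add_cancel hk] at h₂
  rw [DerivesIn, Judgment.subst, h₃, Tm.subst, h₂]
  exact h₁

/-- From here on, the rules that the checker uses are transferred from `Derives` to `DerivesIn`. The
work lies in commuting the realization with `inst`, `instWk` and the derived formers. -/
theorem conv {t A B : Tm} (h : DerivesIn σ Γ (t ∶ A)) (hB : DerivesIn σ Γ (isType B))
    (hAB : ConvIn σ Γ.length A B) : DerivesIn σ Γ (t ∶ B) := Derives.conv h hB hAB

theorem univ : DerivesIn σ Γ (isType .univ) := Derives.univ

theorem el {A : Tm} (h : DerivesIn σ Γ (A ∶ .univ)) : DerivesIn σ Γ (isType A) := Derives.el h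

theorem pi {A B : Tm} (hA : DerivesIn σ Γ (isType A)) (hB : DerivesIn σ (A :: Γ) (isType B)) :
    DerivesIn σ Γ (isType (.pi A B)) :=
  Derives.pi hA hB

theorem pi_univ {A B : Tm} (hA : DerivesIn σ Γ (A ∶ .univ))
    (hB : DerivesIn σ (A :: Γ) (B ∶ .univ)) :
    DerivesIn σ Γ (.pi A B ∶ .univ) :=
  Derives.pi_univ hA hB

theorem lam {A B t : Tm} (hA : DerivesIn σ Γ (isType A)) (ht : DerivesIn σ (A :: Γ) (t ∶ B)) :
    DerivesIn σ Γ (.lam t ∶ .pi A B) :=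
  Derives.lam hA ht

theorem app {A B f a : Tm} (hf : DerivesIn σ Γ (f ∶ .pi A B)) (ha : DerivesIn σ Γ (a ∶ A)) :
    DerivesIn σ Γ (.app f a ∶ B.inst a) := by
  simp only [DerivesIn, Judgment.subst, inst_subst]
  exact Derives.app hf ha

theorem sigma {A B : Tm} (hA : DerivesIn σ Γ (isType A)) (hB : DerivesIn σ (A :: Γ) (isType B)) :
    DerivesIn σ Γ (isType (.sigma A B)) :=
  Derives.sigma hA hB

theorem sigma_univ {A B : Tm} (hA : DerivesIn σ Γ (A ∶ .univ))
    (hB : DerivesIn σ (A :: Γ) (B ∶ .univ)) :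
    DerivesIn σ Γ (.sigma A B ∶ .univ) :=
  Derives.sigma_univ hA hB

theorem pair {A B a b : Tm} (hA : DerivesIn σ Γ (isType A)) (hB : DerivesIn σ (A :: Γ) (isType B))
    (ha : DerivesIn σ Γ (a ∶ A)) (hb : DerivesIn σ Γ (b ∶ B.inst a)) :
    DerivesIn σ Γ (.pair a b ∶ .sigma A B) := by
  simp only [DerivesIn, Judgment.subst, Tm.subst]
  simp only [DerivesIn, Judgment.subst, inst_subst] at hb
  exact Derives.pair hA hB ha hb

theorem sigmaElim {A B P m t : Tm} (h : DerivesIn σ Γ (isType (.sigma A B)))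
    (hP : DerivesIn σ (.sigma A B :: Γ) (isType P))
    (hm : DerivesIn σ Γ (m ∶ .pi A (.pi B (P.instWk 2 (.pair (.var 1) (.var 0))))))
    (ht : DerivesIn σ Γ (t ∶ .sigma A B)) :
    DerivesIn σ Γ (.sigmaElim P m t ∶ P.inst t) := by
  simp only [DerivesIn, Judgment.subst, inst_subst]
  simp only [DerivesIn, Judgment.subst, Tm.subst, instWk_subst₂] at hm
  exact Derives.sigmaElim h hP hm ht

theorem id {A a b : Tm} (hA : DerivesIn σ Γ (isType A)) (ha : DerivesIn σ Γ (a ∶ A))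
    (hb : DerivesIn σ Γ (b ∶ A)) :
    DerivesIn σ Γ (isType (.id A a b)) :=
  Derives.id hA ha hb

theorem id_univ {A a b : Tm} (hA : DerivesIn σ Γ (A ∶ .univ)) (ha : DerivesIn σ Γ (a ∶ A))
    (hb : DerivesIn σ Γ (b ∶ A)) :
    DerivesIn σ Γ (.id A a b ∶ .univ) :=
  Derives.id_univ hA ha hb

theorem refl {A a : Tm} (ha : DerivesIn σ Γ (a ∶ A)) :
    DerivesIn σ Γ (.refl a ∶ .id A a a) :=
  Derives.refl ha

theorem J {A a b C d p : Tm} (hA : DerivesIn σ Γ (isType A)) (ha : DerivesIn σ Γ (a ∶ A))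
    (hC : DerivesIn σ (.id (A.wk 1) (a.wk 1) (.var 0) :: A :: Γ) (isType C))
    (hd : DerivesIn σ Γ (d ∶ C.inst₂ a (.refl a))) (hb : DerivesIn σ Γ (b ∶ A))
    (hp : DerivesIn σ Γ (p ∶ .id A a b)) :
    DerivesIn σ Γ (.J C d p ∶ C.inst₂ b p) := by
  simp only [DerivesIn, Judgment.subst, inst₂_subst]
  simp only [DerivesIn, Judgment.subst, Tm.subst, realize, List.length_cons, ups, wk_subst_up] at hC
  simp only [DerivesIn, Judgment.subst, Tm.subst, inst₂_subst] at hd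
  exact Derives.J hA ha hC hd hb hp

theorem unit :
    DerivesIn σ Γ (.unit ∶ .univ) :=
  Derives.unit

theorem star :
    DerivesIn σ Γ (.star ∶ .unit) :=
  Derives.star

theorem unitElim {P c t : Tm} (hP : DerivesIn σ (.unit :: Γ) (isType P))
    (hc : DerivesIn σ Γ (c ∶ P.inst .star)) (ht : DerivesIn σ Γ (t ∶ .unit)) :
    DerivesIn σ Γ (.unitElim P c t ∶ P.inst t) := by
  simp only [DerivesIn, Judgment.subst, inst_subst]
  simp only [DerivesIn, Judgment.subst, Tm.subst, inst_subst] at hc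
  exact Derives.unitElim hP hc ht

theorem sum {A B : Tm} (hA : DerivesIn σ Γ (isType A)) (hB : DerivesIn σ Γ (isType B)) :
    DerivesIn σ Γ (isType (.sum A B)) :=
  Derives.sum hA hB

theorem sum_univ {A B : Tm} (hA : DerivesIn σ Γ (A ∶ .univ)) (hB : DerivesIn σ Γ (B ∶ .univ)) :
    DerivesIn σ Γ (.sum A B ∶ .univ) :=
  Derives.sum_univ hA hB

theorem inl {A B a : Tm} (hB : DerivesIn σ Γ (isType B)) (ha : DerivesIn σ Γ (a ∶ A)) :
    DerivesIn σ Γ (.inl a ∶ .sum A B) :=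
  Derives.inl hB ha

theorem inr {A B b : Tm} (hA : DerivesIn σ Γ (isType A)) (hb : DerivesIn σ Γ (b ∶ B)) :
    DerivesIn σ Γ (.inr b ∶ .sum A B) :=
  Derives.inr hA hb

theorem sumElim {A B P l r t : Tm} (h : DerivesIn σ Γ (isType (.sum A B)))
    (hP : DerivesIn σ (.sum A B :: Γ) (isType P))
    (hl : DerivesIn σ Γ (l ∶ .pi A (P.instWk 1 (.inl (.var 0)))))
    (hr : DerivesIn σ Γ (r ∶ .pi B (P.instWk 1 (.inr (.var 0)))))
    (ht : DerivesIn σ Γ (t ∶ .sum A B)) :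
    DerivesIn σ Γ (.sumElim P l r t ∶ P.inst t) := by
  simp only [DerivesIn, Judgment.subst, inst_subst]
  simp only [DerivesIn, Judgment.subst, Tm.subst, instWk_subst₁] at hl
  simp only [DerivesIn, Judgment.subst, Tm.subst, instWk_subst₁] at hr
  exact Derives.sumElim h hP hl hr ht

theorem gq {V E : Tm} (hV : DerivesIn σ Γ (V ∶ .univ))
    (hE : DerivesIn σ Γ (E ∶ Tm.arr V (Tm.arr V .univ))) :
    DerivesIn σ Γ (.gq V E ∶ .univ) := by
  simp only [DerivesIn, Judgment.subst]
  simp only [DerivesIn, Judgment.subst, Tm.subst, arr_subst] at hE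
  exact Derives.gq hV hE

theorem vert {V E i : Tm} (h : DerivesIn σ Γ (.gq V E ∶ .univ)) (hi : DerivesIn σ Γ (i ∶ V)) :
    DerivesIn σ Γ (.vert i ∶ .gq V E) :=
  Derives.vert h hi

theorem edge {V E i j e : Tm} (h : DerivesIn σ Γ (.gq V E ∶ .univ)) (hi : DerivesIn σ Γ (i ∶ V))
    (hj : DerivesIn σ Γ (j ∶ V)) (he : DerivesIn σ Γ (e ∶ .app (.app E i) j)) :
    DerivesIn σ Γ (.edge V E i j e ∶ .id (.gq V E) (.vert i) (.vert j)) :=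
  Derives.edge h hi hj he

theorem gqElim {V E P v d t : Tm} (h : DerivesIn σ Γ (.gq V E ∶ .univ))
    (hP : DerivesIn σ (.gq V E :: Γ) (isType P))
    (hv : DerivesIn σ Γ (v ∶ .pi V (P.instWk 1 (.vert (.var 0)))))
    (hd : DerivesIn σ Γ (d ∶ edgeMethod V E P v)) (ht : DerivesIn σ Γ (t ∶ .gq V E)) :
    DerivesIn σ Γ (.gqElim P v d t ∶ P.inst t) := by
  simp only [DerivesIn, Judgment.subst, inst_subst]
  simp only [DerivesIn, Judgment.subst, Tm.subst, instWk_subst₁] at hv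
  simp only [DerivesIn, Judgment.subst, edgeMethod_subst] at hd
  exact Derives.gqElim h hP hv hd ht

theorem gqComp {V E P v d i j e : Tm} (h : DerivesIn σ Γ (.gq V E ∶ .univ))
    (hP : DerivesIn σ (.gq V E :: Γ) (isType P))
    (hv : DerivesIn σ Γ (v ∶ .pi V (P.instWk 1 (.vert (.var 0)))))
    (hd : DerivesIn σ Γ (d ∶ edgeMethod V E P v)) (hi : DerivesIn σ Γ (i ∶ V))
    (hj : DerivesIn σ Γ (j ∶ V)) (he : DerivesIn σ Γ (e ∶ .app (.app E i) j)) :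
    DerivesIn σ Γ (.gqComp V E P v d i j e ∶
      .id (.id (P.inst (.vert j)) (Tm.transport P (.edge V E i j e) (.app v i)) (.app v j))
        (Tm.apd P (.lam (.gqElim (P.wkUp 1) (v.wk 1) (d.wk 1) (.var 0))) (.vert i)
          (.edge V E i j e))
        (.app (.app (.app d i) j) e)) := by
  simp only [DerivesIn, Judgment.subst, Tm.subst, inst_subst, transport_subst, apd_subst,
    wk_subst_up, wkUp_subst_up₁]
  simp only [DerivesIn, Judgment.subst, Tm.subst, instWk_subst₁] at hv
  simp only [DerivesIn, Judgment.subst, edgeMethod_subst] at hd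
  exact Derives.gqComp h hP hv hd hi hj he

theorem funext {A B f g : Tm} (hA : DerivesIn σ Γ (isType A)) (hB : DerivesIn σ (A :: Γ) (isType B))
    (hf : DerivesIn σ Γ (f ∶ .pi A B)) (hg : DerivesIn σ Γ (g ∶ .pi A B)) :
    DerivesIn σ Γ (.funext A B f g ∶ Tm.isEquiv (.id (.pi A B) f g)
      (.pi A (.id B (.app (f.wk 1) (.var 0)) (.app (g.wk 1) (.var 0)))) (Tm.happly A B f)) := by
  simp only [DerivesIn, Judgment.subst, isEquiv_subst, happly_subst, Tm.subst, wk_subst_up]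
  exact Derives.funext hA hB hf hg

theorem ua {A B : Tm} (hA : DerivesIn σ Γ (A ∶ .univ)) (hB : DerivesIn σ Γ (B ∶ .univ)) :
    DerivesIn σ Γ (.ua A B ∶ Tm.isEquiv (.id .univ A B) (Tm.equiv A B) (Tm.idToEquiv A)) := by
  simp only [DerivesIn, Judgment.subst, isEquiv_subst, idToEquiv_subst, equiv_subst, Tm.subst]
  exact Derives.ua hA hB

end DerivesIn

/-! ### The types of the methods of eliminators -/

namespace Derives

/-- Checking a term against `T` is sound only if `T` is known to be a type, so the expected type of
each method of an eliminator has to be justified beforehand. -/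
theorem isType_pairMethod {Γ : Ctx} {A B P : Tm} (hP : Derives (.sigma A B :: Γ) (isType P))
    (h : Derives Γ (isType (.sigma A B))) :
    Derives Γ (isType (.pi A (.pi B (P.instWk 2 (.pair (.var 1) (.var 0)))))) := by
  obtain ⟨hA, hB⟩ := h.components
  refine .pi hA (.pi hB ((hP.wkUp₂_isType A B).inst_isType ?_))
  refine .pair (A := A.wk 2) (B := B.wkUp 2) (hA.wk₂_isType A B) (hB.wkUp₂_isType A B)
    (.var (A := A) rfl) ?_
  rw [wkUp_inst_var 1]
  exact .var rfl

theorem isType_inlMethod {Γ : Ctx} {A B P : Tm} (hP : Derives (.sum A B :: Γ) (isType P))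
    (h : Derives Γ (isType (.sum A B))) :
    Derives Γ (isType (.pi A (P.instWk 1 (.inl (.var 0))))) :=
  .pi h.components.1 ((hP.wkUp_isType A).inst_isType
    (.inl (h.components.2.wk_isType A) (.var (A := A) rfl)))

theorem isType_inrMethod {Γ : Ctx} {A B P : Tm} (hP : Derives (.sum A B :: Γ) (isType P))
    (h : Derives Γ (isType (.sum A B))) :
    Derives Γ (isType (.pi B (P.instWk 1 (.inr (.var 0))))) :=
  .pi h.components.2 ((hP.wkUp_isType B).inst_isType
    (.inr (h.components.1.wk_isType B) (.var (A := B) rfl)))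

end Derives

namespace DerivesIn

variable {σ : ℕ → Tm} {Γ : Ctx}

/-- The judgments about the components of a type former that follow from those about the type. -/
def Components (σ : ℕ → Tm) (Γ : Ctx) : Tm → Prop
  | .pi A B => DerivesIn σ Γ (isType A) ∧ DerivesIn σ (A :: Γ) (isType B)
  | .sigma A B => DerivesIn σ Γ (isType A) ∧ DerivesIn σ (A :: Γ) (isType B)
  | .id A a b => DerivesIn σ Γ (isType A) ∧ DerivesIn σ Γ (a ∶ A) ∧ DerivesIn σ Γ (b ∶ A)
  | .sum A B => DerivesIn σ Γ (isType A) ∧ DerivesIn σ Γ (isType B)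
  | .gq V _ => DerivesIn σ Γ (V ∶ Tm.univ)
  | _ => True

theorem components {A : Tm} (h : DerivesIn σ Γ (isType A)) : Components σ Γ A := by
  cases A with
  | pi => exact Derives.components h
  | sigma => exact Derives.components h
  | id => exact Derives.components h
  | sum => exact Derives.components h
  | gq => exact (Derives.components h).1
  | _ => trivial

theorem gq_univ {V E : Tm} (h : DerivesIn σ Γ (isType (.gq V E))) :
    DerivesIn σ Γ (.gq V E ∶ Tm.univ) :=
  Derives.gq_univ h

theorem inst_isType {a A B : Tm} (h : DerivesIn σ (A :: Γ) (isType B))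
    (ha : DerivesIn σ Γ (a ∶ A)) :
    DerivesIn σ Γ (isType (B.inst a)) := by
  simp only [DerivesIn, Judgment.subst, inst_subst]
  exact Derives.inst_isType h ha

theorem isType_reflMethod {A a C : Tm} (ha : DerivesIn σ Γ (a ∶ A))
    (hC : DerivesIn σ (.id (A.wk 1) (a.wk 1) (.var 0) :: A :: Γ) (isType C)) :
    DerivesIn σ Γ (isType (C.inst₂ a (.refl a))) := by
  simp only [DerivesIn, Judgment.subst, Tm.subst, realize, List.length_cons, ups, wk_subst_up] at hC
  simp only [DerivesIn, Judgment.subst, inst₂_subst]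
  refine Derives.inst₂_isType hC ha ((Derives.refl ha).conv' ?_)
  rw [inst_eq, Tm.subst, wk_subst_instSubst, wk_subst_instSubst]
  rfl

theorem pathContext {A a : Tm} (hA : DerivesIn σ Γ (isType A)) (ha : DerivesIn σ Γ (a ∶ A)) :
    DerivesIn σ (A :: Γ) (isType (.id (A.wk 1) (a.wk 1) (.var 0))) := by
  simp only [DerivesIn, Judgment.subst, Tm.subst, List.length_cons, ups, wk_subst_up]
  exact Derives.pathContext hA ha

theorem isType_pairMethod {A B P : Tm} (hP : DerivesIn σ (.sigma A B :: Γ) (isType P))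
    (h : DerivesIn σ Γ (isType (.sigma A B))) :
    DerivesIn σ Γ (isType (.pi A (.pi B (P.instWk 2 (.pair (.var 1) (.var 0)))))) := by
  simp only [DerivesIn, Judgment.subst, Tm.subst, instWk_subst₂]
  exact Derives.isType_pairMethod hP h

theorem isType_inlMethod {A B P : Tm} (hP : DerivesIn σ (.sum A B :: Γ) (isType P))
    (h : DerivesIn σ Γ (isType (.sum A B))) :
    DerivesIn σ Γ (isType (.pi A (P.instWk 1 (.inl (.var 0))))) := by
  simp only [DerivesIn, Judgment.subst, Tm.subst, instWk_subst₁]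
  exact Derives.isType_inlMethod hP h

theorem isType_inrMethod {A B P : Tm} (hP : DerivesIn σ (.sum A B :: Γ) (isType P))
    (h : DerivesIn σ Γ (isType (.sum A B))) :
    DerivesIn σ Γ (isType (.pi B (P.instWk 1 (.inr (.var 0))))) := by
  simp only [DerivesIn, Judgment.subst, Tm.subst, instWk_subst₁]
  exact Derives.isType_inrMethod hP h

theorem isType_vertMethod {V E P : Tm} (hq : DerivesIn σ Γ (.gq V E ∶ Tm.univ))
    (hP : DerivesIn σ (.gq V E :: Γ) (isType P)) :
    DerivesIn σ Γ (isType (.pi V (P.instWk 1 (.vert (.var 0))))) := by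
  simp only [DerivesIn, Judgment.subst, Tm.subst, instWk_subst₁]
  exact Derives.isType_vertMethod hq hP

theorem isType_edge {V E i j : Tm} (hq : DerivesIn σ Γ (.gq V E ∶ Tm.univ))
    (hi : DerivesIn σ Γ (i ∶ V)) (hj : DerivesIn σ Γ (j ∶ V)) :
    DerivesIn σ Γ (.app (.app E i) j ∶ Tm.univ) :=
  Derives.isType_edge hq hi hj

theorem isType_edgeMethod {V E P v : Tm} (hq : DerivesIn σ Γ (.gq V E ∶ Tm.univ))
    (hP : DerivesIn σ (.gq V E :: Γ) (isType P))
    (hv : DerivesIn σ Γ (v ∶ .pi V (P.instWk 1 (.vert (.var 0))))) :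
    DerivesIn σ Γ (isType (edgeMethod V E P v)) := by
  simp only [DerivesIn, Judgment.subst, Tm.subst, instWk_subst₁] at hv
  simp only [DerivesIn, Judgment.subst, edgeMethod_subst]
  exact Derives.isType_edgeMethod hq hP hv

theorem arr_univ {V : Tm} (hV : DerivesIn σ Γ (V ∶ .univ)) :
    DerivesIn σ Γ (isType (arr V (arr V .univ))) := by
  simp only [DerivesIn, Judgment.subst, arr_subst]
  exact Derives.arr (Derives.el hV) (Derives.arr (Derives.el hV) .univ)

/-- Each type of the context is a type over the remaining part of the context. -/
def Context (σ : ℕ → Tm) (Γ : Ctx) : Prop := WellFormed (realize σ Γ)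

theorem Context.cons {A : Tm} (hΓ : Context σ Γ) (hA : DerivesIn σ Γ (isType A)) :
    Context σ (A :: Γ) :=
  WellFormed.cons hΓ hA

theorem presupposition {t A : Tm} (h : DerivesIn σ Γ (t ∶ A)) (hΓ : Context σ Γ) :
    DerivesIn σ Γ (isType A) :=
  Derives.presupposition h hΓ

end DerivesIn

open DerivesIn (Context)

/-! ### A type checker -/

/-- The three functions of a bidirectional type checker. -/
structure Checker where
  infer : Ctx → Tm → Option Tm
  check : Ctx → Tm → Tm → Bool
  isType : Ctx → Tm → Bool

namespace Checker

/-- Only derivable judgments are accepted. -/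
structure Sound (σ : ℕ → Tm) (c : Checker) : Prop where
  infer {Γ : Ctx} {t A : Tm} : Context σ Γ → c.infer Γ t = some A → DerivesIn σ Γ (t ∶ A)
  check {Γ : Ctx} {t A : Tm} : Context σ Γ → DerivesIn σ Γ (.isType A) → c.check Γ t A = true →
    DerivesIn σ Γ (t ∶ A)
  isType {Γ : Ctx} {A : Tm} : Context σ Γ → c.isType Γ A = true → DerivesIn σ Γ (.isType A)

/-- Whether the term is a type former other than a universe-valued elimination. -/
def isFormer : Tm → Bool
  | .pi _ _ => true
  | .sigma _ _ => true
  | .id _ _ _ => true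
  | .sum _ _ => true
  | .gq _ _ => true
  | _ => false

/-- Weak head normalization until a type former is visible. -/
def exposeFormer (S : Sig) (n : ℕ) : ℕ → Tm → Tm
  | 0 => fun A => A
  | m + 1 => fun A =>
    bif isFormer (whnf 1000 A) then whnf 1000 A
    else match delta S n (whnf 1000 A) with
      | some B => exposeFormer S n m B
      | none => whnf 1000 A

theorem convIn_exposeFormer {S : Sig} {σ : ℕ → Tm} (hS : S.Realized σ) (n m : ℕ) :
    ∀ A, ConvIn σ n A (exposeFormer S n m A) := by
  induction m with
  | zero => exact fun A => .rfl _
  | succ m ih =>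
    intro A
    refine .trans ((conv_whnf 1000 A).convIn σ n) ?_
    change ConvIn σ n _ _
    unfold exposeFormer
    cases isFormer (whnf 1000 A) with
    | true => exact .rfl _
    | false =>
      rw [cond_false]
      split
      · next h => exact .trans (convIn_delta hS n _ h) (ih _)
      · exact .rfl _

/-- A type convertible to `A` whose outermost type former is visible, if it can be found. -/
def expose (c : Checker) (S : Sig) (Γ : Ctx) (A : Tm) : Tm :=
  bif isFormer A then A
  else bif c.isType Γ (exposeFormer S Γ.length 1000 A) then exposeFormer S Γ.length 1000 A else A

/-- Subject reduction is avoided: a reduced type is used only after the checker has verified anew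
that it is a type, and otherwise the original type is kept. -/
theorem Sound.expose {σ : ℕ → Tm} {c : Checker} (hc : c.Sound σ) {S : Sig} (hS : S.Realized σ)
    {Γ : Ctx} {A : Tm} (hΓ : Context σ Γ) (hA : DerivesIn σ Γ (.isType A)) :
    DerivesIn σ Γ (.isType (c.expose S Γ A)) ∧ ConvIn σ Γ.length A (c.expose S Γ A) := by
  unfold Checker.expose
  cases isFormer A with
  | true => exact ⟨hA, .rfl _⟩
  | false =>
    cases h : c.isType Γ (exposeFormer S Γ.length 1000 A) with
    | true => exact ⟨hc.isType hΓ h, convIn_exposeFormer hS _ _ A⟩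
    | false => exact ⟨hA, .rfl _⟩

/-- `x`, provided that `b` holds. -/
def guarded {α : Type} (b : Bool) (x : α) : Option α := bif b then some x else none

theorem guarded_eq_some {α : Type} {b : Bool} {x y : α} (h : guarded b x = some y) :
    b = true ∧ x = y := by
  cases b with
  | true => exact ⟨rfl, Option.some.inj h⟩
  | false => cases h

variable (S : Sig) (hint : ℕ → Tm → Option Tm) (c : Checker)

/-- Type inference for a term; the types of constructors are looked up in `hint`. -/
def inferStep (Γ : Ctx) (t : Tm) : Option Tm :=
  match t with
  | .var n =>
    match Γ[n]? with
    | some A => some (A.wk (n + 1))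
    | none =>
      bif Nat.ble Γ.length n then
        match S (n - Γ.length) with
        | some e => some (e.type.wk Γ.length)
        | none => none
      else none
  | .pi A B => guarded (c.check Γ A .univ && c.check (A :: Γ) B .univ) .univ
  | .app f a =>
    match c.infer Γ f with
    | some T =>
      match c.expose S Γ T with
      | .pi A B => guarded (c.check Γ a A) (B.inst a)
      | _ => none
    | none =>
      -- No type is inferred for the function here; in a beta redex the domain can be read off the
      -- argument, after which the body can be inferred.
      match f with
      | .lam b =>
        match c.infer Γ a with
        | some A =>
          match c.infer (A :: Γ) b with
          | some B => some (B.inst a)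
          | none => none
        | none => none
      | _ => none
  | .sigma A B => guarded (c.check Γ A .univ && c.check (A :: Γ) B .univ) .univ
  | .sigmaElim P m t =>
    match c.infer Γ t with
    | some T =>
      match c.expose S Γ T with
      | .sigma A B =>
        guarded (c.isType (.sigma A B :: Γ) P &&
          c.check Γ m (.pi A (.pi B (P.instWk 2 (.pair (.var 1) (.var 0)))))) (P.inst t)
      | _ => none
    | none => none
  | .id A a b => guarded (c.check Γ A .univ && c.check Γ a A && c.check Γ b A) .univ
  | .refl a =>
    match c.infer Γ a with
    | some A => some (.id A a a)
    | none => none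
  | .J C d p =>
    match c.infer Γ p with
    | some T =>
      match c.expose S Γ T with
      | .id A a b =>
        guarded (c.isType (.id (A.wk 1) (a.wk 1) (.var 0) :: A :: Γ) C &&
          c.check Γ d (C.inst₂ a (.refl a))) (C.inst₂ b p)
      | _ => none
    | none => none
  | .unit => some .univ
  | .star => some .unit
  | .unitElim P d t =>
    guarded (c.isType (.unit :: Γ) P && c.check Γ d (P.inst .star) && c.check Γ t .unit)
      (P.inst t)
  | .sum A B => guarded (c.check Γ A .univ && c.check Γ B .univ) .univ
  | .sumElim P f g t =>
    match c.infer Γ t with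
    | some T =>
      match c.expose S Γ T with
      | .sum A B =>
        guarded (c.isType (.sum A B :: Γ) P &&
          c.check Γ f (.pi A (P.instWk 1 (.inl (.var 0)))) &&
          c.check Γ g (.pi B (P.instWk 1 (.inr (.var 0))))) (P.inst t)
      | _ => none
    | none => none
  | .gq V E => guarded (c.check Γ V .univ && c.check Γ E (arr V (arr V .univ))) .univ
  | .edge V E i j e =>
    guarded (c.check Γ (.gq V E) .univ && c.check Γ i V && c.check Γ j V &&
      c.check Γ e (.app (.app E i) j)) (.id (.gq V E) (.vert i) (.vert j))
  | .gqElim P v d t =>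
    match c.infer Γ t with
    | some T =>
      match c.expose S Γ T with
      | .gq V E =>
        guarded (c.isType (.gq V E :: Γ) P &&
          c.check Γ v (.pi V (P.instWk 1 (.vert (.var 0)))) &&
          c.check Γ d (edgeMethod V E P v)) (P.inst t)
      | _ => none
    | none => none
  | .gqComp V E P v d i j e =>
    guarded (c.check Γ (.gq V E) .univ && c.isType (.gq V E :: Γ) P &&
      c.check Γ v (.pi V (P.instWk 1 (.vert (.var 0)))) &&
      c.check Γ d (edgeMethod V E P v) && c.check Γ i V && c.check Γ j V &&
      c.check Γ e (.app (.app E i) j))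
      (.id (.id (P.inst (.vert j)) (transport P (.edge V E i j e) (.app v i)) (.app v j))
        (apd P (.lam (.gqElim (P.wkUp 1) (v.wk 1) (d.wk 1) (.var 0))) (.vert i) (.edge V E i j e))
        (.app (.app (.app d i) j) e))
  | .funext A B f g =>
    guarded (c.isType Γ A && c.isType (A :: Γ) B && c.check Γ f (.pi A B) &&
      c.check Γ g (.pi A B))
      (isEquiv (.id (.pi A B) f g) (.pi A (.id B (.app (f.wk 1) (.var 0)) (.app (g.wk 1) (.var 0))))
        (happly A B f))
  | .ua A B =>
    guarded (c.check Γ A .univ && c.check Γ B .univ)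
      (isEquiv (.id .univ A B) (equiv A B) (idToEquiv A))
  | t =>
    -- Hints need not be trusted: the proposed type is tested for being a type, and the term is
    -- checked against it.
    match hint Γ.length t with
    | some A => guarded (c.isType Γ A && c.check Γ t A) A
    | none => none

/-- Type checking of a term against a given type. -/
def checkStep (Γ : Ctx) (t T : Tm) : Bool :=
  match t with
  | .lam b =>
    match c.expose S Γ T with
    | .pi A B => c.check (A :: Γ) b B
    | _ => false
  | .pair a b =>
    match c.expose S Γ T with
    | .sigma A B => c.check Γ a A && c.check Γ b (B.inst a)
    | _ => false
  | .refl a =>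
    match c.expose S Γ T with
    | .id A x y => c.check Γ a A && convTest S 1000 Γ.length a x && convTest S 1000 Γ.length a y
    | _ => false
  | .inl a =>
    match c.expose S Γ T with
    | .sum A _ => c.check Γ a A
    | _ => false
  | .inr b =>
    match c.expose S Γ T with
    | .sum _ B => c.check Γ b B
    | _ => false
  | .vert i =>
    match c.expose S Γ T with
    | .gq V _ => c.check Γ i V
    | _ => false
  | t =>
    match c.infer Γ t with
    | some A => convTest S 1000 Γ.length A T
    | none => false

/-- The test whether a term is a type. -/
def isTypeStep (Γ : Ctx) (T : Tm) : Bool :=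
  match T with
  | .univ => true
  | .pi A B => c.isType Γ A && c.isType (A :: Γ) B
  | .sigma A B => c.isType Γ A && c.isType (A :: Γ) B
  | .id A a b => c.isType Γ A && c.check Γ a A && c.check Γ b A
  | .sum A B => c.isType Γ A && c.isType Γ B
  | T => c.check Γ T .univ

/-- One level of type checking. -/
def step : Checker where
  infer := inferStep S hint c
  check := checkStep S c
  isType := isTypeStep c

/-- The type checker with recursion depth at most `m`. -/
def run : ℕ → Checker
  | 0 => ⟨fun _ _ => none, fun _ _ _ => false, fun _ _ => false⟩
  | m + 1 => step S hint (run m)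

variable {S hint c} {σ : ℕ → Tm}

/-- The common first step for applications and for eliminators with an inferred scrutinee:
presupposition makes the inferred type a type, so the term may be retyped with a visible type
former. -/
theorem Sound.app {Γ : Ctx} {f A : Tm} (hc : c.Sound σ) (hS : S.Realized σ) (hΓ : Context σ Γ)
    (h : c.infer Γ f = some A) :
    DerivesIn σ Γ (.isType (c.expose S Γ A)) ∧ DerivesIn σ Γ (f ∶ c.expose S Γ A) := by
  have hf := hc.infer hΓ h
  obtain ⟨h₁, h₂⟩ := hc.expose hS hΓ (hf.presupposition hΓ)
  exact ⟨h₁, .conv hf h₁ h₂⟩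

/-- Each branch is one typing rule. The tests are used in an order in which every context extension
and every expected type has already been justified. -/
theorem Sound.inferStep (hc : c.Sound σ) (hS : S.Realized σ) {Γ : Ctx} {t A : Tm} (hΓ : Context σ Γ)
    (h : inferStep S hint c Γ t = some A) : DerivesIn σ Γ (t ∶ A) := by
  unfold Checker.inferStep at h
  split at h
  · split at h
    · next h' =>
      obtain rfl := Option.some.inj h
      exact .var h'
    · cases hk : Nat.ble Γ.length _ with
      | false => rw [hk] at h; cases h
      | true =>
        rw [hk, cond_true] at h
        split at h
        · next he =>
          obtain rfl := Option.some.inj h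
          exact .const hS (Nat.le_of_ble_eq_true hk) he
        · cases h
  · obtain ⟨h', rfl⟩ := guarded_eq_some h
    simp only [Bool.and_eq_true] at h'
    have hA := hc.check hΓ .univ h'.1
    exact .pi_univ hA (hc.check (hΓ.cons hA.el) .univ h'.2)
  · split at h
    · next hi =>
      obtain ⟨hT, hf⟩ := hc.app hS hΓ hi
      split at h
      · next he =>
        rw [he] at hT hf
        obtain ⟨h', rfl⟩ := guarded_eq_some h
        exact .app hf (hc.check hΓ hT.components.1 h')
      · cases h
    · split at h
      · split at h
        · next ha =>
          split at h
          · next hb =>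
            obtain rfl := Option.some.inj h
            have ha := hc.infer hΓ ha
            have hA := ha.presupposition hΓ
            exact .app (.lam hA (hc.infer (hΓ.cons hA) hb)) ha
          · cases h
        · cases h
      · cases h
  · obtain ⟨h', rfl⟩ := guarded_eq_some h
    simp only [Bool.and_eq_true] at h'
    have hA := hc.check hΓ .univ h'.1
    exact .sigma_univ hA (hc.check (hΓ.cons hA.el) .univ h'.2)
  · split at h
    · next hi =>
      obtain ⟨hT, hf⟩ := hc.app hS hΓ hi
      split at h
      · next A B he =>
        rw [he] at hT hf
        obtain ⟨h', rfl⟩ := guarded_eq_some h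
        simp only [Bool.and_eq_true] at h'
        have hP := hc.isType (hΓ.cons hT) h'.1
        exact .sigmaElim hT hP (hc.check hΓ (hP.isType_pairMethod hT) h'.2) hf
      · cases h
    · cases h
  · obtain ⟨h', rfl⟩ := guarded_eq_some h
    simp only [Bool.and_eq_true] at h'
    have hA := hc.check hΓ .univ h'.1.1
    exact .id_univ hA (hc.check hΓ hA.el h'.1.2) (hc.check hΓ hA.el h'.2)
  · split at h
    · next hi =>
      obtain rfl := Option.some.inj h
      exact .refl (hc.infer hΓ hi)
    · cases h
  · split at h
    · next hi =>
      obtain ⟨hT, hf⟩ := hc.app hS hΓ hi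
      split at h
      · next A a b he =>
        rw [he] at hT hf
        obtain ⟨h', rfl⟩ := guarded_eq_some h
        simp only [Bool.and_eq_true] at h'
        obtain ⟨hA, ha, hb⟩ := hT.components
        have hC := hc.isType ((hΓ.cons hA).cons (hA.pathContext ha)) h'.1
        exact .J hA ha hC (hc.check hΓ (.isType_reflMethod ha hC) h'.2) hb hf
      · cases h
    · cases h
  · obtain rfl := Option.some.inj h
    exact .unit
  · obtain rfl := Option.some.inj h
    exact .star
  · obtain ⟨h', rfl⟩ := guarded_eq_some h
    simp only [Bool.and_eq_true] at h'
    have hP := hc.isType (hΓ.cons (.el .unit)) h'.1.1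
    exact .unitElim hP (hc.check hΓ (hP.inst_isType .star) h'.1.2) (hc.check hΓ (.el .unit) h'.2)
  · obtain ⟨h', rfl⟩ := guarded_eq_some h
    simp only [Bool.and_eq_true] at h'
    exact .sum_univ (hc.check hΓ .univ h'.1) (hc.check hΓ .univ h'.2)
  · split at h
    · next hi =>
      obtain ⟨hT, hf⟩ := hc.app hS hΓ hi
      split at h
      · next A B he =>
        rw [he] at hT hf
        obtain ⟨h', rfl⟩ := guarded_eq_some h
        simp only [Bool.and_eq_true] at h'
        have hP := hc.isType (hΓ.cons hT) h'.1.1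
        exact .sumElim hT hP (hc.check hΓ (hP.isType_inlMethod hT) h'.1.2)
          (hc.check hΓ (hP.isType_inrMethod hT) h'.2) hf
      · cases h
    · cases h
  · obtain ⟨h', rfl⟩ := guarded_eq_some h
    simp only [Bool.and_eq_true] at h'
    have hV := hc.check hΓ .univ h'.1
    exact .gq hV (hc.check hΓ (.arr_univ hV) h'.2)
  · obtain ⟨h', rfl⟩ := guarded_eq_some h
    simp only [Bool.and_eq_true] at h'
    have hq := hc.check hΓ .univ h'.1.1.1
    have hV := hq.el.components.el
    have hi := hc.check hΓ hV h'.1.1.2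
    have hj := hc.check hΓ hV h'.1.2
    exact .edge hq hi hj (hc.check hΓ (hq.isType_edge hi hj).el h'.2)
  · split at h
    · next hi =>
      obtain ⟨hT, hf⟩ := hc.app hS hΓ hi
      split at h
      · next A B he =>
        rw [he] at hT hf
        obtain ⟨h', rfl⟩ := guarded_eq_some h
        simp only [Bool.and_eq_true] at h'
        have hq := hT.gq_univ
        have hP := hc.isType (hΓ.cons hT) h'.1.1
        have hv := hc.check hΓ (hq.isType_vertMethod hP) h'.1.2
        exact .gqElim hq hP hv (hc.check hΓ (hq.isType_edgeMethod hP hv) h'.2) hf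
      · cases h
    · cases h
  · obtain ⟨h', rfl⟩ := guarded_eq_some h
    simp only [Bool.and_eq_true] at h'
    obtain ⟨⟨⟨⟨⟨⟨hq, hP⟩, hv⟩, hd⟩, hi⟩, hj⟩, he⟩ := h'
    replace hq := hc.check hΓ .univ hq
    have hV := hq.el.components.el
    replace hP := hc.isType (hΓ.cons hq.el) hP
    replace hv := hc.check hΓ (hq.isType_vertMethod hP) hv
    replace hi := hc.check hΓ hV hi
    replace hj := hc.check hΓ hV hj
    exact .gqComp hq hP hv (hc.check hΓ (hq.isType_edgeMethod hP hv) hd) hi hj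
      (hc.check hΓ (hq.isType_edge hi hj).el he)
  · obtain ⟨h', rfl⟩ := guarded_eq_some h
    simp only [Bool.and_eq_true] at h'
    obtain ⟨⟨⟨hA, hB⟩, hf⟩, hg⟩ := h'
    replace hA := hc.isType hΓ hA
    replace hB := hc.isType (hΓ.cons hA) hB
    exact .funext hA hB (hc.check hΓ (.pi hA hB) hf) (hc.check hΓ (.pi hA hB) hg)
  · obtain ⟨h', rfl⟩ := guarded_eq_some h
    simp only [Bool.and_eq_true] at h'
    exact .ua (hc.check hΓ .univ h'.1) (hc.check hΓ .univ h'.2)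
  · split at h
    · obtain ⟨h', rfl⟩ := guarded_eq_some h
      simp only [Bool.and_eq_true] at h'
      exact hc.check hΓ (hc.isType hΓ h'.1) h'.2
    · cases h

theorem Sound.checkStep (hc : c.Sound σ) (hS : S.Realized σ) {Γ : Ctx} {t T : Tm} (hΓ : Context σ Γ)
    (hT : DerivesIn σ Γ (.isType T)) (h : checkStep S c Γ t T = true) : DerivesIn σ Γ (t ∶ T) := by
  obtain ⟨hE, hTE⟩ := hc.expose hS hΓ hT
  unfold Checker.checkStep at h
  split at h
  · split at h
    · next he =>
      rw [he] at hE hTE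
      obtain ⟨hA, hB⟩ := hE.components
      exact .conv (.lam hA (hc.check (hΓ.cons hA) hB h)) hT hTE.symm
    · cases h
  · split at h
    · next he =>
      rw [he] at hE hTE
      obtain ⟨hA, hB⟩ := hE.components
      simp only [Bool.and_eq_true] at h
      have ha := hc.check hΓ hA h.1
      exact .conv (.pair hA hB ha (hc.check hΓ (hB.inst_isType ha) h.2)) hT hTE.symm
    · cases h
  · split at h
    · next he =>
      rw [he] at hE hTE
      obtain ⟨hA, _, _⟩ := hE.components
      simp only [Bool.and_eq_true] at h
      refine .conv (.refl (hc.check hΓ hA h.1.1)) hT (.trans ?_ hTE.symm)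
      exact .id (.rfl _) (convIn_of_convTest hS 1000 h.1.2) (convIn_of_convTest hS 1000 h.2)
    · cases h
  · split at h
    · next he =>
      rw [he] at hE hTE
      obtain ⟨hA, hB⟩ := hE.components
      exact .conv (.inl hB (hc.check hΓ hA h)) hT hTE.symm
    · cases h
  · split at h
    · next he =>
      rw [he] at hE hTE
      obtain ⟨hA, hB⟩ := hE.components
      exact .conv (.inr hA (hc.check hΓ hB h)) hT hTE.symm
    · cases h
  · split at h
    · next he =>
      rw [he] at hE hTE
      exact .conv (.vert hE.gq_univ (hc.check hΓ hE.components.el h)) hT hTE.symm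
    · cases h
  · split at h
    · next hi => exact .conv (hc.infer hΓ hi) hT (convIn_of_convTest hS 1000 h)
    · cases h

theorem Sound.isTypeStep (hc : c.Sound σ) {Γ : Ctx} {T : Tm} (hΓ : Context σ Γ)
    (h : isTypeStep c Γ T = true) : DerivesIn σ Γ (.isType T) := by
  unfold Checker.isTypeStep at h
  split at h
  · exact .univ
  · simp only [Bool.and_eq_true] at h
    have hA := hc.isType hΓ h.1
    exact .pi hA (hc.isType (hΓ.cons hA) h.2)
  · simp only [Bool.and_eq_true] at h
    have hA := hc.isType hΓ h.1
    exact .sigma hA (hc.isType (hΓ.cons hA) h.2)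
  · simp only [Bool.and_eq_true] at h
    have hA := hc.isType hΓ h.1.1
    exact .id hA (hc.check hΓ hA h.1.2) (hc.check hΓ hA h.2)
  · simp only [Bool.and_eq_true] at h
    exact .sum (hc.isType hΓ h.1) (hc.isType hΓ h.2)
  · exact .el (hc.check hΓ .univ h)

/-- The three mutually recursive functions are iterates of a single step, so their joint soundness
is an induction on the depth, starting from a checker that rejects everything. -/
theorem run_sound (hS : S.Realized σ) (hint : ℕ → Tm → Option Tm) (m : ℕ) :
    (run S hint m).Sound σ := by
  induction m with
  | zero => exact
    { infer := fun _ h => by cases h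
      check := fun _ _ h => by cases h
      isType := fun _ h => by cases h }
  | succ m ih =>
    exact
    { infer := ih.inferStep hS
      check := ih.checkStep hS
      isType := ih.isTypeStep }

/-- The test whether `t` is a closed term of the closed type `T`. -/
def test (S : Sig) (hint : ℕ → Tm → Option Tm) (t T : Tm) : Bool :=
  (run S hint 1000).isType [] T && (run S hint 1000).check [] t T

theorem derives_of_test (hS : S.Realized σ) {t T : Tm} (h : test S hint t T = true) :
    Derives [] (t.subst σ ∶ T.subst σ) := by
  have hr := run_sound hS hint 1000
  rw [test, Bool.and_eq_true] at h
  exact hr.check (Γ := []) WellFormed.nil (hr.isType (Γ := []) WellFormed.nil h.1) h.2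

end Checker

/-! ### Sequences of definitions -/

/-- The first `k` definitions of a list. -/
def Sig.take (l : List Entry) (k : ℕ) : Sig := fun i => bif Nat.blt i k then l[i]? else none

/-- The term with its variables except for the first `k` removed. -/
def Tm.truncate (k : ℕ) (t : Tm) : Tm := t.subst fun i => bif Nat.blt i k then .var i else .star

/-- Invariance under truncation is a computable way to say that only the first `k` free variables
occur. -/
theorem Tm.subst_of_truncate {k : ℕ} {t : Tm} (h : beq (t.truncate k) t = true) {σ τ : ℕ → Tm}
    (hστ : ∀ i < k, σ i = τ i) : t.subst σ = t.subst τ := by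
  rw [← eq_of_beq _ _ h, truncate, subst_subst, subst_subst]
  refine subst_congr t fun i => ?_
  by_cases hi : i < k
  · have : Nat.blt i k = true := by simpa using hi
    rw [this]
    exact hστ i hi
  · have : Nat.blt i k = false := Bool.eq_false_iff.mpr (mt Nat.blt_eq.mp hi)
    rw [this]
    rfl

/-- The test of the definition number `k` of a list. -/
def testEntry (hint : ℕ → Tm → Option Tm) (l : List Entry) (k : ℕ) : Bool :=
  match l[k]? with
  | some e => beq (e.value.truncate k) e.value && beq (e.type.truncate k) e.type &&
      Checker.test (Sig.take l k) hint e.value e.type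
  | none => false

/-- The realization is built definition by definition: position `k` receives its value with the
earlier realization substituted. Soundness of the checker relative to the earlier definitions gives
the typing. The truncation test ensures that changing position `k` affects neither the earlier items
nor item `k` itself. -/
theorem exists_realized {hint : ℕ → Tm → Option Tm} {l : List Entry} {k : ℕ}
    (h : ∀ i < k, testEntry hint l i = true) : ∃ σ, (Sig.take l k).Realized σ := by
  induction k with
  | zero => exact ⟨Tm.var, fun i e h => by cases i <;> cases h⟩
  | succ k ih =>
    obtain ⟨σ, hσ⟩ := ih fun i hi => h i (hi.trans k.lt_succ_self)
    have hk := h k k.lt_succ_self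
    unfold testEntry at hk
    split at hk
    · next e he =>
      simp only [Bool.and_eq_true] at hk
      have hd := Checker.derives_of_test hσ hk.2
      have hτ : ∀ i < k, σ i = (fun i => if i = k then e.value.subst σ else σ i) i :=
        fun i hi => (if_neg hi.ne).symm
      refine ⟨fun i => if i = k then e.value.subst σ else σ i, fun i e' h' => ?_⟩
      have hi : i < k + 1 := by
        by_contra hi
        have : Nat.blt i (k + 1) = false := Bool.eq_false_iff.mpr (mt Nat.blt_eq.mp hi)
        rw [Sig.take, this] at h'
        cases h'
      have : Nat.blt i (k + 1) = true := by simpa using hi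
      rw [Sig.take, this, cond_true] at h'
      rcases Nat.lt_succ_iff_lt_or_eq.mp hi with hi | rfl
      · have : Nat.blt i k = true := by simpa using hi
        have h₁ := hσ i e' (by rw [Sig.take, this]; exact h')
        have h₂ := h i (hi.trans k.lt_succ_self)
        rw [testEntry, h'] at h₂
        simp only [Bool.and_eq_true] at h₂
        rw [← hτ i hi, ← subst_of_truncate h₂.1.1 fun j hj => hτ j (hj.trans hi),
          ← subst_of_truncate h₂.1.2 fun j hj => hτ j (hj.trans hi)]
        exact h₁
      · obtain rfl : e = e' := Option.some.inj (he.symm.trans h')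
        rw [← subst_of_truncate hk.1.1 hτ, ← subst_of_truncate hk.1.2 hτ]
        simp only [if_true]
        exact ⟨hd, trivial⟩
    · cases hk

end HoTT

/-! ### Named-variable notation for the proof terms -/

namespace HoTT

/-! ### Higher-order abstract syntax -/

/-- A term with named variables: the value at `n` is the de Bruijn term over a context of `n`
variables. -/
abbrev Sc : Type := ℕ → Tm

namespace Sc

/-- The variable that is bound in a context of `k` variables. -/
def level (k : ℕ) : Sc := fun n => .var (n - 1 - k)

/-- The body of a binder. -/
def bind (b : Sc → Sc) : Sc := fun n => b (level n) (n + 1)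

/-- The term with the definition number `i`. -/
def const (i : ℕ) : Sc := fun n => .var (n + i)

def univ : Sc := fun _ => .univ
def pi (A : Sc) (B : Sc → Sc) : Sc := fun n => .pi (A n) (bind B n)
def arr (A B : Sc) : Sc := pi A fun _ => B
def lam (b : Sc → Sc) : Sc := fun n => .lam (bind b n)
def app (f a : Sc) : Sc := fun n => .app (f n) (a n)
def sigma (A : Sc) (B : Sc → Sc) : Sc := fun n => .sigma (A n) (bind B n)
def prod (A B : Sc) : Sc := sigma A fun _ => B
def pair (a b : Sc) : Sc := fun n => .pair (a n) (b n)
def id (A a b : Sc) : Sc := fun n => .id (A n) (a n) (b n)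
def refl (a : Sc) : Sc := fun n => .refl (a n)
def J (C : Sc → Sc → Sc) (d p : Sc) : Sc := fun n =>
  .J (bind (fun y => bind fun q => C y q) n) (d n) (p n)
def sum (A B : Sc) : Sc := fun n => .sum (A n) (B n)
def inl (a : Sc) : Sc := fun n => .inl (a n)
def inr (b : Sc) : Sc := fun n => .inr (b n)
def sumElim (P : Sc → Sc) (l r t : Sc) : Sc := fun n => .sumElim (bind P n) (l n) (r n) (t n)
def gq (V E : Sc) : Sc := fun n => .gq (V n) (E n)
def vert (i : Sc) : Sc := fun n => .vert (i n)
def edge (V E i j e : Sc) : Sc := fun n => .edge (V n) (E n) (i n) (j n) (e n)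
def gqElim (P : Sc → Sc) (v d t : Sc) : Sc := fun n => .gqElim (bind P n) (v n) (d n) (t n)
def gqComp (V E : Sc) (P : Sc → Sc) (v d i j e : Sc) : Sc := fun n =>
  .gqComp (V n) (E n) (bind P n) (v n) (d n) (i n) (j n) (e n)
def funext (A : Sc) (B : Sc → Sc) (f g : Sc) : Sc := fun n => .funext (A n) (bind B n) (f n) (g n)
def ua (A B : Sc) : Sc := fun n => .ua (A n) (B n)
def transport (P : Sc → Sc) (p u : Sc) : Sc := fun n => .transport (bind P n) (p n) (u n)
def transportConst (X p u : Sc) : Sc := fun n => .transportConst (X n) (p n) (u n)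
def apd (P : Sc → Sc) (f a p : Sc) : Sc := fun n => .apd (bind P n) (f n) (a n) (p n)
def equiv (A B : Sc) : Sc := fun n => .equiv (A n) (B n)

/-- Application. -/
infixl:100 " ⬝ " => app

notation:60 "Λ " x ", " t:60 => lam (fun x => t)

/-- Elimination of a pair. -/
def sigmaElim (P : Sc → Sc) (m : Sc → Sc → Sc) (t : Sc) : Sc := fun n =>
  .sigmaElim (bind P n) ((Λ a, Λ b, m a b) n) (t n)

/-- Application to several arguments. -/
def apps (f : Sc) (l : List Sc) : Sc := l.foldl app f

/-- The definition of `t : T`. -/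
def defn (t T : Sc) : Entry := ⟨t 0, T 0, true⟩

/-- The lemma `T` with the proof `t`. -/
def lem (t T : Sc) : Entry := ⟨t 0, T 0, false⟩

end Sc

end HoTT

/-! ### Path algebra inside the type theory -/

namespace HoTT

namespace Sc

/-! ### Paths -/

/-- Transport of `u : P a` along `p : a = b`. -/
def tr (A P a b p u : Sc) : Sc := apps (const 0) [A, P, a, b, p, u]

def trEntry : Entry := defn
  (Λ _, Λ P, Λ _, Λ _, Λ p, Λ u, transport (P ⬝ ·) p u)
  (pi univ fun A => pi (arr A univ) fun P => pi A fun a => pi A fun b => pi (id A a b) fun _ =>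
    arr (P ⬝ a) (P ⬝ b))

def concat (A a b c p q : Sc) : Sc := apps (const 1) [A, a, b, c, p, q]

def concatEntry : Entry := defn
  (Λ A, Λ a, Λ _, Λ _, Λ p, Λ q, transport (fun y => id A a y) q p)
  (pi univ fun A => pi A fun a => pi A fun b => pi A fun c =>
    arr (id A a b) (arr (id A b c) (id A a c)))

/-- The action of `f : A → B` on `p : a = b`. -/
def ap (A B f a b p : Sc) : Sc := apps (const 2) [A, B, f, a, b, p]

def apEntry : Entry := defn
  (Λ _, Λ B, Λ f, Λ a, Λ _, Λ p, J (fun y _ => id B (f ⬝ a) (f ⬝ y)) (refl (f ⬝ a)) p)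
  (pi univ fun A => pi univ fun B => pi (arr A B) fun f => pi A fun a => pi A fun b =>
    arr (id A a b) (id B (f ⬝ a) (f ⬝ b)))

/-- `refl · q = q` -/
def concatRefl (A a b q : Sc) : Sc := apps (const 3) [A, a, b, q]

def concatReflEntry : Entry := lem
  (Λ A, Λ a, Λ _, Λ q, J (fun y r => id (id A a y) (concat A a a y (refl a) r) r) (refl (refl a)) q)
  (pi univ fun A => pi A fun a => pi A fun b => pi (id A a b) fun q =>
    id (id A a b) (concat A a a b (refl a) q) q)

/-- `p = q → p = refl · q` -/
def eqConcatRefl (A a b p q s : Sc) : Sc := apps (const 4) [A, a, b, p, q, s]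

/-- `concat` computes on its second argument, so `p · refl` is `p` by conversion while `refl · q` is
not `q`. The conclusion is exactly the square that `trPath` asks for when both of its paths `r` and
`r'` are `refl`. -/
def eqConcatReflEntry : Entry := lem
  (Λ A, Λ a, Λ b, Λ p, Λ _, Λ s, J (fun q _ => id (id A a b) p (concat A a a b (refl a) q))
    (J (fun y r => id (id A a y) r (concat A a a y (refl a) r)) (refl (refl a)) p) s)
  (pi univ fun A => pi A fun a => pi A fun b => pi (id A a b) fun p => pi (id A a b) fun q =>
    arr (id (id A a b) p q) (id (id A a b) p (concat A a a b (refl a) q)))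

/-- `p = q → r = q → p = r` -/
def eqTrans (A a b c p q : Sc) : Sc := apps (const 5) [A, a, b, c, p, q]

/-- The second path is taken reversed because the computation rules supply it in that direction; no
inverse has to be formed. -/
def eqTransEntry : Entry := lem
  (Λ A, Λ a, Λ _, Λ c, Λ p, Λ q, J (fun b _ => arr (id A a b) (id A a c)) (Λ p, p) q ⬝ p)
  (pi univ fun A => pi A fun a => pi A fun b => pi A fun c =>
    arr (id A a b) (arr (id A c b) (id A a c)))

/-- `ap f p = q → ap g q = r → ap (g ∘ f) p = r` -/
def apComp (A B C f g a b p q r s t : Sc) : Sc :=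
  apps (const 6) [A, B, C, f, g, a, b, p, q, r, s, t]

/-- The premises have the shape of path computation rules, so the action of a composite of two
recursors on a path constructor can be read off. Induction on `s` turns `q` into `ap f p`; induction
on `p` then reduces both actions to `refl`. -/
def apCompEntry : Entry := lem
  (Λ A, Λ B, Λ C, Λ f, Λ g, Λ a, Λ b, Λ p, Λ _, Λ r, Λ s,
    let D (b : Sc) := id C (g ⬝ (f ⬝ a)) (g ⬝ (f ⬝ b))
    J (fun q _ => arr (id (D b) (ap B C g (f ⬝ a) (f ⬝ b) q) r)
        (id (D b) (ap A C (Λ x, g ⬝ (f ⬝ x)) a b p) r))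
      (J (fun b p => pi (D b) fun r =>
          arr (id (D b) (ap B C g (f ⬝ a) (f ⬝ b) (ap A B f a b p)) r)
            (id (D b) (ap A C (Λ x, g ⬝ (f ⬝ x)) a b p) r))
        (Λ _, Λ t, t) p ⬝ r)
      s)
  (pi univ fun A => pi univ fun B => pi univ fun C => pi (arr A B) fun f => pi (arr B C) fun g =>
    pi A fun a => pi A fun b => pi (id A a b) fun p => pi (id B (f ⬝ a) (f ⬝ b)) fun q =>
    let D := id C (g ⬝ (f ⬝ a)) (g ⬝ (f ⬝ b))
    pi D fun r => arr (id (id B (f ⬝ a) (f ⬝ b)) (ap A B f a b p) q)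
      (arr (id D (ap B C g (f ⬝ a) (f ⬝ b) q) r) (id D (ap A C (Λ x, g ⬝ (f ⬝ x)) a b p) r)))

/-- `ap (g ∘ f) p = r → ap g (ap f p) = r` -/
def apAp (A B C f g a b p r s : Sc) : Sc := apps (const 7) [A, B, C, f, g, a, b, p, r, s]

def apApEntry : Entry := lem
  (Λ A, Λ B, Λ C, Λ f, Λ g, Λ a, Λ _, Λ p, Λ r,
    let D (b : Sc) := id C (g ⬝ (f ⬝ a)) (g ⬝ (f ⬝ b))
    J (fun b p => pi (D b) fun r =>
        arr (id (D b) (ap A C (Λ x, g ⬝ (f ⬝ x)) a b p) r)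
          (id (D b) (ap B C g (f ⬝ a) (f ⬝ b) (ap A B f a b p)) r))
      (Λ _, Λ t, t) p ⬝ r)
  (pi univ fun A => pi univ fun B => pi univ fun C => pi (arr A B) fun f => pi (arr B C) fun g =>
    pi A fun a => pi A fun b => pi (id A a b) fun p =>
    let D := id C (g ⬝ (f ⬝ a)) (g ⬝ (f ⬝ b))
    pi D fun r => arr (id D (ap A C (Λ x, g ⬝ (f ⬝ x)) a b p) r)
      (id D (ap B C g (f ⬝ a) (f ⬝ b) (ap A B f a b p)) r))

/-- `ap id p = p` -/
def apId (A a b p : Sc) : Sc := apps (const 8) [A, a, b, p]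

def apIdEntry : Entry := lem
  (Λ A, Λ a, Λ _, Λ p, J (fun b p => id (id A a b) (ap A A (Λ z, z) a b p) p) (refl (refl a)) p)
  (pi univ fun A => pi A fun a => pi A fun b => pi (id A a b) fun p =>
    id (id A a b) (ap A A (Λ z, z) a b p) p)

/-- `ap (fun _ => c) p = refl` -/
def apConst (A B c a b p : Sc) : Sc := apps (const 9) [A, B, c, a, b, p]

def apConstEntry : Entry := lem
  (Λ A, Λ B, Λ c, Λ a, Λ _, Λ p, J (fun b p => id (id B c c) (ap A B (Λ _, c) a b p) (refl c))
    (refl (refl c)) p)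
  (pi univ fun A => pi univ fun B => pi B fun c => pi A fun a => pi A fun b =>
    pi (id A a b) fun p =>
    id (id B c c) (ap A B (Λ _, c) a b p) (refl c))

/-- Transport in a family of paths `f z = g z`. -/
def trPath (A B f g a b p r r' s : Sc) : Sc := apps (const 10) [A, B, f, g, a, b, p, r, r', s]

/-- This reduces the path case of a homotopy out of a pushout to a naturality square. By induction
on `p`, with `r'` generalized, the square becomes `refl · r' = r`, and `concatRefl` turns it into `r
= r'`. -/
def trPathEntry : Entry := lem
  (Λ A, Λ B, Λ f, Λ g, Λ a, Λ _, Λ p, Λ r, Λ r', Λ s,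
    J (fun b p => pi (id B (f ⬝ b) (g ⬝ b)) fun r' =>
        arr (id (id B (f ⬝ a) (g ⬝ b)) (concat B (f ⬝ a) (f ⬝ b) (g ⬝ b) (ap A B f a b p) r')
            (concat B (f ⬝ a) (g ⬝ a) (g ⬝ b) r (ap A B g a b p)))
          (id (id B (f ⬝ b) (g ⬝ b)) (tr A (Λ z, id B (f ⬝ z) (g ⬝ z)) a b p r) r'))
      (Λ r', Λ s, tr (id B (f ⬝ a) (g ⬝ a)) (Λ z, id (id B (f ⬝ a) (g ⬝ a)) z r')
        (concat B (f ⬝ a) (f ⬝ a) (g ⬝ a) (refl (f ⬝ a)) r') r s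
        (concatRefl B (f ⬝ a) (g ⬝ a) r'))
      p ⬝ r' ⬝ s)
  (pi univ fun A => pi univ fun B => pi (arr A B) fun f => pi (arr A B) fun g =>
    pi A fun a => pi A fun b => pi (id A a b) fun p => pi (id B (f ⬝ a) (g ⬝ a)) fun r =>
    pi (id B (f ⬝ b) (g ⬝ b)) fun r' =>
    arr (id (id B (f ⬝ a) (g ⬝ b)) (concat B (f ⬝ a) (f ⬝ b) (g ⬝ b) (ap A B f a b p) r')
        (concat B (f ⬝ a) (g ⬝ a) (g ⬝ b) r (ap A B g a b p)))
      (id (id B (f ⬝ b) (g ⬝ b)) (tr A (Λ z, id B (f ⬝ z) (g ⬝ z)) a b p r) r'))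

end Sc

end HoTT

/-! ### Pushouts, joins and homotopy fibers as definitions of the theory -/

namespace HoTT

namespace Sc

/-! ### Pushouts -/

/-- Quantification over two maps `A ← C → B`. -/
def piSpan (T : Sc → Sc → Sc → Sc → Sc → Sc) : Sc :=
  pi univ fun A => pi univ fun B => pi univ fun C => pi (arr C A) fun f => pi (arr C B) fun g =>
    T A B C f g

def lamSpan (t : Sc → Sc → Sc → Sc → Sc → Sc) : Sc := Λ A, Λ B, Λ C, Λ f, Λ g, t A B C f g

/-- The relation that defines the pushout. -/
def pushoutEdge (A B C f g : Sc) : Sc := apps (const 11) [A, B, C, f, g]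

def pushoutEdgeEntry : Entry := defn
  (lamSpan fun A B C f g => Λ i, Λ j, sigma C fun c =>
    prod (id (sum A B) (inl (f ⬝ c)) i) (id (sum A B) (inr (g ⬝ c)) j))
  (piSpan fun A B _ _ _ => arr (sum A B) (arr (sum A B) univ))

def pushout (A B C f g : Sc) : Sc := apps (const 12) [A, B, C, f, g]

def pushoutEntry : Entry := defn
  (lamSpan fun A B C f g => gq (sum A B) (pushoutEdge A B C f g))
  (piSpan fun _ _ _ _ _ => univ)

/-- The point constructors of the pushout. -/
def left (A B C f g a : Sc) : Sc := apps (const 13) [A, B, C, f, g, a]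

def leftEntry : Entry := defn
  (lamSpan fun _ _ _ _ _ => Λ a, vert (inl a))
  (piSpan fun A B C f g => arr A (pushout A B C f g))

def right (A B C f g b : Sc) : Sc := apps (const 14) [A, B, C, f, g, b]

def rightEntry : Entry := defn
  (lamSpan fun _ _ _ _ _ => Λ b, vert (inr b))
  (piSpan fun A B C f g => arr B (pushout A B C f g))

/-- The path constructor of the pushout. -/
def glue (A B C f g c : Sc) : Sc := apps (const 15) [A, B, C, f, g, c]

def glueEntry : Entry := defn
  (lamSpan fun A B C f g => Λ c, edge (sum A B) (pushoutEdge A B C f g) (inl (f ⬝ c)) (inr (g ⬝ c))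
    (pair c (pair (refl (inl (f ⬝ c))) (refl (inr (g ⬝ c))))))
  (piSpan fun A B C f g => pi C fun c =>
    id (pushout A B C f g) (left A B C f g (f ⬝ c)) (right A B C f g (g ⬝ c)))

/-- Quantification over the data that define a map from a pushout to a type. -/
def piCocone (T : Sc → Sc → Sc → Sc → Sc → Sc → Sc → Sc → Sc → Sc) : Sc :=
  piSpan fun A B C f g => pi univ fun X => pi (arr A X) fun u => pi (arr B X) fun v =>
    pi (pi C fun c => id X (u ⬝ (f ⬝ c)) (v ⬝ (g ⬝ c))) fun H => T A B C f g X u v H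

def lamCocone (t : Sc → Sc → Sc → Sc → Sc → Sc → Sc → Sc → Sc → Sc) : Sc :=
  lamSpan fun A B C f g => Λ X, Λ u, Λ v, Λ H, t A B C f g X u v H

/-- The map on the vertices of the graph that underlies `pushoutRec`. -/
def recVert (A B X u v : Sc) : Sc := apps (const 16) [A, B, X, u, v]

def recVertEntry : Entry := defn
  (Λ _, Λ _, Λ X, Λ u, Λ v, Λ i, sumElim (fun _ => X) u v i)
  (pi univ fun A => pi univ fun B => pi univ fun X => arr (arr A X)
    (arr (arr B X) (arr (sum A B) X)))

/-- The map on the edges of the graph that underlies `pushoutRec`. -/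
def recEdge (A B C f g X u v H i j e : Sc) : Sc :=
  apps (const 17) [A, B, C, f, g, X, u, v, H, i, j, e]

def recEdgeEntry : Entry := defn
  (lamCocone fun A B _ f _ X u v H => Λ i, Λ j, Λ e,
    let k (i : Sc) := recVert A B X u v ⬝ i
    sigmaElim (fun _ => id X (k i) (k j))
      (fun c r => sigmaElim (fun _ => id X (k i) (k j))
        (fun p q => J (fun y _ => id X (k y) (k j))
          (J (fun y _ => id X (u ⬝ (f ⬝ c)) (k y)) (H ⬝ c) q)
          p)
        r)
      e)
  (piCocone fun A B C f g X u v _ => pi (sum A B) fun i => pi (sum A B) fun j =>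
    arr (pushoutEdge A B C f g ⬝ i ⬝ j) (id X (recVert A B X u v ⬝ i) (recVert A B X u v ⬝ j)))

/-- The second method of the eliminator that underlies `pushoutRec`. -/
def recMethod (A B C f g X u v H : Sc) : Sc :=
  Λ i, Λ j, Λ e,
    let p : Sc := edge (sum A B) (pushoutEdge A B C f g) i j e
    let k (i : Sc) := recVert A B X u v ⬝ i
    concat X (transport (fun _ => X) p (k i)) (k i) (k j) (transportConst X p (k i))
      (recEdge A B C f g X u v H i j e)

/-- Maps out of a pushout. -/
def pushoutRec (A B C f g X u v H : Sc) : Sc := apps (const 18) [A, B, C, f, g, X, u, v, H]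

def pushoutRecEntry : Entry := defn
  (lamCocone fun A B C f g X u v H => Λ w,
    gqElim (fun _ => X) (recVert A B X u v) (recMethod A B C f g X u v H) w)
  (piCocone fun A B C f g X _ _ _ => arr (pushout A B C f g) X)

/-- If the dependent action of `h` on `p` is `transportConst · q`, then `ap h p` is `q`. -/
def apOfApd (A B h a b p q s : Sc) : Sc := apps (const 19) [A, B, h, a, b, p, q, s]

/-- `gqComp` describes the dependent action in a constant family. By induction on `p`, everything
but `q` becomes `refl`, and `refl · q = q` finishes the argument. -/
def apOfApdEntry : Entry := lem
  (Λ A, Λ B, Λ h, Λ a, Λ _, Λ p, Λ q, Λ s,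
    J (fun b p => pi (id B (h ⬝ a) (h ⬝ b)) fun q =>
        arr (id (id B (transport (fun _ => B) p (h ⬝ a)) (h ⬝ b)) (apd (fun _ => B) h a p)
            (concat B (transport (fun _ => B) p (h ⬝ a)) (h ⬝ a) (h ⬝ b)
              (transportConst B p (h ⬝ a)) q))
          (id (id B (h ⬝ a) (h ⬝ b)) (ap A B h a b p) q))
      (Λ q, Λ s, tr (id B (h ⬝ a) (h ⬝ a)) (Λ r, id (id B (h ⬝ a) (h ⬝ a)) (refl (h ⬝ a)) r)
        (concat B (h ⬝ a) (h ⬝ a) (h ⬝ a) (refl (h ⬝ a)) q) q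
        (concatRefl B (h ⬝ a) (h ⬝ a) q) s)
      p ⬝ q ⬝ s)
  (pi univ fun A => pi univ fun B => pi (arr A B) fun h => pi A fun a => pi A fun b =>
    pi (id A a b) fun p => pi (id B (h ⬝ a) (h ⬝ b)) fun q =>
    arr (id (id B (transport (fun _ => B) p (h ⬝ a)) (h ⬝ b)) (apd (fun _ => B) h a p)
        (concat B (transport (fun _ => B) p (h ⬝ a)) (h ⬝ a) (h ⬝ b)
          (transportConst B p (h ⬝ a)) q))
      (id (id B (h ⬝ a) (h ⬝ b)) (ap A B h a b p) q))

/-- `pushoutRec` maps the path `glue c` to `H c`. -/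
def recGlue (A B C f g X u v H c : Sc) : Sc := apps (const 20) [A, B, C, f, g, X, u, v, H, c]

/-- The edge behind `glue c` carries two copies of `refl`, on which the path inductions in `recEdge`
compute to `H c`. Hence `gqComp` has, up to conversion, the type of the premise of `apOfApd`. -/
def recGlueEntry : Entry := lem
  (lamCocone fun A B C f g X u v H => Λ c,
    apOfApd (pushout A B C f g) X (pushoutRec A B C f g X u v H)
      (vert (inl (f ⬝ c))) (vert (inr (g ⬝ c)))
      (edge (sum A B) (pushoutEdge A B C f g) (inl (f ⬝ c)) (inr (g ⬝ c))
        (pair c (pair (refl (inl (f ⬝ c))) (refl (inr (g ⬝ c))))))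
      (H ⬝ c)
      (gqComp (sum A B) (pushoutEdge A B C f g) (fun _ => X) (recVert A B X u v)
        (recMethod A B C f g X u v H) (inl (f ⬝ c)) (inr (g ⬝ c))
        (pair c (pair (refl (inl (f ⬝ c))) (refl (inr (g ⬝ c)))))))
  (piCocone fun A B C f g X u v H => pi C fun c =>
    id (id X (u ⬝ (f ⬝ c)) (v ⬝ (g ⬝ c)))
      (ap (pushout A B C f g) X (pushoutRec A B C f g X u v H)
        (left A B C f g (f ⬝ c)) (right A B C f g (g ⬝ c)) (glue A B C f g c))
      (H ⬝ c))

/-- The map on the vertices of the graph that underlies `pushoutInd`. -/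
def indVert (A B C f g P u v : Sc) : Sc := apps (const 21) [A, B, C, f, g, P, u, v]

def indVertEntry : Entry := defn
  (lamSpan fun _ _ _ _ _ => Λ P, Λ u, Λ v, Λ i, sumElim (fun i => P ⬝ vert i) u v i)
  (piSpan fun A B C f g => pi (arr (pushout A B C f g) univ) fun P =>
    arr (pi A fun a => P ⬝ left A B C f g a) (arr (pi B fun b => P ⬝ right A B C f g b)
      (pi (sum A B) fun i => P ⬝ vert i)))

/-- Induction on a pushout. -/
def pushoutInd (A B C f g P u v H w : Sc) : Sc := apps (const 22) [A, B, C, f, g, P, u, v, H, w]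

/-- An arbitrary edge from `i` to `j` is a triple `(c, (p, q))`. Path induction on `q` and `p`,
whose free endpoints are `j` and `i`, leaves the edge behind `glue c`, where `H c` applies. -/
def pushoutIndEntry : Entry := lem
  (lamSpan fun A B C f g => Λ P, Λ u, Λ v, Λ H, Λ w,
    let k (i : Sc) : Sc := indVert A B C f g P u v ⬝ i
    let goal (i j e : Sc) : Sc :=
      id (P ⬝ vert j) (transport (P ⬝ ·) (edge (sum A B) (pushoutEdge A B C f g) i j e) (k i)) (k j)
    gqElim (P ⬝ ·) (Λ i, k i)
      (Λ i, Λ j, Λ e, sigmaElim (fun e => goal i j e)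
        (fun c r => sigmaElim (fun r => goal i j (pair c r))
          (fun p q => J (fun y q => goal i y (pair c (pair p q)))
            (J (fun x p => goal x (inr (g ⬝ c)) (pair c (pair p (refl (inr (g ⬝ c))))))
              (H ⬝ c) p) q)
          r)
        e)
      w)
  (piSpan fun A B C f g => pi (arr (pushout A B C f g) univ) fun P =>
    pi (pi A fun a => P ⬝ left A B C f g a) fun u =>
      pi (pi B fun b => P ⬝ right A B C f g b) fun v =>
    arr (pi C fun c => id (P ⬝ right A B C f g (g ⬝ c))
        (tr (pushout A B C f g) P (left A B C f g (f ⬝ c)) (right A B C f g (g ⬝ c))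
          (glue A B C f g c) (u ⬝ (f ⬝ c)))
        (v ⬝ (g ⬝ c)))
      (pi (pushout A B C f g) fun w => P ⬝ w))

/-- The join of two types. -/
def prodFst (A B : Sc) : Sc := apps (const 23) [A, B]

def prodFstEntry : Entry := defn
  (Λ A, Λ _, Λ c, sigmaElim (fun _ => A) (fun a _ => a) c)
  (pi univ fun A => pi univ fun B => arr (prod A B) A)

def prodSnd (A B : Sc) : Sc := apps (const 24) [A, B]

def prodSndEntry : Entry := defn
  (Λ _, Λ B, Λ c, sigmaElim (fun _ => B) (fun _ b => b) c)
  (pi univ fun A => pi univ fun B => arr (prod A B) B)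

def join (A B : Sc) : Sc := apps (const 25) [A, B]

def joinEntry : Entry := defn
  (Λ A, Λ B, pushout A B (prod A B) (prodFst A B) (prodSnd A B))
  (arr univ (arr univ univ))

/-- Quantification over two maps `A → X ← B`. -/
def piCospan (T : Sc → Sc → Sc → Sc → Sc → Sc) : Sc :=
  pi univ fun A => pi univ fun B => pi univ fun X => pi (arr A X) fun f => pi (arr B X) fun g =>
    T A B X f g

def pullback (A B X f g : Sc) : Sc := apps (const 26) [A, B, X, f, g]

def pullbackEntry : Entry := defn
  (lamSpan fun A B X f g => sigma A fun a => sigma B fun b => id X (f ⬝ a) (g ⬝ b))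
  (piCospan fun _ _ _ _ _ => univ)

def pullbackFst (A B X f g : Sc) : Sc := apps (const 27) [A, B, X, f, g]

def pullbackFstEntry : Entry := defn
  (lamSpan fun A _ _ _ _ => Λ c, sigmaElim (fun _ => A) (fun a _ => a) c)
  (piCospan fun A B X f g => arr (pullback A B X f g) A)

def pullbackSnd (A B X f g : Sc) : Sc := apps (const 28) [A, B, X, f, g]

def pullbackSndEntry : Entry := defn
  (lamSpan fun _ B _ _ _ => Λ c,
    sigmaElim (fun _ => B) (fun _ r => sigmaElim (fun _ => B) (fun b _ => b) r) c)
  (piCospan fun A B X f g => arr (pullback A B X f g) B)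

def pullbackPath (A B X f g : Sc) : Sc := apps (const 29) [A, B, X, f, g]

def pullbackPathEntry : Entry := defn
  (lamSpan fun A B X f g => Λ c,
    sigmaElim (fun c => id X (f ⬝ (pullbackFst A B X f g ⬝ c)) (g ⬝ (pullbackSnd A B X f g ⬝ c)))
      (fun a r => sigmaElim (fun r => id X (f ⬝ (pullbackFst A B X f g ⬝ pair a r))
          (g ⬝ (pullbackSnd A B X f g ⬝ pair a r))) (fun _ h => h) r)
      c)
  (piCospan fun A B X f g => pi (pullback A B X f g) fun c =>
    id X (f ⬝ (pullbackFst A B X f g ⬝ c)) (g ⬝ (pullbackSnd A B X f g ⬝ c)))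

/-- The domain of the join of two maps. -/
def joinDom (A B X f g : Sc) : Sc := apps (const 30) [A, B, X, f, g]

def joinDomEntry : Entry := defn
  (lamSpan fun A B X f g =>
    pushout A B (pullback A B X f g) (pullbackFst A B X f g) (pullbackSnd A B X f g))
  (piCospan fun _ _ _ _ _ => univ)

/-- The join of two maps. -/
def joinMap (A B X f g : Sc) : Sc := apps (const 31) [A, B, X, f, g]

def joinMapEntry : Entry := defn
  (lamSpan fun A B X f g =>
    pushoutRec A B (pullback A B X f g) (pullbackFst A B X f g) (pullbackSnd A B X f g) X f g
      (pullbackPath A B X f g))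
  (piCospan fun A B X f g => arr (joinDom A B X f g) X)

/-- The homotopy fiber. -/
def fib (A X f x : Sc) : Sc := apps (const 32) [A, X, f, x]

def fibEntry : Entry := defn
  (Λ A, Λ X, Λ f, Λ x, sigma A fun a => id X (f ⬝ a) x)
  (pi univ fun A => pi univ fun X => arr (arr A X) (arr X univ))

end Sc

end HoTT

/-! ### The case of projections: pushouts commute with dependent sums -/

namespace HoTT

namespace Sc

/-! ### The join of the projections of two families -/

/-- Quantification over two families of types. -/
def piFam (T : Sc → Sc → Sc → Sc) : Sc :=
  pi univ fun X => pi (arr X univ) fun F => pi (arr X univ) fun G => T X F G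

def lamFam (t : Sc → Sc → Sc → Sc) : Sc := Λ X, Λ F, Λ G, t X F G

def total (X F : Sc) : Sc := apps (const 33) [X, F]

def totalEntry : Entry := defn
  (Λ X, Λ F, sigma X (F ⬝ ·))
  (pi univ fun X => arr (arr X univ) univ)

def proj (X F : Sc) : Sc := apps (const 34) [X, F]

def projEntry : Entry := defn
  (Λ X, Λ _, Λ z, sigmaElim (fun _ => X) (fun x _ => x) z)
  (pi univ fun X => pi (arr X univ) fun F => arr (total X F) X)

/-- The pullback of the projections. -/
def pb (X F G : Sc) : Sc := apps (const 35) [X, F, G]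

def pbEntry : Entry := defn
  (lamFam fun X F G => pullback (total X F) (total X G) X (proj X F) (proj X G))
  (piFam fun _ _ _ => univ)

def pbFst (X F G c : Sc) : Sc :=
  pullbackFst (total X F) (total X G) X (proj X F) (proj X G) ⬝ c

def pbSnd (X F G c : Sc) : Sc :=
  pullbackSnd (total X F) (total X G) X (proj X F) (proj X G) ⬝ c

def pbPair (X F G x u v : Sc) : Sc := apps (const 36) [X, F, G, x, u, v]

def pbPairEntry : Entry := defn
  (lamFam fun _ _ _ => Λ x, Λ u, Λ v, pair (pair x u) (pair (pair x v) (refl x)))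
  (piFam fun X F G => pi X fun x => arr (F ⬝ x) (arr (G ⬝ x) (pb X F G)))

/-- Induction on the pullback. -/
def pbInd (X F G P m c : Sc) : Sc := apps (const 37) [X, F, G, P, m, c]

/-- A point of the pullback is `((x, u), ((y, v), h))` with `h : x = y`, so the pullback is in
effect `Σ x, F x × G x`. Path induction on `h` is done with `v` generalized, since the type of `v`
depends on `y`. -/
def pbIndEntry : Entry := defn
  (lamFam fun X F G => Λ P, Λ m, Λ c,
    sigmaElim (P ⬝ ·)
      (fun z r => sigmaElim
        (fun z => pi (sigma (total X G) fun w => id X (proj X F ⬝ z) (proj X G ⬝ w)) fun r =>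
          P ⬝ pair z r)
        (fun x u => Λ r, sigmaElim (fun r => P ⬝ pair (pair x u) r)
          (fun w h => sigmaElim
            (fun w => pi (id X x (proj X G ⬝ w)) fun h => P ⬝ pair (pair x u) (pair w h))
            (fun _ v => Λ h, J (fun y h => pi (G ⬝ y) fun v =>
                P ⬝ pair (pair x u) (pair (pair y v) h))
              (Λ v, m ⬝ x ⬝ u ⬝ v) h ⬝ v) w ⬝ h)
          r)
        z ⬝ r) c)
  (piFam fun X F G => pi (arr (pb X F G) univ) fun P =>
    arr (pi X fun x => pi (F ⬝ x) fun u => pi (G ⬝ x) fun v => P ⬝ pbPair X F G x u v)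
      (pi (pb X F G) fun c => P ⬝ c))

/-- The domain of the join of the projections. -/
def dom (X F G : Sc) : Sc := joinDom (total X F) (total X G) X (proj X F) (proj X G)

def map (X F G : Sc) : Sc := joinMap (total X F) (total X G) X (proj X F) (proj X G)

def domLeft (X F G x u : Sc) : Sc := apps (const 38) [X, F, G, x, u]

def domLeftEntry : Entry := defn
  (lamFam fun _ _ _ => Λ x, Λ u, vert (inl (pair x u)))
  (piFam fun X F G => pi X fun x => arr (F ⬝ x) (dom X F G))

def domRight (X F G x v : Sc) : Sc := apps (const 39) [X, F, G, x, v]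

def domRightEntry : Entry := defn
  (lamFam fun _ _ _ => Λ x, Λ v, vert (inr (pair x v)))
  (piFam fun X F G => pi X fun x => arr (G ⬝ x) (dom X F G))

def domGlue (X F G x u v : Sc) : Sc := apps (const 40) [X, F, G, x, u, v]

def domGlueEntry : Entry := defn
  (lamFam fun X F G => Λ x, Λ u, Λ v,
    glue (total X F) (total X G) (pb X F G)
      (pullbackFst (total X F) (total X G) X (proj X F) (proj X G))
      (pullbackSnd (total X F) (total X G) X (proj X F) (proj X G)) (pbPair X F G x u v))
  (piFam fun X F G => pi X fun x => pi (F ⬝ x) fun u => pi (G ⬝ x) fun v =>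
    id (dom X F G) (domLeft X F G x u) (domRight X F G x v))

/-- Induction on the domain. -/
def domInd (X F G P u v H w : Sc) : Sc := apps (const 41) [X, F, G, P, u, v, H, w]

/-- Pushout induction with curried point cases; `pbInd` reduces the path case to the points `pbPair
x u v`, at which `glue` is `domGlue`. -/
def domIndEntry : Entry := lem
  (lamFam fun X F G => Λ P, Λ l, Λ r, Λ H, Λ w,
    let f := pullbackFst (total X F) (total X G) X (proj X F) (proj X G)
    let g := pullbackSnd (total X F) (total X G) X (proj X F) (proj X G)
    let l' : Sc := Λ z, sigmaElim (fun z => P ⬝ vert (inl z)) (fun x u => l ⬝ x ⬝ u) z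
    let r' : Sc := Λ z, sigmaElim (fun z => P ⬝ vert (inr z)) (fun x v => r ⬝ x ⬝ v) z
    pushoutInd (total X F) (total X G) (pb X F G) f g P l' r'
      (Λ c, pbInd X F G (Λ c, id (P ⬝ vert (inr (g ⬝ c)))
          (tr (dom X F G) P (vert (inl (f ⬝ c))) (vert (inr (g ⬝ c)))
            (glue (total X F) (total X G) (pb X F G) f g c)
            (sigmaElim (fun z => P ⬝ vert (inl z)) (fun x u => l ⬝ x ⬝ u) (f ⬝ c)))
          (sigmaElim (fun z => P ⬝ vert (inr z)) (fun x v => r ⬝ x ⬝ v) (g ⬝ c)))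
        H c)
      w)
  (piFam fun X F G => pi (arr (dom X F G) univ) fun P =>
    pi (pi X fun x => pi (F ⬝ x) fun u => P ⬝ domLeft X F G x u) fun l =>
    pi (pi X fun x => pi (G ⬝ x) fun v => P ⬝ domRight X F G x v) fun r =>
    arr (pi X fun x => pi (F ⬝ x) fun u => pi (G ⬝ x) fun v =>
        id (P ⬝ domRight X F G x v)
          (tr (dom X F G) P (domLeft X F G x u) (domRight X F G x v) (domGlue X F G x u v)
            (l ⬝ x ⬝ u))
          (r ⬝ x ⬝ v))
      (pi (dom X F G) fun w => P ⬝ w))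

/-- Functions on the domain. -/
def piDomCocone (T : Sc → Sc → Sc → Sc → Sc → Sc → Sc → Sc) : Sc :=
  piFam fun X F G => pi univ fun Y => pi (pi X fun x => arr (F ⬝ x) Y) fun l =>
    pi (pi X fun x => arr (G ⬝ x) Y) fun r =>
    pi (pi X fun x => pi (F ⬝ x) fun u => pi (G ⬝ x) fun v => id Y (l ⬝ x ⬝ u) (r ⬝ x ⬝ v)) fun H =>
      T X F G Y l r H

def lamDomCocone (t : Sc → Sc → Sc → Sc → Sc → Sc → Sc → Sc) : Sc :=
  lamFam fun X F G => Λ Y, Λ l, Λ r, Λ H, t X F G Y l r H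

def domPath (X F G Y l r H : Sc) : Sc := apps (const 42) [X, F, G, Y, l, r, H]

def domPathEntry : Entry := defn
  (lamDomCocone fun X F G Y l r H => Λ c,
    pbInd X F G (Λ c, id Y (sigmaElim (fun _ => Y) (fun x u => l ⬝ x ⬝ u) (pbFst X F G c))
      (sigmaElim (fun _ => Y) (fun x u => r ⬝ x ⬝ u) (pbSnd X F G c))) H c)
  (piDomCocone fun X F G Y l r _ => pi (pb X F G) fun c =>
    id Y (sigmaElim (fun _ => Y) (fun x u => l ⬝ x ⬝ u) (pbFst X F G c))
      (sigmaElim (fun _ => Y) (fun x u => r ⬝ x ⬝ u) (pbSnd X F G c)))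

def domRec (X F G Y l r H : Sc) : Sc := apps (const 43) [X, F, G, Y, l, r, H]

def domRecEntry : Entry := defn
  (lamDomCocone fun X F G Y l r H =>
    pushoutRec (total X F) (total X G) (pb X F G)
      (pullbackFst (total X F) (total X G) X (proj X F) (proj X G))
      (pullbackSnd (total X F) (total X G) X (proj X F) (proj X G)) Y
      (Λ z, sigmaElim (fun _ => Y) (fun x u => l ⬝ x ⬝ u) z)
      (Λ z, sigmaElim (fun _ => Y) (fun x v => r ⬝ x ⬝ v) z)
      (domPath X F G Y l r H))
  (piDomCocone fun X F G Y _ _ _ => arr (dom X F G) Y)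

def domRecGlue (X F G Y l r H : Sc) : Sc := apps (const 44) [X, F, G, Y, l, r, H]

/-- `pbInd` is transparent and computes at `pbPair`, whose path is `refl`. The general rule
`recGlue` therefore has this type up to conversion. -/
def domRecGlueEntry : Entry := lem
  (lamDomCocone fun X F G Y l r H => Λ x, Λ u, Λ v,
    recGlue (total X F) (total X G) (pb X F G)
      (pullbackFst (total X F) (total X G) X (proj X F) (proj X G))
      (pullbackSnd (total X F) (total X G) X (proj X F) (proj X G)) Y
      (Λ z, sigmaElim (fun _ => Y) (fun x u => l ⬝ x ⬝ u) z)
      (Λ z, sigmaElim (fun _ => Y) (fun x v => r ⬝ x ⬝ v) z)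
      (domPath X F G Y l r H) (pbPair X F G x u v))
  (piDomCocone fun X F G Y l r H =>
    pi X fun x => pi (F ⬝ x) fun u => pi (G ⬝ x) fun v =>
    id (id Y (l ⬝ x ⬝ u) (r ⬝ x ⬝ v))
      (ap (dom X F G) Y (domRec X F G Y l r H) (domLeft X F G x u) (domRight X F G x v)
        (domGlue X F G x u v))
      (H ⬝ x ⬝ u ⬝ v))

/-- `joinMap` maps the path constructor to a constant path. -/
def mapGlue (X F G x u v : Sc) : Sc := apps (const 45) [X, F, G, x, u, v]

/-- At `pbPair x u v` the homotopy `pullbackPath` computes to `refl x`. -/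
def mapGlueEntry : Entry := lem
  (lamFam fun X F G => Λ x, Λ u, Λ v,
    recGlue (total X F) (total X G) (pb X F G)
      (pullbackFst (total X F) (total X G) X (proj X F) (proj X G))
      (pullbackSnd (total X F) (total X G) X (proj X F) (proj X G)) X (proj X F) (proj X G)
      (pullbackPath (total X F) (total X G) X (proj X F) (proj X G)) (pbPair X F G x u v))
  (piFam fun X F G => pi X fun x => pi (F ⬝ x) fun u => pi (G ⬝ x) fun v =>
    id (id X x x)
      (ap (dom X F G) X (map X F G) (domLeft X F G x u) (domRight X F G x v)
        (domGlue X F G x u v))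
      (refl x))

/-! ### The total space of the joins of the fibers -/

/-- The fiberwise join. -/
def fam (X F G : Sc) : Sc := apps (const 46) [X, F, G]

def famEntry : Entry := defn
  (lamFam fun _ F G => Λ x, join (F ⬝ x) (G ⬝ x))
  (piFam fun X _ _ => arr X univ)

def famLeft (X F G x u : Sc) : Sc := apps (const 47) [X, F, G, x, u]

def famLeftEntry : Entry := defn
  (lamFam fun _ _ _ => Λ _, Λ u, vert (inl u))
  (piFam fun X F G => pi X fun x => arr (F ⬝ x) (fam X F G ⬝ x))

def famRight (X F G x v : Sc) : Sc := apps (const 48) [X, F, G, x, v]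

def famRightEntry : Entry := defn
  (lamFam fun _ _ _ => Λ _, Λ v, vert (inr v))
  (piFam fun X F G => pi X fun x => arr (G ⬝ x) (fam X F G ⬝ x))

def famGlue (X F G x u v : Sc) : Sc := apps (const 49) [X, F, G, x, u, v]

def famGlueEntry : Entry := defn
  (lamFam fun _ F G => Λ x, Λ u, Λ v,
    glue (F ⬝ x) (G ⬝ x) (prod (F ⬝ x) (G ⬝ x)) (prodFst (F ⬝ x) (G ⬝ x)) (prodSnd (F ⬝ x) (G ⬝ x))
      (pair u v))
  (piFam fun X F G => pi X fun x => pi (F ⬝ x) fun u => pi (G ⬝ x) fun v =>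
    id (fam X F G ⬝ x) (famLeft X F G x u) (famRight X F G x v))

def famInd (X F G x P l r H j : Sc) : Sc := apps (const 50) [X, F, G, x, P, l, r, H, j]

def famIndEntry : Entry := lem
  (lamFam fun _ F G => Λ x, Λ P, Λ l, Λ r, Λ H, Λ j,
    let f : Sc := prodFst (F ⬝ x) (G ⬝ x)
    let g : Sc := prodSnd (F ⬝ x) (G ⬝ x)
    pushoutInd (F ⬝ x) (G ⬝ x) (prod (F ⬝ x) (G ⬝ x)) f g P l r
      (Λ c, sigmaElim (fun c => id (P ⬝ vert (inr (g ⬝ c)))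
          (tr (join (F ⬝ x) (G ⬝ x)) P (vert (inl (f ⬝ c))) (vert (inr (g ⬝ c)))
            (glue (F ⬝ x) (G ⬝ x) (prod (F ⬝ x) (G ⬝ x)) f g c) (l ⬝ (f ⬝ c)))
          (r ⬝ (g ⬝ c)))
        (fun u v => H ⬝ u ⬝ v) c)
      j)
  (piFam fun X F G => pi X fun x => pi (arr (fam X F G ⬝ x) univ) fun P =>
    pi (pi (F ⬝ x) fun u => P ⬝ famLeft X F G x u) fun l =>
    pi (pi (G ⬝ x) fun v => P ⬝ famRight X F G x v) fun r =>
    arr (pi (F ⬝ x) fun u => pi (G ⬝ x) fun v => id (P ⬝ famRight X F G x v)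
        (tr (fam X F G ⬝ x) P (famLeft X F G x u) (famRight X F G x v) (famGlue X F G x u v)
          (l ⬝ u))
        (r ⬝ v))
      (pi (fam X F G ⬝ x) fun j => P ⬝ j))

/-- The map from the fiberwise join to the domain. -/
def ofFam (X F G x : Sc) : Sc := apps (const 51) [X, F, G, x]

/-- The local `domLeft` and `domRight` are the constants of the same names without their last
argument, that is, maps out of `F x` and `G x`. -/
def ofFamEntry : Entry := defn
  (lamFam fun X F G => Λ x,
    pushoutRec (F ⬝ x) (G ⬝ x) (prod (F ⬝ x) (G ⬝ x)) (prodFst (F ⬝ x) (G ⬝ x))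
      (prodSnd (F ⬝ x) (G ⬝ x)) (dom X F G) (domLeft X F G x) (domRight X F G x)
      (Λ c, domGlue X F G x (prodFst (F ⬝ x) (G ⬝ x) ⬝ c) (prodSnd (F ⬝ x) (G ⬝ x) ⬝ c)))
  (piFam fun X F G => pi X fun x => arr (fam X F G ⬝ x) (dom X F G))
where
  domLeft (X F G x : Sc) : Sc := apps (const 38) [X, F, G, x]
  domRight (X F G x : Sc) : Sc := apps (const 39) [X, F, G, x]

def ofFamGlue (X F G x u v : Sc) : Sc := apps (const 52) [X, F, G, x, u, v]

def ofFamGlueEntry : Entry := lem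
  (lamFam fun X F G => Λ x, Λ u, Λ v,
    recGlue (F ⬝ x) (G ⬝ x) (prod (F ⬝ x) (G ⬝ x)) (prodFst (F ⬝ x) (G ⬝ x))
      (prodSnd (F ⬝ x) (G ⬝ x)) (dom X F G) (ofFamEntry.domLeft X F G x)
      (ofFamEntry.domRight X F G x)
      (Λ c, domGlue X F G x (prodFst (F ⬝ x) (G ⬝ x) ⬝ c) (prodSnd (F ⬝ x) (G ⬝ x) ⬝ c))
      (pair u v))
  (piFam fun X F G => pi X fun x => pi (F ⬝ x) fun u => pi (G ⬝ x) fun v =>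
    id (id (dom X F G) (domLeft X F G x u) (domRight X F G x v))
      (ap (fam X F G ⬝ x) (dom X F G) (ofFam X F G x) (famLeft X F G x u) (famRight X F G x v)
        (famGlue X F G x u v))
      (domGlue X F G x u v))

/-- The total space of the fiberwise joins. -/
def tot (X F G : Sc) : Sc := total X (fam X F G)

def totPair (X F G x j : Sc) : Sc := apps (const 53) [X, F, G, x, j]

def totPairEntry : Entry := defn
  (lamFam fun _ _ _ => Λ x, Λ j, pair x j)
  (piFam fun X F G => pi X fun x => arr (fam X F G ⬝ x) (tot X F G))

def totGlue (X F G x u v : Sc) : Sc := apps (const 54) [X, F, G, x, u, v]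

/-- The image of `famGlue` under the inclusion `j ↦ (x, j)` of the fiber; the inclusion is `totPair`
(number 53) without its last argument. -/
def totGlueEntry : Entry := defn
  (lamFam fun X F G => Λ x, Λ u, Λ v,
    ap (fam X F G ⬝ x) (tot X F G) (apps (const 53) [X, F, G, x]) (famLeft X F G x u)
      (famRight X F G x v) (famGlue X F G x u v))
  (piFam fun X F G => pi X fun x => pi (F ⬝ x) fun u => pi (G ⬝ x) fun v =>
    id (tot X F G) (totPair X F G x (famLeft X F G x u)) (totPair X F G x (famRight X F G x v)))

/-- The map from the domain to the total space. -/
def toTot (X F G : Sc) : Sc := apps (const 55) [X, F, G]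

def toTotEntry : Entry := defn
  (lamFam fun X F G => domRec X F G (tot X F G) (Λ x, Λ u, totPair X F G x (famLeft X F G x u))
    (Λ x, Λ v, totPair X F G x (famRight X F G x v)) (apps (const 54) [X, F, G]))
  (piFam fun X F G => arr (dom X F G) (tot X F G))

def toTotGlue (X F G x u v : Sc) : Sc := apps (const 56) [X, F, G, x, u, v]

def toTotGlueEntry : Entry := lem
  (lamFam fun X F G => domRecGlue X F G (tot X F G)
    (Λ x, Λ u, totPair X F G x (famLeft X F G x u))
    (Λ x, Λ v, totPair X F G x (famRight X F G x v)) (apps (const 54) [X, F, G]))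
  (piFam fun X F G => pi X fun x => pi (F ⬝ x) fun u => pi (G ⬝ x) fun v =>
    id (id (tot X F G) (totPair X F G x (famLeft X F G x u)) (totPair X F G x (famRight X F G x v)))
      (ap (dom X F G) (tot X F G) (toTot X F G) (domLeft X F G x u) (domRight X F G x v)
        (domGlue X F G x u v))
      (totGlue X F G x u v))

def ofTot (X F G : Sc) : Sc := apps (const 57) [X, F, G]

def ofTotEntry : Entry := defn
  (lamFam fun X F G => Λ z, sigmaElim (fun _ => dom X F G) (fun x j => ofFam X F G x ⬝ j) z)
  (piFam fun X F G => arr (tot X F G) (dom X F G))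

/-! ### The two maps are inverse to each other -/

def toTotOfTot (X F G : Sc) : Sc := apps (const 58) [X, F, G]

/-- By induction on the fiberwise join. Both sides agree on points by conversion. On `famGlue` the
composite first gives `domGlue` and then `totGlue`, and `totGlue` unfolds to the action of `j ↦ (x,
j)`, the other side of the square. -/
def toTotOfTotEntry : Entry := lem
  (lamFam fun X F G => Λ z,
    let T := tot X F G
    sigmaElim (fun z => id T (toTot X F G ⬝ (ofTot X F G ⬝ z)) z)
      (fun x j =>
        let k : Sc := Λ j, toTot X F G ⬝ (ofFam X F G x ⬝ j)
        let l (u : Sc) : Sc := totPair X F G x (famLeft X F G x u)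
        let r (v : Sc) : Sc := totPair X F G x (famRight X F G x v)
        famInd X F G x (Λ j, id T (k ⬝ j) (apps (const 53) [X, F, G, x] ⬝ j))
          (Λ u, refl (l u)) (Λ v, refl (r v))
          (Λ u, Λ v,
            let a := famLeft X F G x u
            let b := famRight X F G x v
            let p := famGlue X F G x u v
            trPath (fam X F G ⬝ x) T k (apps (const 53) [X, F, G, x]) a b p
              (refl (l u)) (refl (r v))
              (eqConcatRefl T (l u) (r v) (ap (fam X F G ⬝ x) T k a b p) (totGlue X F G x u v)
                (apComp (fam X F G ⬝ x) (dom X F G) T (ofFam X F G x) (toTot X F G) a b p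
                  (domGlue X F G x u v) (totGlue X F G x u v) (ofFamGlue X F G x u v)
                  (toTotGlue X F G x u v))))
          j)
      z)
  (piFam fun X F G => pi (tot X F G) fun z =>
    id (tot X F G) (toTot X F G ⬝ (ofTot X F G ⬝ z)) z)

def ofTotToTot (X F G : Sc) : Sc := apps (const 59) [X, F, G]

/-- On `domGlue`, `toTot` gives `totGlue`, which is the image of `famGlue` under `j ↦ (x, j)`.
Followed by `ofTot`, this inclusion is `ofFam x` up to conversion, so `ofFamGlue` returns `domGlue`.
-/
def ofTotToTotEntry : Entry := lem
  (lamFam fun X F G => Λ w,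
    let T := dom X F G
    let k : Sc := Λ w, ofTot X F G ⬝ (toTot X F G ⬝ w)
    domInd X F G (Λ w, id T (k ⬝ w) w) (Λ x, Λ u, refl (domLeft X F G x u))
      (Λ x, Λ v, refl (domRight X F G x v))
      (Λ x, Λ u, Λ v,
        let a := domLeft X F G x u
        let b := domRight X F G x v
        let p := domGlue X F G x u v
        trPath T T k (Λ w, w) a b p (refl a) (refl b)
          (eqConcatRefl T a b (ap T T k a b p) (ap T T (Λ w, w) a b p)
            (eqTrans (id T a b) (ap T T k a b p) p (ap T T (Λ w, w) a b p)
              (apComp T (tot X F G) T (toTot X F G) (ofTot X F G) a b p (totGlue X F G x u v) p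
                (toTotGlue X F G x u v)
                (apAp (fam X F G ⬝ x) (tot X F G) T (apps (const 53) [X, F, G, x]) (ofTot X F G)
                  (famLeft X F G x u) (famRight X F G x v) (famGlue X F G x u v) p
                  (ofFamGlue X F G x u v)))
              (apId T a b p))))
      w)
  (piFam fun X F G => pi (dom X F G) fun w =>
    id (dom X F G) (ofTot X F G ⬝ (toTot X F G ⬝ w)) w)

def projToTot (X F G : Sc) : Sc := apps (const 60) [X, F, G]

/-- The equivalence lies over `X`: both maps send `domGlue` to a constant path, the first because `j
↦ (x, j)` followed by the projection is constant, the second by `mapGlue`. -/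
def projToTotEntry : Entry := lem
  (lamFam fun X F G => Λ w,
    let T := dom X F G
    let k : Sc := Λ w, proj X (fam X F G) ⬝ (toTot X F G ⬝ w)
    domInd X F G (Λ w, id X (k ⬝ w) (map X F G ⬝ w)) (Λ x, Λ _, refl x) (Λ x, Λ _, refl x)
      (Λ x, Λ u, Λ v,
        let a := domLeft X F G x u
        let b := domRight X F G x v
        let p := domGlue X F G x u v
        trPath T X k (map X F G) a b p (refl x) (refl x)
          (eqConcatRefl X x x (ap T X k a b p) (ap T X (map X F G) a b p)
            (eqTrans (id X x x) (ap T X k a b p) (refl x) (ap T X (map X F G) a b p)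
              (apComp T (tot X F G) X (toTot X F G) (proj X (fam X F G)) a b p
                (totGlue X F G x u v) (refl x) (toTotGlue X F G x u v)
                (apAp (fam X F G ⬝ x) (tot X F G) X (apps (const 53) [X, F, G, x])
                  (proj X (fam X F G)) (famLeft X F G x u) (famRight X F G x v)
                  (famGlue X F G x u v) (refl x)
                  (apConst (fam X F G ⬝ x) X x (famLeft X F G x u) (famRight X F G x v)
                    (famGlue X F G x u v))))
              (mapGlue X F G x u v))))
      w)
  (piFam fun X F G => pi (dom X F G) fun w =>
    id X (proj X (fam X F G) ⬝ (toTot X F G ⬝ w)) (map X F G ⬝ w))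

end Sc

end HoTT

/-! ### Reduction of arbitrary maps to projections by univalence -/

namespace HoTT

open Tm (pushoutRecVert)

namespace Sc

/-! ### Equivalences -/

def equivFun (A B e : Sc) : Sc := apps (const 61) [A, B, e]

def equivFunEntry : Entry := defn
  (Λ A, Λ B, Λ e, sigmaElim (fun _ => arr A B) (fun f _ => f) e)
  (pi univ fun A => pi univ fun B => arr (equiv A B) (arr A B))

/-- Equivalence induction for maps to `X`. -/
def equivInd (X P B h A e q : Sc) : Sc := apps (const 62) [X, P, B, h, A, e, q]

/-- The section in `ua` presents `e` as `idToEquiv p` for some `p : A = B`. After transport along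
this identification, path induction on `p`, with `h` and `q` generalized, leaves the identity
equivalence, for which `Λ a, h ⬝ a` is `h` by `eta`. -/
def equivIndEntry : Entry := lem
  (Λ X, Λ P, Λ B, Λ h, Λ A, Λ e, Λ q,
    let goal (e : Sc) : Sc := P ⬝ A ⬝ (Λ a, h ⬝ (equivFun A B e ⬝ a))
    let idEquiv : Sc := fun _ => Tm.idEquiv
    sigmaElim (fun _ => goal e)
      (fun s _ => sigmaElim (fun _ => goal e)
        (fun g ε => transport goal (ε ⬝ e)
          (J (fun Y p => pi (arr Y X) fun h => arr (P ⬝ Y ⬝ h)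
              (P ⬝ A ⬝ (Λ a, h ⬝ (equivFun A Y (J (fun Z _ => equiv A Z) idEquiv p) ⬝ a))))
            (Λ _, Λ q, q) (g ⬝ e) ⬝ h ⬝ q))
        s)
      (ua A B))
  (pi univ fun X => pi (pi univ fun A => arr (arr A X) univ) fun P => pi univ fun B =>
    pi (arr B X) fun h => pi univ fun A => pi (equiv A B) fun e =>
    arr (P ⬝ B ⬝ h) (P ⬝ A ⬝ (Λ a, h ⬝ (equivFun A B e ⬝ a))))

/-- The fiber of the projection of a family. -/
def fibProj (X F x : Sc) : Sc := apps (const 63) [X, F, x]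

/-- A point `((y, u), p)` of the fiber goes to the transport of `u` along `p`. One composite is the
identity by computation, the other by path induction on `p`. -/
def fibProjEntry : Entry := lem
  (Λ X, Λ F, Λ x,
    let T (y : Sc) : Sc := fib (total X F) X (proj X F) y
    let f (y w : Sc) : Sc := sigmaElim (fun _ => F ⬝ y)
      (fun z p => sigmaElim (fun z => arr (id X (proj X F ⬝ z) y) (F ⬝ y))
        (fun x u => Λ p, tr X F x y p u) z ⬝ p) w
    let g (y u : Sc) : Sc := pair (pair y u) (refl y)
    pair (Λ w, f x w)
      (pair (pair (Λ u, g x u) (Λ u, refl u))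
        (pair (Λ u, g x u)
          (Λ w, sigmaElim (fun w => id (T x) (g x (f x w)) w)
            (fun z p => sigmaElim
              (fun z => pi (id X (proj X F ⬝ z) x) fun p =>
                id (T x) (g x (sigmaElim (fun z => arr (id X (proj X F ⬝ z) x) (F ⬝ x))
                  (fun y u => Λ p, tr X F y x p u) z ⬝ p)) (pair z p))
              (fun y u => Λ p, J (fun x p => id (T x) (g x (tr X F y x p u)) (pair (pair y u) p))
                (refl (g y u)) p) z ⬝ p) w))))
  (pi univ fun X => pi (arr X univ) fun F => pi X fun x =>
    equiv (fib (total X F) X (proj X F) x) (F ⬝ x))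

/-- Replacement of a map by an equivalent one. -/
def fibEquiv (A B X e f g s x Y q : Sc) : Sc := apps (const 64) [A, B, X, e, f, g, s, x, Y, q]

/-- Function extensionality makes the homotopy `s` a path from `g ∘ e` to `f`. It remains to treat
`g ∘ e`, which equivalence induction reduces to `g`. -/
def fibEquivEntry : Entry := lem
  (Λ A, Λ B, Λ X, Λ e, Λ f, Λ g, Λ s, Λ x, Λ Y, Λ q,
    let f' : Sc := Λ a, g ⬝ (equivFun A B e ⬝ a)
    let goal (f : Sc) : Sc := equiv (fib A X f x) Y
    sigmaElim (fun _ => goal f)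
      (fun r _ => transport goal
        (sigmaElim (fun _ => id (arr A X) f' f) (fun k _ => k ⬝ s) r)
        (equivInd X (Λ A, Λ f, equiv (fib A X f x) Y) B g A e q))
      (funext A (fun _ => X) f' f))
  (pi univ fun A => pi univ fun B => pi univ fun X => pi (equiv A B) fun e =>
    pi (arr A X) fun f => pi (arr B X) fun g =>
    pi (pi A fun a => id X (g ⬝ (equivFun A B e ⬝ a)) (f ⬝ a)) fun _ => pi X fun x =>
    pi univ fun Y => arr (equiv (fib B X g x) Y) (equiv (fib A X f x) Y))

/-- The equivalence of a type with the total space of the fibers of a map. -/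
def equivTotal (A X f : Sc) : Sc := apps (const 65) [A, X, f]

/-- The family of the fibers of a map. -/
def fibers (A X f : Sc) : Sc := apps (const 32) [A, X, f]

/-- The pair `(x, p : f a = x)` is contracted by path induction. The definition has to be
transparent: `fibJoinEntry` relies on the projection of the image of `a` computing to `f a`. -/
def equivTotalEntry : Entry := defn
  (Λ A, Λ X, Λ f,
    let S := total X (fibers A X f)
    let i (a : Sc) : Sc := pair (f ⬝ a) (pair a (refl (f ⬝ a)))
    let r (z : Sc) : Sc := sigmaElim (fun _ => A)
      (fun _ w => sigmaElim (fun _ => A) (fun a _ => a) w) z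
    pair (Λ a, i a)
      (pair
        (pair (Λ z, r z) (Λ z, sigmaElim (fun z => id S (i (r z)) z)
          (fun x w => sigmaElim
            (fun w => id S (i (sigmaElim (fun _ => A) (fun a _ => a) w)) (pair x w))
            (fun a p => J (fun y p => id S (i a) (pair y (pair a p))) (refl (i a)) p) w) z))
        (pair (Λ z, r z) (Λ a, refl a))))
  (pi univ fun A => pi univ fun X => pi (arr A X) fun f => equiv A (total X (fibers A X f)))

/-! ### The fibers of the join of two maps -/

def fibJoinProj (X F G x : Sc) : Sc := apps (const 66) [X, F, G, x]

/-- The domain of the join of the projections is equivalent over `X` to the total space of the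
fiberwise joins, and the fiber of the latter's projection is the fiberwise join itself. -/
def fibJoinProjEntry : Entry := lem
  (lamFam fun X F G => Λ x,
    fibEquiv (dom X F G) (tot X F G) X
      (pair (toTot X F G)
        (pair (pair (ofTot X F G) (toTotOfTot X F G)) (pair (ofTot X F G) (ofTotToTot X F G))))
      (map X F G) (proj X (fam X F G)) (projToTot X F G) x (fam X F G ⬝ x)
      (fibProj X (fam X F G) x))
  (piFam fun X F G => pi X fun x =>
    equiv (fib (dom X F G) X (map X F G) x) (fam X F G ⬝ x))

/-- The type of the theorem for two maps to `X`. -/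
def fibJoinGoal (A B X f g x Y : Sc) : Sc :=
  equiv (fib (joinDom A B X f g) X (joinMap A B X f g) x) Y

/-- Equivalence induction is applied to `f` and then to `g`, with the join `Y` of the original
fibers held fixed. It produces the statement for the projection composed with `equivTotal`, which is
`f`, respectively `g`, by computation and `eta`. For projections, `fam X F G ⬝ x` unfolds to `Y`. -/
def fibJoinEntry : Entry := lem
  (Λ A, Λ B, Λ X, Λ f, Λ g, Λ x,
    let F := fibers A X f
    let G := fibers B X g
    let Y := join (fib A X f x) (fib B X g x)
    equivInd X (Λ A, Λ f, fibJoinGoal A B X f g x Y) (total X F) (proj X F) A (equivTotal A X f)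
      (equivInd X (Λ B, Λ g, fibJoinGoal (total X F) B X (proj X F) g x Y) (total X G) (proj X G) B
        (equivTotal B X g) (fibJoinProj X F G x)))
  (pi univ fun A => pi univ fun B => pi univ fun X => pi (arr A X) fun f => pi (arr B X) fun g =>
    pi X fun x => fibJoinGoal A B X f g x (join (fib A X f x) (fib B X g x)))

/-- The type of the theorem. -/
def goalType : Tm :=
  .pi .univ (.pi .univ (.pi .univ
    (.pi (.arr (.var 2) (.var 0))
      (.pi (.arr (.var 2) (.var 1))
        (.pi (.var 2)
          (.equiv
            (.hfib (.joinDom (.var 5) (.var 4) (.var 3) (.var 2) (.var 1)) (.var 3)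
              (.joinMap (.var 5) (.var 4) (.var 3) (.var 2) (.var 1)) (.var 0))
            (.join (.hfib (.var 5) (.var 3) (.var 2) (.var 0))
              (.hfib (.var 4) (.var 3) (.var 1) (.var 0)))))))))

/-- The term is just `fibJoinEntry`. Testing this item amounts to a conversion between its type,
built from the definitions, and the type of the theorem, in which everything is spelled out. -/
def goalEntry : Entry := ⟨.var 67, goalType, false⟩

/-- The type of the map on edges that underlies the join of two maps, over `A`, `B`, `X`, `f`
and `g`. -/
def edgeMapType : Tm :=
  .pi (.sum (.var 4) (.var 3)) (.pi (.sum (.var 5) (.var 4))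
    (.pi (.app (.app ((Tm.pushoutEdge (.var 4) (.var 3)
        (.pullback (.var 4) (.var 3) (.var 2) (.var 1) (.var 0)) (.pullbackFst (.var 4))
        (.pullbackSnd (.var 3))).wk 2) (.var 1)) (.var 0))
      (.id (.var 5) (.app ((pushoutRecVert (.var 2) (.var 1) (.var 0)).wk 3) (.var 2))
        (.app ((pushoutRecVert (.var 2) (.var 1) (.var 0)).wk 3) (.var 1)))))

/-- Types for the terms in `goalType` whose types cannot be inferred. -/
def hint (n : ℕ) : Tm → Option Tm
  -- Hints are stated over the first five variables `A`, `B`, `X`, `f`, `g`, so over `n` variables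
  -- they are weakened by `n - 5`.
  | .inl _ => some ((Tm.sum (.var 4) (.var 3)).wk (n - 5))
  | .inr _ => some ((Tm.sum (.var 4) (.var 3)).wk (n - 5))
  | .pair _ _ => some ((Tm.pullback (.var 4) (.var 3) (.var 2) (.var 1) (.var 0)).wk (n - 5))
  | .lam (.lam (.lam _)) => some (edgeMapType.wk (n - 5))
  | .lam (.lam (.sigma _ _)) =>
    some ((Tm.arr (.sum (.var 4) (.var 3)) (Tm.arr (.sum (.var 4) (.var 3)) .univ)).wk (n - 5))
  | _ => none

end Sc

end HoTT

/-! ### Evaluation of the checker on the sequence of definitions -/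

namespace HoTT

namespace Sc

/-- The definitions and lemmas, in the order of their numbers. -/
def definitions : List Entry :=
  [trEntry, concatEntry, apEntry, concatReflEntry, eqConcatReflEntry, eqTransEntry, apCompEntry,
    apApEntry, apIdEntry, apConstEntry, trPathEntry, pushoutEdgeEntry, pushoutEntry, leftEntry,
    rightEntry, glueEntry, recVertEntry, recEdgeEntry, pushoutRecEntry, apOfApdEntry, recGlueEntry,
    indVertEntry, pushoutIndEntry, prodFstEntry, prodSndEntry, joinEntry, pullbackEntry,
    pullbackFstEntry, pullbackSndEntry, pullbackPathEntry, joinDomEntry, joinMapEntry, fibEntry,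
    totalEntry, projEntry, pbEntry, pbPairEntry, pbIndEntry, domLeftEntry, domRightEntry,
    domGlueEntry, domIndEntry, domPathEntry, domRecEntry, domRecGlueEntry, mapGlueEntry, famEntry,
    famLeftEntry, famRightEntry, famGlueEntry, famIndEntry, ofFamEntry, ofFamGlueEntry,
    totPairEntry, totGlueEntry, toTotEntry, toTotGlueEntry, ofTotEntry, toTotOfTotEntry,
    ofTotToTotEntry, projToTotEntry, equivFunEntry, equivIndEntry, fibProjEntry, fibEquivEntry,
    equivTotalEntry, fibJoinProjEntry, fibJoinEntry, goalEntry]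

theorem forall_of_all_range' {p : ℕ → Bool} {m n : ℕ}
    (h : (List.range' m (n - m)).all p = true) : ∀ i, m ≤ i → i < n → p i = true :=
  fun i h₁ h₂ => List.all_eq_true.mp h i (List.mem_range'_1.mpr ⟨h₁, by omega⟩)

/-- The evaluations are split into ranges. The three homotopies 58, 59, 60 and the last two items,
67 and 68, are each evaluated separately. -/
theorem testEntry_0 : ∀ i, 0 ≤ i → i < 42 → testEntry hint definitions i = true :=
  forall_of_all_range' (by decide +kernel)

theorem testEntry_42 : ∀ i, 42 ≤ i → i < 58 → testEntry hint definitions i = true :=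
  forall_of_all_range' (by decide +kernel)

theorem testEntry_58 : ∀ i, 58 ≤ i → i < 59 → testEntry hint definitions i = true :=
  forall_of_all_range' (by decide +kernel)

theorem testEntry_59 : ∀ i, 59 ≤ i → i < 60 → testEntry hint definitions i = true :=
  forall_of_all_range' (by decide +kernel)

theorem testEntry_60 : ∀ i, 60 ≤ i → i < 61 → testEntry hint definitions i = true :=
  forall_of_all_range' (by decide +kernel)

theorem testEntry_61 : ∀ i, 61 ≤ i → i < 67 → testEntry hint definitions i = true :=
  forall_of_all_range' (by decide +kernel)

theorem testEntry_67 : ∀ i, 67 ≤ i → i < 68 → testEntry hint definitions i = true :=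
  forall_of_all_range' (by decide +kernel)

theorem testEntry_68 : ∀ i, 68 ≤ i → i < 69 → testEntry hint definitions i = true :=
  forall_of_all_range' (by decide +kernel)

theorem testEntry_definitions (i : ℕ) (hi : i < 69) : testEntry hint definitions i = true := by
  by_cases h68 : 68 ≤ i
  · exact testEntry_68 i h68 (by omega)
  by_cases h67 : 67 ≤ i
  · exact testEntry_67 i h67 (by omega)
  by_cases h61 : 61 ≤ i
  · exact testEntry_61 i h61 (by omega)
  by_cases h60 : 60 ≤ i
  · exact testEntry_60 i h60 (by omega)
  by_cases h59 : 59 ≤ i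
  · exact testEntry_59 i h59 (by omega)
  by_cases h58 : 58 ≤ i
  · exact testEntry_58 i h58 (by omega)
  by_cases h42 : 42 ≤ i
  · exact testEntry_42 i h42 (by omega)
  exact testEntry_0 i (Nat.zero_le i) (by omega)

theorem exists_derives_goalType : ∃ e, Derives [] (e ∶ goalType) := by
  obtain ⟨σ, hσ⟩ := exists_realized (hint := hint) (l := definitions) (k := 69)
    testEntry_definitions
  have h := (hσ 68 goalEntry rfl).1
  -- Truncation at `0` replaces every free variable by `star`, so this says that `goalType` is
  -- closed and hence unaffected by the realization.
  have hT : Tm.beq (goalType.truncate 0) goalType = true := by decide +kernel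
  have hs : goalType.subst σ = goalType.subst .var :=
    Tm.subst_of_truncate hT fun i hi => absurd hi i.not_lt_zero
  rw [Tm.subst_var] at hs
  exact ⟨σ 68, hs ▸ h⟩

end Sc

end HoTT

/-- Homotopy type theory has a closed term of type
`∏ (A B X : U) (f : A → X) (g : B → X) (x : X), hfib (f * g) x ≃ hfib f x * hfib g x`.
Under the six binders, `A, B, X, f, g, x` are the variables `5, 4, 3, 2, 1, 0`. -/
theorem mainTheorem3 :
    ∃ e : HoTT.Tm, HoTT.Derives []
      (HoTT.Judgment.hasType e
        (.pi .univ (.pi .univ (.pi .univ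
          (.pi (.arr (.var 2) (.var 0))
            (.pi (.arr (.var 2) (.var 1))
              (.pi (.var 2)
                (.equiv
                  (.hfib (.joinDom (.var 5) (.var 4) (.var 3) (.var 2) (.var 1)) (.var 3)
                    (.joinMap (.var 5) (.var 4) (.var 3) (.var 2) (.var 1)) (.var 0))
                  (.join (.hfib (.var 5) (.var 3) (.var 2) (.var 0))
                    (.hfib (.var 4) (.var 3) (.var 1) (.var 0))))))))))) :=
  HoTT.Sc.exists_derives_goalType
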